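/- Let $(M,g)$ be a connected closed (compact, without boundary) smooth Riemannian manifold of dimension $d\ge 2$, let $T'M=T^*M\setminus\{0\}$, and let $h(x,\xi)=\left(g^{\alpha\beta}(x)\,\xi_\alpha\xi_\beta\right)^{1/2}$. Let $(x^*(t;y,\eta),\xi^*(t;y,\eta))$, $t\in\mathbb R$, $(y,\eta)\in T'M$, be the (globally defined) cogeodesic flow, that is, the solution in $T'M$ of Hamilton's equations $\dot x^*=h_\xi(x^*,\xi^*)$, $\dot \xi^*=-h_x(x^*,\xi^*)$ with initial condition $(x^*,\xi^*)|_{t=0}=(y,\eta)$. For $y\in M$ and $t\in\mathbb R$ put $$\mathcal T_y(t)=\{(x^*(t;y,\eta),\xi^*(t;y,\eta))\in T^*M \mid \eta\in T'_yM\}.$$ Using $\eta\in T'_yM$ as coordinates on $\mathcal T_y(t)$, define on it the position form $Q$ and the momentum form $P$ by $$Q^{\mu\nu}=g_{\alpha\beta}(x^*)\,q^{\alpha\mu}q^{\beta\nu},\qquad q^{\alpha\mu}=\frac{\partial x^{*\alpha}}{\partial\eta_\mu},$$ $$P^{\mu\nu}=g_{\alpha\beta}(x^*)\,p^{\alpha\mu}p^{\beta\nu},\qquad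 p^{\alpha\mu}=g^{\alpha\gamma}(x^*)\left[\frac{\partial\xi^*_\gamma}{\partial\eta_\mu}-\Gamma^\rho{}_{\gamma\beta}(x^*)\,\xi^*_\rho\,\frac{\partial x^{*\beta}}{\partial\eta_\mu}\right],$$ where $\Gamma$ are the Christoffel symbols of $g$; the tensors $Q$ and $P$ take the values $Q^{\mu\nu}\delta\eta_\mu\,\delta\eta'_\nu$ and $P^{\mu\nu}\delta\eta_\mu\,\delta\eta'_\nu$ on the tangent vectors of $\mathcal T_y(t)$ that correspond to the increments $\delta\eta,\delta\eta'\in T^*_yM$. Then for all $y\in M$ and $t\in\mathbb R$ the set $\mathcal T_y(t)$ is a smooth embedded $d$-dimensional Lagrangian submanifold of $T^*M$, the map $\eta\mapsto(x^*(t;y,\eta),\xi^*(t;y,\eta))$ is a diffeomorphism of $T'_yM$ onto it, and for all real $a,b>0$ the linear combination $$a\,h^2\,Q+b\,P,\qquad h=h(y,\eta),$$ is a smooth Riemannian metric on $\mathcal T_y(t)$. Neither $Q$ nor $P$ need be a Riemannian metric on its own: there are a connected closed Riemannian manifold of dimension at least $2$, a point $y$ and a time $t$ for which neither $Q$ nor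 $P$ is a Riemannian metric on $\mathcal T_y(t)$. -/

import Mathlib

open scoped Manifold ContDiff Topology

noncomputable section

namespace Cogeodesic

/-- Coordinate space `ℝ^d` of vectors. -/
abbrev Vec (d : ℕ) : Type := EuclideanSpace ℝ (Fin d)

/-- Coordinate space of covectors. -/
abbrev Covec (d : ℕ) : Type := Vec d →L[ℝ] ℝ

/-- The cotangent space `T*_x M`. Mathlib's `TangentSpace (𝓡 d) x` is `Vec d`, a vector being given
by its components in the preferred chart at `x`; accordingly `T*_x M` is `Covec d`. -/
abbrev Cotangent (d : ℕ) {M : Type*} [TopologicalSpace M] [ChartedSpace (Vec d) M] (x : M) : Type :=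
  TangentSpace (𝓡 d) x →L[ℝ] ℝ

/-- The cotangent bundle `T*M`, with Mathlib's topology and smooth structure of the bundle of
continuous linear maps from the tangent bundle to the trivial line bundle. Its preferred chart at
`p` consists of the canonical coordinates `(x^α, ξ_α)` induced by the preferred chart of `M` at the
base point of `p`. -/
abbrev CotangentBundle (d : ℕ) (M : Type*) [TopologicalSpace M] [ChartedSpace (Vec d) M]
    [IsManifold (𝓡 d) ∞ M] : Type _ :=
  Bundle.TotalSpace (Covec d) (fun x : M => Cotangent d x)

/-- The model with corners of the cotangent bundle. -/
abbrev cotangentModel (d : ℕ) :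
    ModelWithCorners ℝ (Vec d × Covec d) (ModelProd (Vec d) (Covec d)) :=
  (𝓡 d).prod 𝓘(ℝ, Covec d)

/-- A smooth Riemannian metric on the manifold `M`. -/
abbrev RiemMetric (d : ℕ) (M : Type*) [TopologicalSpace M] [ChartedSpace (Vec d) M]
    [IsManifold (𝓡 d) ∞ M] : Type _ :=
  Bundle.ContMDiffRiemannianMetric (𝓡 d) ∞ (Vec d) (fun x : M => TangentSpace (𝓡 d) x)

/-- The punctured cotangent fibre `T'_y M = T*_y M \ {0}`, as an open subset of `T*_y M`. -/
abbrev PuncturedFibre (d : ℕ) : TopologicalSpace.Opens (Covec d) :=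
  ⟨{0}ᶜ, isOpen_compl_singleton⟩

variable {d : ℕ} {M : Type*} [TopologicalSpace M] [ChartedSpace (Vec d) M] [IsManifold (𝓡 d) ∞ M]

/-- The point `(y, η)` of the cotangent bundle. -/
def covectorAt (y : M) (η : Covec d) : CotangentBundle d M :=
  ⟨y, (η : Cotangent d y)⟩

/-- Lowering an index at `x`, in the preferred chart: `v ↦ g_{αβ} v^β`. -/
def lower (g : RiemMetric d M) (x : M) : Vec d →L[ℝ] Covec d :=
  g.inner x

/-- Raising an index at `x`, in the preferred chart: `ξ ↦ g^{αβ} ξ_β`, the inverse of `lower g x`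
(which is invertible because `g` is positive definite). -/
def raise (g : RiemMetric d M) (x : M) : Covec d →L[ℝ] Vec d :=
  (lower g x).inverse

/-- The Hamiltonian `h(x, ξ) = (g^{αβ}(x) ξ_α ξ_β)^{1/2}`. -/
def hamiltonian (g : RiemMetric d M) (p : CotangentBundle d M) : ℝ :=
  Real.sqrt ((p.2 : Covec d) (raise g p.1 p.2))

/-- `γ = (x, ξ)` is a solution, for all times and inside `T'M`, of Hamilton's equations
`ẋ = h_ξ(x, ξ)`, `ξ̇ = -h_x(x, ξ)`. At each time the equations are written in canonical
coordinates around `γ t`. -/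
def IsHamiltonianCurve (g : RiemMetric d M) (γ : ℝ → CotangentBundle d M) : Prop :=
  ∀ t : ℝ, (γ t).2 ≠ 0 ∧ ∃ (x' : Vec d) (ξ' : Covec d),
    HasMFDerivAt 𝓘(ℝ, ℝ) (cotangentModel d) γ t
      (ContinuousLinearMap.toSpanSingleton ℝ ((x', ξ') : Vec d × Covec d)) ∧
    (∀ β : Covec d, β x' =
      mfderiv (cotangentModel d) 𝓘(ℝ, ℝ) (hamiltonian g) (γ t) ((0, β) : Vec d × Covec d)) ∧
    (∀ u : Vec d, ξ' u =
      -mfderiv (cotangentModel d) 𝓘(ℝ, ℝ) (hamiltonian g) (γ t) ((u, 0) : Vec d × Covec d))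

open Classical in
/-- The cogeodesic flow `(t, (y, η)) ↦ (x*(t; y, η), ξ*(t; y, η))`: the value at time `t` of the
solution of Hamilton's equations that starts at the given point (the point itself if there is no
such solution, which on a closed manifold happens on the zero section only). -/
def flow (g : RiemMetric d M) (t : ℝ) (p : CotangentBundle d M) : CotangentBundle d M :=
  if H : ∃ γ : ℝ → CotangentBundle d M, γ 0 = p ∧ IsHamiltonianCurve g γ then H.choose t else p

/-- The set `𝒯_y(t) = {(x*(t; y, η), ξ*(t; y, η)) | η ∈ T'_y M}`. -/
def leaf (g : RiemMetric d M) (y : M) (t : ℝ) : Set (CotangentBundle d M) :=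
  {p | ∃ η : Covec d, η ≠ 0 ∧ p = flow g t (covectorAt y η)}

/-- The differential of `η ↦ (x*(t; y, η), ξ*(t; y, η))` at `η`, in canonical coordinates around
`(x*, ξ*)`: a pair of `δη ↦ (x*)^α_{η_μ} δη_μ` and `δη ↦ (ξ*_α)_{η_μ} δη_μ`. -/
def flowDeriv (g : RiemMetric d M) (y : M) (t : ℝ) (η : Covec d) : Covec d →L[ℝ] Vec d × Covec d :=
  mfderiv 𝓘(ℝ, Covec d) (cotangentModel d)
    (fun η' : Covec d => flow g t (covectorAt y η')) η

/-- The components of the metric in the preferred chart at `x₀`, as a function of the coordinates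
`z`: `metricCoeff g x₀ z u v = g_{μν}(z) u^μ v^ν`. Here `L u = u^μ ∂_μ` is the tangent vector at the
point with coordinates `z` that has components `u` in the preferred chart at `x₀`. -/
def metricCoeff (g : RiemMetric d M) (x₀ : M) (z : Vec d) : Vec d →L[ℝ] Vec d →L[ℝ] ℝ :=
  let x : M := (extChartAt (𝓡 d) x₀).symm z
  let L : Vec d →L[ℝ] Vec d :=
    (trivializationAt (Vec d) (fun x : M => TangentSpace (𝓡 d) x) x₀).symmL ℝ x
  (lower g x).bilinearComp L L

/-- The Christoffel symbols at `x` in the preferred chart at `x`, contracted with a vector `v`: the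
linear map `u ↦ Γ^ρ_{μν} u^μ v^ν`, where
`Γ^ρ_{μν} = ½ g^{ρσ} (∂_μ g_{νσ} + ∂_ν g_{μσ} - ∂_σ g_{μν})`. -/
def christoffel (g : RiemMetric d M) (x : M) (v : Vec d) : Vec d →L[ℝ] Vec d :=
  -- `D w u v = ∂_σ g_{μν} w^σ u^μ v^ν`
  let D : Vec d →L[ℝ] Vec d →L[ℝ] Vec d →L[ℝ] ℝ :=
    fderiv ℝ (metricCoeff g x) (extChartAt (𝓡 d) x x)
  (raise g x).comp
    ((1 / 2 : ℝ) • (D.flip v + D v - (D.flip v).flip))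

/-- The base point `x*(t; y, η)`. -/
def xStar (g : RiemMetric d M) (y : M) (t : ℝ) (η : Covec d) : M :=
  (flow g t (covectorAt y η)).1

/-- The momentum `ξ*(t; y, η)`. -/
def xiStar (g : RiemMetric d M) (y : M) (t : ℝ) (η : Covec d) : Cotangent d (xStar g y t η) :=
  (flow g t (covectorAt y η)).2

/-- `q(δη)^α = (x*)^α_{η_μ} δη_μ`. -/
def qVec (g : RiemMetric d M) (y : M) (t : ℝ) (η δη : Covec d) :
    TangentSpace (𝓡 d) (xStar g y t η) :=
  (flowDeriv g y t η δη).1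

/-- `p(δη)^α = g^{αγ}(x*) [(ξ*_γ)_{η_μ} - Γ^ρ_{γβ}(x*) ξ*_ρ (x*)^β_{η_μ}] δη_μ`. -/
def pVec (g : RiemMetric d M) (y : M) (t : ℝ) (η δη : Covec d) :
    TangentSpace (𝓡 d) (xStar g y t η) :=
  raise g (xStar g y t η)
    ((flowDeriv g y t η δη).2 -
      (xiStar g y t η : Covec d).comp
        (christoffel g (xStar g y t η) (qVec g y t η δη)) : Covec d)

/-- The position form `Q(δη, δη') = g_{αβ}(x*) q(δη)^α q(δη')^β`. -/
def positionForm (g : RiemMetric d M) (y : M) (t : ℝ) (η u v : Covec d) : ℝ :=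
  g.inner (xStar g y t η) (qVec g y t η u) (qVec g y t η v)

/-- The momentum form `P(δη, δη') = g_{αβ}(x*) p(δη)^α p(δη')^β`. -/
def momentumForm (g : RiemMetric d M) (y : M) (t : ℝ) (η u v : Covec d) : ℝ :=
  g.inner (xStar g y t η) (pVec g y t η u) (pVec g y t η v)

/-- The canonical symplectic form `dx^α ∧ dξ_α` on the tangent space of `T*M` at a point, in
canonical coordinates around that point. -/
def symplecticForm (v w : Vec d × Covec d) : ℝ :=
  w.2 v.1 - v.2 w.1

/-- The bilinear forms `B η` on the momentum increments `δη`, one for each `η ∈ T'_y M`, constitute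
a Riemannian metric on `𝒯_y(t)`. That is: `𝒯_y(t)`, with the subspace topology, is a smooth
`d`-dimensional embedded submanifold of `T*M`; the map `Ψ : η ↦ (x*(t; y, η), ξ*(t; y, η))` is a
diffeomorphism of `T'_y M` onto it, so that `η` are coordinates on it; and there is a smooth
Riemannian metric on the manifold `𝒯_y(t)` whose expression in these coordinates is `B`. -/
def IsRiemannianMetricOnLeaf (g : RiemMetric d M) (y : M) (t : ℝ)
    (B : Covec d → Covec d → Covec d → ℝ) : Prop :=
  ∃ (_ : ChartedSpace (Covec d) (leaf g y t))
    (_ : IsManifold 𝓘(ℝ, Covec d) ∞ (leaf g y t)),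
    Manifold.IsSmoothEmbedding 𝓘(ℝ, Covec d) (cotangentModel d) ∞
      (Subtype.val : leaf g y t → CotangentBundle d M) ∧
    ∃ Ψ : PuncturedFibre d ≃ₘ^∞⟮𝓘(ℝ, Covec d), 𝓘(ℝ, Covec d)⟯ leaf g y t,
      (∀ η, (Ψ η : CotangentBundle d M) = flow g t (covectorAt y (η : Covec d))) ∧
      ∃ G : Bundle.ContMDiffRiemannianMetric 𝓘(ℝ, Covec d) ∞ (Covec d)
          (fun p : leaf g y t => TangentSpace 𝓘(ℝ, Covec d) p),
        ∀ (η : PuncturedFibre d) (u v : TangentSpace 𝓘(ℝ, Covec d) η),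
          G.inner (Ψ η) (mfderiv 𝓘(ℝ, Covec d) 𝓘(ℝ, Covec d) Ψ η u)
            (mfderiv 𝓘(ℝ, Covec d) 𝓘(ℝ, Covec d) Ψ η v) = B (η : Covec d) u v

end Cogeodesic

end

open Cogeodesic

/-! The flow is complete because `h` is conserved and its level sets on a closed manifold are
compact: local solutions on a level set have a common lifespan, and since they stay on that level
they can be continued for all time (`exists_isHamiltonianCurve`). Smooth dependence on initial data
is proved for short time by the inverse function theorem in a space of paths, then propagated to all
times by the group law (`contMDiffAt_flow_uncurry`). Charts may be changed freely because the
cotangent lift of a coordinate change is symplectic and therefore carries Hamiltonian fields to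
Hamiltonian fields.

Consequently the flow at time `t` is a diffeomorphism of `T'M`, and the leaf is the image of the
punctured fibre over `y`. Flowing back and reading off the momentum (`initialMomentum`) is a smooth
inverse of `η ↦ (x*, ξ*)`; canonical coordinates transported by the flow straighten the leaf to a
coordinate slice. This makes the leaf embedded, gives it the global coordinates `η`, and makes the
differential of the parametrization injective.

The leaf is Lagrangian because `h` is homogeneous of degree one. Euler's identity `ξ · h_ξ = h`
implies that the flow preserves the canonical one-form `ξ dx`, not merely its exterior derivative.
This form vanishes on the initial fibre, hence on the leaf (`canonicalForm_leaf`), and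
differentiating once more gives the symplectic statement.

`Q` and `P` are pullbacks of `g` under the linear maps `q` and `p`, hence nonnegative. If `q(δη) =
0`, the Christoffel term drops out and `p(δη)` is the raised derivative of `ξ*`; so `q` and `p`
vanish together only when the differential of the flow kills `δη`, that is, when `δη = 0`
(`combinedForm_pos`). Smoothness follows because `q` and `p` are tensorial, so near a given `η` both
forms can be computed in one fixed chart.

On the round two-sphere at time `π/2` the base point is the direction of `η`, so `Q` kills the
radial direction. The momentum, seen as a vector of the ambient space, is `-|η| y`, stationary to
first order in directions orthogonal to `η`, so `P` kills those. -/

set_option linter.unusedSectionVars false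

noncomputable section

/-! ### Smooth dependence of solutions of ordinary differential equations on initial data -/

section
namespace SmoothDependence

open Set

universe u

section Nemytskii

variable {K : Type*} [TopologicalSpace K] [CompactSpace K]
  {E F : Type u} [NormedAddCommGroup E] [NormedSpace ℝ E] [NormedAddCommGroup F] [NormedSpace ℝ F]

/-- Pointwise application of a continuous family of operators to a continuous family of vectors. -/
def pointwiseApply : C(K, E →L[ℝ] F) →L[ℝ] C(K, E) →L[ℝ] C(K, F) :=
  LinearMap.mkContinuous₂
    (LinearMap.mk₂ ℝ (fun (A : C(K, E →L[ℝ] F)) (h : C(K, E)) =>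
        (⟨fun t => A t (h t), by fun_prop⟩ : C(K, F)))
      (fun _ _ _ => by ext; simp) (fun _ _ _ => by ext; simp)
      (fun _ _ _ => by ext; simp) (fun _ _ _ => by ext; simp)) 1
    (fun A h => by
      rw [ContinuousMap.norm_le _ (by positivity)]
      intro t
      simp only [LinearMap.mk₂_apply, ContinuousMap.coe_mk, one_mul]
      exact (A t).le_of_opNorm_le_of_le (A.norm_coe_le_norm t) (h.norm_coe_le_norm t))

/-- The superposition operator `α ↦ f ∘ α`. -/
def superposition (f : C(E, F)) (α : C(K, E)) : C(K, F) := f.comp α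

omit [CompactSpace K] [NormedSpace ℝ E] [NormedSpace ℝ F] in
lemma continuous_superposition (f : C(E, F)) :
    Continuous (superposition f : C(K, E) → C(K, F)) :=
  ContinuousMap.continuous_postcomp f

/-- The mean value inequality is applied at each `t` on a ball about `α t`. One radius works for all
`t` because `α ↦ f' ∘ α` is continuous for the uniform norm. -/
lemma hasFDerivAt_superposition (f : C(E, F)) (f' : C(E, E →L[ℝ] F))
    (hf : ∀ x, HasFDerivAt f (f' x) x) (α : C(K, E)) :
    HasFDerivAt (superposition f) (pointwiseApply (superposition f' α)) α := by
  rw [hasFDerivAt_iff_isLittleO_nhds_zero, Asymptotics.isLittleO_iff]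
  intro c hc
  obtain ⟨δ, hδ, h⟩ := Metric.continuousAt_iff.1
    ((continuous_superposition (K := K) f').continuousAt (x := α)) c hc
  filter_upwards [Metric.ball_mem_nhds (0 : C(K, E)) hδ] with v hv
  rw [mem_ball_zero_iff] at hv
  rw [ContinuousMap.norm_le _ (by positivity)]
  intro t
  have key := (convex_ball (α t) δ).norm_image_sub_le_of_norm_hasFDerivWithin_le'
    (f := f) (f' := f') (φ := f' (α t)) (C := c) (x := α t) (y := α t + v t)
    (fun x _ => (hf x).hasFDerivWithinAt) (fun x hx => ?_) (Metric.mem_ball_self hδ) ?_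
  · simp only [add_sub_cancel_left] at key
    refine key.trans (mul_le_mul_of_nonneg_left (v.norm_coe_le_norm t) hc.le)
  -- A point `x` near `α t` is the value at `t` of a constant shift of `α`, so uniform closeness of
  -- paths controls `f' x`.
  · have h1 : dist (α + ContinuousMap.const K (x - α t)) α < δ := by
      rw [dist_eq_norm, add_sub_cancel_left]
      refine lt_of_le_of_lt ((ContinuousMap.norm_le _ (norm_nonneg (x - α t))).2 fun _ => ?_) ?_
      · simp
      · simpa [dist_eq_norm] using hx
    have h2 := h h1
    rw [dist_eq_norm] at h2
    have h3 := (ContinuousMap.norm_coe_le_norm _ t).trans h2.le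
    simpa [superposition] using h3
  · simpa [dist_eq_norm] using (v.norm_coe_le_norm t).trans_lt hv

/-- The derivative is itself a superposition operator, that of `fderiv ℝ f`, followed by a bounded
linear map. The induction therefore changes the target space to `E →L[ℝ] F`, which is why `F` is
quantified inside and shares the universe of `E`. -/
lemma contDiff_superposition_nat (n : ℕ) : ∀ {F : Type u} [NormedAddCommGroup F] [NormedSpace ℝ F]
    (f : C(E, F)), ContDiff ℝ n f →
    ContDiff ℝ n (superposition f : C(K, E) → C(K, F)) := by
  induction n with
  | zero =>
    intro F _ _ f _
    simpa using continuous_superposition f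
  | succ n ih =>
    intro F _ _ f hf
    have hd : Continuous (fderiv ℝ f) := hf.continuous_fderiv (by simp)
    have hder := hasFDerivAt_superposition (K := K) f ⟨fderiv ℝ f, hd⟩
      (fun x => (hf.differentiable (by simp) x).hasFDerivAt)
    push_cast at hf ⊢
    rw [contDiff_succ_iff_fderiv] at hf ⊢
    refine ⟨fun α => (hder α).differentiableAt, by simp, ?_⟩
    have : fderiv ℝ (superposition f : C(K, E) → C(K, F)) =
        fun α => pointwiseApply (superposition ⟨fderiv ℝ f, hd⟩ α) :=
      funext fun α => (hder α).fderiv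
    rw [this]
    exact pointwiseApply.contDiff.comp (ih ⟨fderiv ℝ f, hd⟩ hf.2.2)

lemma contDiff_superposition (f : C(E, F)) (hf : ContDiff ℝ ∞ f) :
    ContDiff ℝ ∞ (superposition f : C(K, E) → C(K, F)) :=
  contDiff_infty.2 fun n => contDiff_superposition_nat n f (contDiff_infty.1 hf n)

end Nemytskii

section Flow

variable {E : Type u} [NormedAddCommGroup E] [NormedSpace ℝ E] [CompleteSpace E]

/-- The space of continuous paths `[0, 1] → E`. -/
abbrev Paths (E : Type u) [NormedAddCommGroup E] : Type u := C(Icc (0 : ℝ) 1, E)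

/-- The primitive `t ↦ ∫₀ᵗ α` of a path. -/
def primitive : Paths E →L[ℝ] Paths E :=
  LinearMap.mkContinuous
    { toFun := fun α => ⟨fun t => ∫ τ in (0 : ℝ)..t, IccExtend zero_le_one α τ, by
        have hc : Continuous (IccExtend (zero_le_one (α := ℝ)) α) := α.continuous.Icc_extend'
        exact (intervalIntegral.continuous_primitive
          (fun a b => hc.intervalIntegrable a b) 0).comp continuous_subtype_val⟩
      map_add' := fun α β => by
        ext t
        have hα : Continuous (IccExtend (zero_le_one (α := ℝ)) α) := α.continuous.Icc_extend'
        have hβ : Continuous (IccExtend (zero_le_one (α := ℝ)) β) := β.continuous.Icc_extend'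
        exact intervalIntegral.integral_add (hα.intervalIntegrable 0 t) (hβ.intervalIntegrable 0 t)
      map_smul' := fun c α => by
        ext t
        exact intervalIntegral.integral_smul c _ } 1
    (fun α => by
      rw [ContinuousMap.norm_le _ (by positivity)]
      intro t
      refine (intervalIntegral.norm_integral_le_of_norm_le_const (C := ‖α‖) fun τ _ =>
        α.norm_coe_le_norm _).trans ?_
      rw [one_mul, sub_zero, abs_of_nonneg t.2.1]
      exact mul_le_of_le_one_right (norm_nonneg _) t.2.2)

omit [CompleteSpace E] in
lemma primitive_apply (α : Paths E) (t : Icc (0 : ℝ) 1) :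
    primitive α t = ∫ τ in (0 : ℝ)..t, IccExtend zero_le_one α τ := rfl

/-- The constant path. -/
def constPath : E →L[ℝ] Paths E :=
  LinearMap.mkContinuous
    { toFun := fun z => ContinuousMap.const _ z
      map_add' := fun _ _ => rfl
      map_smul' := fun _ _ => rfl } 1
    (fun z => by
      rw [ContinuousMap.norm_le _ (by positivity)]
      intro t
      rw [one_mul]
      exact le_rfl)

omit [CompleteSpace E] in
@[simp] lemma constPath_apply (z : E) (t : Icc (0 : ℝ) 1) : constPath z t = z := rfl

/-- The equation `α = z + s ∫ f ∘ α` for a path, in the form `α - z - s ∫ f ∘ α = 0`. -/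
def pathEquation (f : C(E, E)) (u : (ℝ × E) × Paths E) : (ℝ × E) × Paths E :=
  (u.1, u.2 - constPath u.1.2 - u.1.1 • primitive (superposition f u.2))

omit [CompleteSpace E] in
lemma contDiff_pathEquation (f : C(E, E)) (hf : ContDiff ℝ ∞ f) :
    ContDiff ℝ ∞ (pathEquation f) := by
  have h := contDiff_superposition (K := Icc (0 : ℝ) 1) f hf
  unfold pathEquation
  have h1 : ContDiff ℝ ∞ fun u : (ℝ × E) × Paths E => superposition f u.2 := h.comp contDiff_snd
  fun_prop

-- At `s = 0` the nonlinear term carries the factor `s`, so only its `s`-derivative survives. The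
-- differential is then block triangular with identities on the diagonal, hence invertible without
-- any smallness assumption.
omit [CompleteSpace E] in
lemma hasFDerivAt_pathEquation (f : C(E, E)) (hf : ContDiff ℝ ∞ f) (z : E) (α : Paths E) :
    HasFDerivAt (pathEquation f)
      (((ContinuousLinearEquiv.refl ℝ (ℝ × E)).skewProd (ContinuousLinearEquiv.refl ℝ (Paths E))
        (-(constPath.comp (ContinuousLinearMap.snd ℝ ℝ E)) -
          (ContinuousLinearMap.fst ℝ ℝ E).smulRight (primitive (superposition f α))) :
        ((ℝ × E) × Paths E) ≃L[ℝ] _) : ((ℝ × E) × Paths E) →L[ℝ] (ℝ × E) × Paths E)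
      ((0, z), α) := by
  have h := (contDiff_superposition (K := Icc (0 : ℝ) 1) f hf).differentiable (by simp) α
  have h2 : HasFDerivAt (fun u : (ℝ × E) × Paths E => primitive (superposition f u.2))
      (primitive.comp ((fderiv ℝ (superposition f) α).comp
        (ContinuousLinearMap.snd ℝ (ℝ × E) (Paths E)))) ((0, z), α) :=
    (primitive (E := E)).hasFDerivAt.comp (f := fun u : (ℝ × E) × Paths E => superposition f u.2)
      ((0, z), α) (HasFDerivAt.comp (g := superposition f)
      (f := fun u : (ℝ × E) × Paths E => u.2) ((0, z), α) h.hasFDerivAt hasFDerivAt_snd)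
  have h3 : HasFDerivAt (fun u : (ℝ × E) × Paths E => u.1.1)
      ((ContinuousLinearMap.fst ℝ ℝ E).comp (ContinuousLinearMap.fst ℝ (ℝ × E) (Paths E)))
      ((0, z), α) := ContinuousLinearMap.hasFDerivAt
        ((ContinuousLinearMap.fst ℝ ℝ E).comp (ContinuousLinearMap.fst ℝ (ℝ × E) (Paths E)))
  have h4 : HasFDerivAt (fun u : (ℝ × E) × Paths E => constPath u.1.2)
      (constPath.comp ((ContinuousLinearMap.snd ℝ ℝ E).comp
        (ContinuousLinearMap.fst ℝ (ℝ × E) (Paths E))))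
      ((0, z), α) := ContinuousLinearMap.hasFDerivAt
        (constPath.comp ((ContinuousLinearMap.snd ℝ ℝ E).comp
          (ContinuousLinearMap.fst ℝ (ℝ × E) (Paths E))))
  have h5 := (hasFDerivAt_fst (𝕜 := ℝ) (E := ℝ × E) (F := Paths E) (p := ((0, z), α))).prodMk
    ((hasFDerivAt_snd.sub h4).sub (h3.smul h2))
  refine h5.congr_fderiv ?_
  ext u <;> simp [ContinuousLinearEquiv.skewProd]

/-- The inverse function theorem for `pathEquation`. The parameter `s` is the length of the time
interval rescaled to `[0, 1]`, which turns a short time into a small parameter. -/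
lemma exists_path_solution (f : C(E, E)) (hf : ContDiff ℝ ∞ f) (z₀ : E) :
    ∃ ψ : ℝ × E → Paths E, ∀ᶠ u in 𝓝 ((0 : ℝ), z₀), ContDiffAt ℝ ∞ ψ u ∧
      ψ u = constPath u.2 + u.1 • primitive (superposition f (ψ u)) := by
  set Φ := pathEquation f with hΦ
  have hsm : ContDiff ℝ ∞ Φ := contDiff_pathEquation f hf
  set α₀ : Paths E := constPath z₀
  set u₀ : (ℝ × E) × Paths E := ((0, z₀), α₀)
  have hd := hasFDerivAt_pathEquation f hf z₀ α₀
  set e := hsm.contDiffAt.toOpenPartialHomeomorph Φ hd (by simp) with he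
  have heu : ∀ u, e u = Φ u := fun u => rfl
  have hΦ0 : Φ u₀ = ((0, z₀), 0) := by
    simp [hΦ, pathEquation, u₀, α₀]
  have hmem : u₀ ∈ e.source := hsm.contDiffAt.mem_toOpenPartialHomeomorph_source hd (by simp)
  have htgt : ((0, z₀), (0 : Paths E)) ∈ e.target := by
    rw [← hΦ0]; exact e.map_source hmem
  have hsymm0 : e.symm ((0, z₀), 0) = u₀ := by
    rw [← hΦ0, ← heu]; exact e.left_inv hmem
  -- Smoothness of the local inverse is needed at all nearby points, not only at the base point;
  -- invertible operators form an open set.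
  have hinv : ∀ᶠ u in 𝓝 u₀, fderiv ℝ Φ u ∈ range ((↑) :
      (((ℝ × E) × Paths E) ≃L[ℝ] ((ℝ × E) × Paths E)) → _) := by
    have hc : ContinuousAt (fderiv ℝ Φ) u₀ := (hsm.continuous_fderiv (by simp)).continuousAt
    refine hc.eventually_mem ?_
    rw [hd.fderiv]
    exact ContinuousLinearEquiv.nhds _
  have hcs : ContinuousAt (fun u : ℝ × E => e.symm (u, 0)) (0, z₀) := by
    have : ContinuousAt e.symm ((0, z₀), (0 : Paths E)) := e.symm.continuousAt htgt
    exact ContinuousAt.comp (g := e.symm) (f := fun u : ℝ × E => (u, (0 : Paths E))) this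
      (by fun_prop)
  refine ⟨fun u => (e.symm (u, 0)).2, ?_⟩
  have hpair : ContinuousAt (fun u : ℝ × E => (u, (0 : Paths E))) (0, z₀) := by fun_prop
  filter_upwards [hpair.eventually (e.open_target.mem_nhds htgt),
    hcs.tendsto.eventually (p := fun w => fderiv ℝ Φ w ∈ range ((↑) :
      (((ℝ × E) × Paths E) ≃L[ℝ] ((ℝ × E) × Paths E)) → _)) (by rwa [hsymm0])] with u hu1 hu2
  constructor
  · obtain ⟨L, hL⟩ := hu2
    have h1 : ContDiffAt ℝ ∞ e.symm (u, 0) := by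
      refine e.contDiffAt_symm (f₀' := L) hu1 ?_ hsm.contDiffAt
      rw [hL]
      exact (hsm.differentiable (by simp) _).hasFDerivAt
    exact contDiffAt_snd.comp _ (h1.comp u (by fun_prop))
  · have h1 : Φ (e.symm (u, 0)) = (u, 0) := by rw [← heu]; exact e.right_inv hu1
    simp only [hΦ, pathEquation, Prod.mk.injEq] at h1
    obtain ⟨h2, h3⟩ := h1
    rw [h2] at h3
    rw [sub_sub, sub_eq_zero] at h3
    exact h3

/-- The flow of a globally Lipschitz smooth vector field is smooth for small times. -/
lemma exists_flow_of_lipschitz (f : C(E, E)) (hf : ContDiff ℝ ∞ f) {K : NNReal}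
    (hK : LipschitzWith K f) (z₀ : E) :
    ∃ φ : ℝ × E → E, ∀ᶠ u in 𝓝 ((0 : ℝ), z₀), φ (0, u.2) = u.2 ∧ ContDiffAt ℝ ∞ φ u ∧
      HasDerivAt (fun s => φ (s, u.2)) (f (φ u)) u.1 := by
  obtain ⟨ψ, hψ⟩ := exists_path_solution f hf z₀
  obtain ⟨β, hβ⟩ := (hf.contDiffAt (x := z₀)).of_le
    (show (1 : WithTop ℕ∞) ≤ ∞ by simp) |>.exists_eventually_eq_hasDerivAt 0
  set one : Icc (0 : ℝ) 1 := ⟨1, by simp⟩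
  have hβ' : ∀ᶠ u in 𝓝 ((0 : ℝ), z₀), β u.2 0 = u.2 ∧ HasDerivAt (β u.2) (f (β u.2 u.1)) u.1 := by
    have : Filter.Tendsto (fun u : ℝ × E => (u.2, u.1)) (𝓝 ((0 : ℝ), z₀)) (𝓝 z₀ ×ˢ 𝓝 0) := by
      rw [← nhds_prod_eq]
      exact Continuous.tendsto' (by fun_prop) _ _ rfl
    exact this.eventually hβ
  obtain ⟨ε, hε, hball⟩ := Metric.eventually_nhds_iff_ball.1 (hψ.and hβ')
  have hin : ∀ s z, |s| < ε → dist z z₀ < ε → ((s, z) : ℝ × E) ∈ Metric.ball ((0 : ℝ), z₀) ε := by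
    intro s z hs hz
    rw [← ball_prod_same]
    exact ⟨by simpa using hs, hz⟩
  -- Both `ψ (s, z)` and `τ ↦ β z (s τ)` solve `y' = s f(y)` from `z`. So the Picard–Lindelöf
  -- solution `β`, which has the right time derivative, is the endpoint of the smooth family `ψ`.
  have key : ∀ s z, |s| < ε → dist z z₀ < ε → ψ (s, z) one = β z s := by
    intro s z hs hz
    obtain ⟨⟨-, hsol⟩, hb⟩ := hball _ (hin s z hs hz)
    set y : ℝ → E := IccExtend (zero_le_one (α := ℝ)) (ψ (s, z)) with hy
    have hyc : Continuous y := (ψ (s, z)).continuous.Icc_extend'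
    have hint : ∀ t ∈ Icc (0 : ℝ) 1, y t = z + s • ∫ τ in (0 : ℝ)..t, f (y τ) := by
      intro t ht
      have h1 := congrArg (fun p : Paths E => p ⟨t, ht⟩) hsol
      simp only [ContinuousMap.add_apply, constPath_apply, ContinuousMap.smul_apply,
        primitive_apply] at h1
      rw [hy, IccExtend_of_mem _ _ ht, h1]
      rfl
    have hyd : ∀ t ∈ Ico (0 : ℝ) 1, HasDerivWithinAt y (s • f (y t)) (Ici t) t := by
      intro t ht
      have h1 : HasDerivAt (fun t => z + s • ∫ τ in (0 : ℝ)..t, f (y τ)) (s • f (y t)) t := by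
        have hc : Continuous fun τ => f (y τ) := f.continuous.comp hyc
        exact ((hc.integral_hasStrictDerivAt 0 t).hasDerivAt.const_smul s).const_add z
      refine h1.hasDerivWithinAt.congr_of_eventuallyEq ?_ (hint t ⟨ht.1, ht.2.le⟩)
      filter_upwards [Ico_mem_nhdsGE ht.2] with t' ht'
      exact hint t' ⟨ht.1.trans ht'.1, ht'.2.le⟩
    have hs1 : ∀ τ ∈ Icc (0 : ℝ) 1, |s * τ| < ε := by
      intro τ hτ
      rw [abs_mul, abs_of_nonneg hτ.1]
      exact lt_of_le_of_lt (mul_le_of_le_one_right (abs_nonneg _) hτ.2) hs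
    have hbd : ∀ t ∈ Icc (0 : ℝ) 1, HasDerivAt (fun τ => β z (s * τ)) (s • f (β z (s * t))) t := by
      intro t ht
      have h1 : HasDerivAt (β z) (f (β z (s * t))) (s * t) :=
        (hball _ (hin (s * t) z (hs1 t ht) hz)).2.2
      have h2 : HasDerivAt (fun τ : ℝ => s * τ) s t := by
        simpa using (hasDerivAt_id t).const_mul s
      exact h1.scomp t h2
    have := ODE_solution_unique (v := fun _ x => s • f x) (K := ‖s‖₊ * K) (a := 0) (b := 1)
      (f := y) (g := fun τ => β z (s * τ)) (fun _ => (lipschitzWith_smul s).comp hK) hyc.continuousOn hyd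
      (fun t ht => (hbd t ht).continuousAt.continuousWithinAt)
      (fun t ht => (hbd t ⟨ht.1, ht.2.le⟩).hasDerivWithinAt)
      (by rw [hint 0 (by simp)]; simpa using hb.1.symm) (right_mem_Icc.2 zero_le_one)
    simpa [hy, one] using this
  refine ⟨fun u => ψ u one, ?_⟩
  filter_upwards [Metric.ball_mem_nhds _ hε] with u hu
  rw [← ball_prod_same] at hu
  have hu1 : |u.1| < ε := by simpa using hu.1
  have hu2 : dist u.2 z₀ < ε := hu.2
  have hu' : u ∈ Metric.ball ((0 : ℝ), z₀) ε := hin u.1 u.2 hu1 hu2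
  refine ⟨?_, ?_, ?_⟩
  · rw [key 0 u.2 (by simpa using hε) hu2]
    exact (hball u hu').2.1
  · have : ContDiff ℝ ∞ fun p : Paths E => p one :=
      (ContinuousMap.evalCLM ℝ one : Paths E →L[ℝ] E).contDiff
    exact this.contDiffAt.comp u (hball u hu').1.1
  · have h1 := (hball u hu').2.2
    rw [← key u.1 u.2 hu1 hu2] at h1
    refine h1.congr_of_eventuallyEq ?_
    have : ∀ᶠ s in 𝓝 u.1, |s| < ε := continuous_abs.continuousAt.eventually_lt_const hu1
    filter_upwards [this] with s hs
    exact key s u.2 hs hu2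

/-- A smooth vector field on an open set has a smooth local flow. -/
theorem exists_smooth_local_flow {E : Type u} [NormedAddCommGroup E] [NormedSpace ℝ E]
    [FiniteDimensional ℝ E] {f : E → E} {Ω : Set E} (hΩ : IsOpen Ω) (hf : ContDiffOn ℝ ∞ f Ω)
    {z₀ : E} (hz₀ : z₀ ∈ Ω) :
    ∃ φ : ℝ × E → E, ∀ᶠ u in 𝓝 ((0 : ℝ), z₀), φ (0, u.2) = u.2 ∧ φ u ∈ Ω ∧ ContDiffAt ℝ ∞ φ u ∧
      HasDerivAt (fun s => φ (s, u.2)) (f (φ u)) u.1 := by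
  have : CompleteSpace E := FiniteDimensional.complete ℝ E
  obtain ⟨r, hr, hrΩ⟩ := Metric.nhds_basis_closedBall.mem_iff.1 (hΩ.mem_nhds hz₀)
  -- The cutoff makes the field globally smooth with compact support, hence Lipschitz. On the ball
  -- of radius `r / 2`, where `χ = 1`, the field is unchanged, and short trajectories stay there.
  let χ : ContDiffBump z₀ := ⟨r / 2, r, by positivity, by linarith⟩
  have hFs : ContDiff ℝ ∞ (fun z => χ z • f z) := by
    rw [contDiff_iff_contDiffAt]
    intro z
    by_cases hz : z ∈ Ω
    · exact χ.contDiff.contDiffAt.smul (hf.contDiffAt (hΩ.mem_nhds hz))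
    · have : z ∉ tsupport χ := by
        rw [χ.tsupport_eq]
        exact fun h => hz (hrΩ h)
      have h0 : (fun z => χ z • f z) =ᶠ[𝓝 z] fun _ => 0 := by
        filter_upwards [notMem_tsupport_iff_eventuallyEq.1 this] with w hw
        simp [hw]
      exact contDiffAt_const.congr_of_eventuallyEq h0
  have hsupp : HasCompactSupport (fun z => χ z • f z) := χ.hasCompactSupport.smul_right
  obtain ⟨K, hK⟩ := ContDiff.lipschitzWith_of_hasCompactSupport hsupp hFs (by simp)
  obtain ⟨φ, hφ⟩ := exists_flow_of_lipschitz ⟨_, hFs.continuous⟩ hFs hK z₀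
  refine ⟨φ, ?_⟩
  have h0 := hφ.self_of_nhds
  have hc : ContinuousAt φ (0, z₀) := h0.2.1.continuousAt
  have hev : ∀ᶠ u in 𝓝 ((0 : ℝ), z₀), φ u ∈ Metric.ball z₀ (r / 2) := by
    refine hc.eventually_mem ?_
    rw [show φ (0, z₀) = z₀ from h0.1]
    exact Metric.ball_mem_nhds _ (by positivity)
  filter_upwards [hφ, hev] with u hu hu2
  refine ⟨hu.1, hrΩ ?_, hu.2.1, ?_⟩
  · exact Metric.closedBall_subset_closedBall (by linarith) (Metric.ball_subset_closedBall hu2)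
  · have := hu.2.2
    simpa [χ.one_of_mem_closedBall (Metric.ball_subset_closedBall hu2)] using this

end Flow
end SmoothDependence

end

/-! ### Canonical coordinates on the cotangent bundle and their domains -/

section
namespace Cogeodesic
variable {d : ℕ} {M : Type*} [TopologicalSpace M] [ChartedSpace (Vec d) M] [IsManifold (𝓡 d) ∞ M]

open Set Bundle

instance instIsManifoldCotangentBundle :
    IsManifold (cotangentModel d) ∞ (CotangentBundle d M) :=
  Bundle.TotalSpace.isManifold (Covec d) (fun x : M => Cotangent d x)

/-- The coordinate frame of the preferred chart at `x₀`, at the point `x`. -/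
def frame (x₀ x : M) : Vec d →L[ℝ] Vec d :=
  (trivializationAt (Vec d) (fun x : M => TangentSpace (𝓡 d) x) x₀).symmL ℝ x

lemma frame_eq {x₀ x : M} (hx : x ∈ (chartAt (Vec d) x₀).source) :
    frame x₀ x = tangentCoordChange (𝓡 d) x₀ x x :=
  TangentBundle.symmL_trivializationAt_eq_core hx

lemma frame_self (x : M) : frame (d := d) x x = ContinuousLinearMap.id ℝ _ := by
  rw [frame_eq (mem_chart_source _ _)]
  ext1 v
  exact tangentCoordChange_self (mem_extChartAt_source x)

/-- The canonical coordinates on the cotangent bundle induced by the preferred chart at `x₀`. -/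
def cochart (d : ℕ) {M : Type*} [TopologicalSpace M] [ChartedSpace (Vec d) M]
    [IsManifold (𝓡 d) ∞ M] (x₀ : M) : PartialEquiv (CotangentBundle d M) (Vec d × Covec d) :=
  extChartAt (cotangentModel d) (covectorAt x₀ 0)

/-- The preferred chart depends on the base point only, so charts indexed by points of `M` suffice.
-/
lemma extChartAt_cotangent (p : CotangentBundle d M) :
    extChartAt (cotangentModel d) p = cochart d p.1 := rfl

lemma cochart_source (x₀ : M) :
    (cochart d x₀).source = {p | p.1 ∈ (chartAt (Vec d) x₀).source} := by
  rw [cochart, extChartAt_source, FiberBundle.chartedSpace_chartAt]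
  ext p
  simp only [covectorAt, OpenPartialHomeomorph.trans_source, mem_inter_iff, mem_preimage, mem_ofPred_eq,
    OpenPartialHomeomorph.prod_source, OpenPartialHomeomorph.refl_source, mem_prod, mem_univ, and_true]
  constructor
  · exact fun h => h.2
  · exact fun h => ⟨by simpa using h, h⟩

lemma cochart_target (x₀ : M) :
    (cochart d x₀).target = (extChartAt (𝓡 d) x₀).target ×ˢ univ := by
  rw [cochart, FiberBundle.extChartAt_target]
  congr 1
  ext z
  refine ⟨fun h => h.1, fun hz => ⟨hz, ?_⟩⟩
  have := (extChartAt (𝓡 d) x₀).map_target hz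
  simpa [covectorAt] using this

lemma cochart_apply (x₀ : M) (p : CotangentBundle d M) :
    cochart d x₀ p = (extChartAt (𝓡 d) x₀ p.1, (p.2 : Covec d).comp (frame x₀ p.1)) := by
  rw [cochart, FiberBundle.extChartAt]
  refine Prod.ext rfl ?_
  ext v
  simp [covectorAt, hom_trivializationAt_apply, ContinuousLinearMap.inCoordinates, frame]

lemma cochart_covectorAt (x₀ x : M) (ξ : Covec d) :
    cochart d x₀ (covectorAt x ξ) = (extChartAt (𝓡 d) x₀ x, ξ.comp (frame x₀ x)) :=
  cochart_apply x₀ _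

lemma cochart_self (x : M) (ξ : Covec d) :
    cochart d x (covectorAt x ξ) = (extChartAt (𝓡 d) x x, ξ) := by
  rw [cochart_apply]
  simp only [covectorAt, frame_self]
  rfl

lemma mem_cochart_source {x₀ : M} {p : CotangentBundle d M} :
    p ∈ (cochart d x₀).source ↔ p.1 ∈ (chartAt (Vec d) x₀).source := by
  rw [cochart_source]; rfl

lemma mem_cochart_source_self (p : CotangentBundle d M) : p ∈ (cochart d p.1).source :=
  mem_cochart_source.2 (mem_chart_source _ _)

lemma isOpen_cochart_source (x₀ : M) : IsOpen (cochart d x₀).source :=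
  isOpen_extChartAt_source _

lemma isOpen_cochart_target (x₀ : M) : IsOpen (cochart d x₀).target :=
  isOpen_extChartAt_target _

lemma contMDiffOn_cochart (x₀ : M) :
    ContMDiffOn (cotangentModel d) 𝓘(ℝ, Vec d × Covec d) ∞ (cochart d x₀) (cochart d x₀).source := by
  have := contMDiffOn_extChartAt (I := cotangentModel d) (n := ∞)
    (x := (covectorAt x₀ 0 : CotangentBundle d M))
  rwa [← extChartAt_source (cotangentModel d)] at this

lemma contMDiffOn_cochart_symm (x₀ : M) :
    ContMDiffOn 𝓘(ℝ, Vec d × Covec d) (cotangentModel d) ∞ (cochart d x₀).symm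
      (cochart d x₀).target :=
  contMDiffOn_extChartAt_symm _

lemma cochart_symm_fst {x₀ : M} {w : Vec d × Covec d} (hw : w ∈ (cochart d x₀).target) :
    ((cochart d x₀).symm w).1 = (extChartAt (𝓡 d) x₀).symm w.1 := by
  have h1 := (cochart d x₀).right_inv hw
  have h2 := (cochart d x₀).map_target hw
  rw [mem_cochart_source, ← extChartAt_source (𝓡 d)] at h2
  rw [cochart_apply] at h1
  rw [← congrArg Prod.fst h1]
  exact ((extChartAt (𝓡 d) x₀).left_inv h2).symm

lemma frame_comp {x₀ x₁ x : M} (h₀ : x ∈ (chartAt (Vec d) x₀).source)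
    (h₁ : x ∈ (chartAt (Vec d) x₁).source) :
    (frame x₁ x).comp (tangentCoordChange (𝓡 d) x₀ x₁ x) = frame x₀ x := by
  rw [frame_eq h₀, frame_eq h₁]
  ext1 v
  exact tangentCoordChange_comp (I := 𝓡 d) (w := x₀) (x := x₁) (y := x)
    ⟨⟨by simpa using h₀, by simpa using h₁⟩, mem_extChartAt_source x⟩

lemma tangentCoordChange_comp_symm {x₀ x₁ x : M} (h₀ : x ∈ (chartAt (Vec d) x₀).source)
    (h₁ : x ∈ (chartAt (Vec d) x₁).source) :
    (tangentCoordChange (𝓡 d) x₁ x₀ x).comp (tangentCoordChange (𝓡 d) x₀ x₁ x) =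
      ContinuousLinearMap.id ℝ _ := by
  ext1 v
  have h₀' : x ∈ (extChartAt (𝓡 d) x₀).source := by simpa using h₀
  have h₁' : x ∈ (extChartAt (𝓡 d) x₁).source := by simpa using h₁
  have := tangentCoordChange_comp (I := 𝓡 d) (w := x₀) (x := x₁) (y := x₀) (v := v)
    ⟨⟨h₀', h₁'⟩, h₀'⟩
  simp only [ContinuousLinearMap.comp_apply]
  rw [this, tangentCoordChange_self (I := 𝓡 d) h₀']
  rfl

lemma frame_bijective {x₀ x : M} (h : x ∈ (chartAt (Vec d) x₀).source) :
    Function.Bijective (frame (d := d) x₀ x) := by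
  have h1 := frame_comp (x₁ := x₀) (mem_chart_source (Vec d) x) h
  rw [frame_self] at h1
  have h2 := tangentCoordChange_comp_symm h (mem_chart_source (Vec d) x)
  rw [← frame_eq h] at h2
  constructor
  · intro u v huv
    have := congrArg (tangentCoordChange (𝓡 d) x x₀ x) huv
    rw [← ContinuousLinearMap.comp_apply, ← ContinuousLinearMap.comp_apply, h2] at this
    exact this
  · intro v
    exact ⟨_, DFunLike.congr_fun h1 v⟩

/-- The change of coordinates from the preferred chart at `x₀` to that at `x₁`. -/
def transition (d : ℕ) {M : Type*} [TopologicalSpace M] [ChartedSpace (Vec d) M]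
    (x₀ x₁ : M) : Vec d → Vec d :=
  extChartAt (𝓡 d) x₁ ∘ (extChartAt (𝓡 d) x₀).symm

/-- The domain of the change of coordinates from the preferred chart at `x₀` to that at `x₁`. -/
def overlap (d : ℕ) {M : Type*} [TopologicalSpace M] [ChartedSpace (Vec d) M]
    (x₀ x₁ : M) : Set (Vec d) :=
  ((extChartAt (𝓡 d) x₀).symm ≫ extChartAt (𝓡 d) x₁).source

lemma mem_overlap {x₀ x₁ : M} {z : Vec d} : z ∈ overlap d x₀ x₁ ↔
    z ∈ (extChartAt (𝓡 d) x₀).target ∧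
      (extChartAt (𝓡 d) x₀).symm z ∈ (chartAt (Vec d) x₁).source := by
  rw [overlap, PartialEquiv.trans_source, PartialEquiv.symm_source, extChartAt_source]
  rfl

lemma isOpen_overlap (x₀ x₁ : M) : IsOpen (overlap d x₀ x₁) := by
  have : overlap d x₀ x₁ = (extChartAt (𝓡 d) x₀).target ∩
      (extChartAt (𝓡 d) x₀).symm ⁻¹' (chartAt (Vec d) x₁).source := by
    ext z; exact mem_overlap
  rw [this]
  exact (continuousOn_extChartAt_symm x₀).isOpen_inter_preimage (isOpen_extChartAt_target x₀)
    (chartAt (Vec d) x₁).open_source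

lemma contDiffOn_transition (x₀ x₁ : M) :
    ContDiffOn ℝ ∞ (transition d x₀ x₁) (overlap d x₀ x₁) :=
  contDiffOn_ext_coord_change x₁ x₀

/-- This ties the cocycle of the tangent bundle, by which covectors transform, to the Jacobian of
the coordinate change. -/
lemma hasFDerivAt_transition {x₀ x₁ : M} {z : Vec d} (hz : z ∈ overlap d x₀ x₁) :
    HasFDerivAt (transition d x₀ x₁)
      (tangentCoordChange (𝓡 d) x₀ x₁ ((extChartAt (𝓡 d) x₀).symm z)) z := by
  obtain ⟨h1, h2⟩ := mem_overlap.1 hz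
  have := hasFDerivWithinAt_tangentCoordChange (I := 𝓡 d) (x := x₀) (y := x₁)
    (z := (extChartAt (𝓡 d) x₀).symm z) ⟨(extChartAt (𝓡 d) x₀).map_target h1, by simpa using h2⟩
  rw [(extChartAt (𝓡 d) x₀).right_inv h1] at this
  rw [ModelWithCorners.range_eq_univ, hasFDerivWithinAt_univ] at this
  exact this

end Cogeodesic

end

/-! ### Symplectic linear algebra and lifts of coordinate changes -/

section
namespace Cogeodesic
open Set

section Symplectic
variable {d : ℕ}

/-- The vector that represents a linear functional on covectors. -/
def dualVec : (Covec d →L[ℝ] ℝ) →L[ℝ] Vec d :=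
  LinearMap.toContinuousLinearMap (𝕜 := ℝ) (E := Covec d →L[ℝ] ℝ) (F' := Vec d)
    { toFun := fun (L : Covec d →L[ℝ] ℝ) => WithLp.toLp 2 fun i : Fin d => L (EuclideanSpace.proj i)
      map_add' := fun _ _ => by ext; simp
      map_smul' := fun _ _ => by ext; simp }

lemma apply_dualVec (L : Covec d →L[ℝ] ℝ) (β : Covec d) : β (dualVec L) = L β := by
  have hβ : β = ∑ i, β (EuclideanSpace.single i 1) • (EuclideanSpace.proj i : Covec d) := by
    ext v
    conv_lhs => rw [← (EuclideanSpace.basisFun (Fin d) ℝ).sum_repr v]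
    simp [mul_comm]
  conv_rhs => rw [hβ]
  conv_lhs => rw [hβ]
  simp [dualVec]

/-- The vector `J dH`: the symplectic gradient that corresponds to a differential. -/
def symplGrad : ((Vec d × Covec d) →L[ℝ] ℝ) →L[ℝ] Vec d × Covec d :=
  (dualVec.comp ((ContinuousLinearMap.compL ℝ (Covec d) (Vec d × Covec d) ℝ).flip
    (ContinuousLinearMap.inr ℝ (Vec d) (Covec d)))).prod
  (-((ContinuousLinearMap.compL ℝ (Vec d) (Vec d × Covec d) ℝ).flip
    (ContinuousLinearMap.inl ℝ (Vec d) (Covec d))))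

lemma apply_symplGrad_fst (L : (Vec d × Covec d) →L[ℝ] ℝ) (β : Covec d) :
    β (symplGrad L).1 = L (0, β) := by
  simp [symplGrad, apply_dualVec]

lemma symplGrad_snd_apply (L : (Vec d × Covec d) →L[ℝ] ℝ) (u : Vec d) :
    (symplGrad L).2 u = -L (u, 0) := by
  simp [symplGrad]

lemma symplecticForm_symplGrad (L : (Vec d × Covec d) →L[ℝ] ℝ) (w : Vec d × Covec d) :
    symplecticForm (symplGrad L) w = L w := by
  rw [symplecticForm, apply_symplGrad_fst, symplGrad_snd_apply, sub_neg_eq_add, ← map_add]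
  simp

lemma exists_covec_ne_zero {u : Vec d} (hu : u ≠ 0) : ∃ β : Covec d, β u ≠ 0 :=
  ⟨innerSL ℝ u, by simpa using hu⟩

/-- Nondegeneracy: vertical test vectors detect the position component, horizontal ones the momentum
component. -/
lemma eq_of_symplecticForm {v v' : Vec d × Covec d}
    (h : ∀ w, symplecticForm v w = symplecticForm v' w) : v = v' := by
  have h1 : v.1 = v'.1 := by
    by_contra hne
    obtain ⟨β, hβ⟩ := exists_covec_ne_zero (sub_ne_zero.2 hne)
    have := h (0, β)
    simp [symplecticForm] at this
    rw [map_sub, this, sub_self] at hβ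
    exact hβ rfl
  have h2 : v.2 = v'.2 := by
    ext u
    simpa [symplecticForm] using h (u, 0)
  exact Prod.ext h1 h2

/-- The Hamiltonian vector field of a function in canonical coordinates. -/
def hamField (H : Vec d × Covec d → ℝ) (w : Vec d × Covec d) : Vec d × Covec d :=
  symplGrad (fderiv ℝ H w)

/-- The lift of a change of coordinates `φ` to covectors, `A` being the inverse of `Dφ`. -/
def covecLift (φ : Vec d → Vec d) (A : Vec d → Vec d →L[ℝ] Vec d) (w : Vec d × Covec d) :
    Vec d × Covec d :=
  (φ w.1, w.2.comp (A w.1))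

/-- The differential of `covecLift`. -/
def covecLiftDeriv (φ : Vec d → Vec d) (A : Vec d → Vec d →L[ℝ] Vec d) (w : Vec d × Covec d) :
    (Vec d × Covec d) →L[ℝ] Vec d × Covec d :=
  ((fderiv ℝ φ w.1).comp (ContinuousLinearMap.fst ℝ _ _)).prod
    (((ContinuousLinearMap.compL ℝ (Vec d) (Vec d) ℝ w.2).comp (fderiv ℝ A w.1)).comp
        (ContinuousLinearMap.fst ℝ _ _) +
      ((ContinuousLinearMap.compL ℝ (Vec d) (Vec d) ℝ).flip (A w.1)).comp
        (ContinuousLinearMap.snd ℝ _ _))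

variable {φ : Vec d → Vec d} {A : Vec d → Vec d →L[ℝ] Vec d} {w : Vec d × Covec d}

lemma covecLiftDeriv_apply (v : Vec d × Covec d) : covecLiftDeriv φ A w v =
    (fderiv ℝ φ w.1 v.1, w.2.comp (fderiv ℝ A w.1 v.1) + v.2.comp (A w.1)) := rfl

lemma hasFDerivAt_covecLift (hφ : DifferentiableAt ℝ φ w.1) (hA : DifferentiableAt ℝ A w.1) :
    HasFDerivAt (covecLift φ A) (covecLiftDeriv φ A w) w := by
  have h1 : HasFDerivAt (fun w : Vec d × Covec d => φ w.1) _ w :=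
    hφ.hasFDerivAt.comp w hasFDerivAt_fst
  have h2 : HasFDerivAt (fun w : Vec d × Covec d => A w.1) _ w :=
    hA.hasFDerivAt.comp w hasFDerivAt_fst
  refine (h1.prodMk (hasFDerivAt_snd.clm_comp h2)).congr_fderiv ?_
  ext v <;> simp [covecLiftDeriv]

/-- Differentiating `A · Dφ = id` gives `DA(u) Dφ v = -A D²φ(u, v)`, and second derivatives are
symmetric. This symmetry is exactly what makes the lift to covectors symplectic. -/
lemma fderiv_inverse_apply_symm (hφ : ContDiffAt ℝ 2 φ w.1) (hA : DifferentiableAt ℝ A w.1)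
    (hAφ : ∀ᶠ z in 𝓝 w.1, (A z).comp (fderiv ℝ φ z) = ContinuousLinearMap.id ℝ _) (u v : Vec d) :
    fderiv ℝ A w.1 u (fderiv ℝ φ w.1 v) = fderiv ℝ A w.1 v (fderiv ℝ φ w.1 u) := by
  have hd : DifferentiableAt ℝ (fderiv ℝ φ) w.1 :=
    (hφ.fderiv_right (m := 1) (by norm_num)).differentiableAt (by simp)
  have key : ∀ u v : Vec d, fderiv ℝ A w.1 u (fderiv ℝ φ w.1 v) =
      -A w.1 (fderiv ℝ (fderiv ℝ φ) w.1 u v) := by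
    intro u v
    have h1 := (hA.hasFDerivAt.clm_comp hd.hasFDerivAt).congr_of_eventuallyEq
      (Filter.EventuallyEq.symm hAφ)
    have h2 := h1.unique (hasFDerivAt_const _ _)
    have h3 := DFunLike.congr_fun (DFunLike.congr_fun h2 u) v
    simp only [_root_.add_apply, ContinuousLinearMap.comp_apply,
      ContinuousLinearMap.compL_apply, ContinuousLinearMap.flip_apply,
      _root_.zero_apply] at h3
    rw [add_comm] at h3
    exact eq_neg_of_add_eq_zero_left h3
  have hs : IsSymmSndFDerivAt ℝ φ w.1 := hφ.isSymmSndFDerivAt (by simp)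
  rw [key, key, hs.eq]

lemma symplecticForm_covecLiftDeriv (hφ : ContDiffAt ℝ 2 φ w.1) (hA : DifferentiableAt ℝ A w.1)
    (hAφ : ∀ᶠ z in 𝓝 w.1, (A z).comp (fderiv ℝ φ z) = ContinuousLinearMap.id ℝ _)
    (v v' : Vec d × Covec d) :
    symplecticForm (covecLiftDeriv φ A w v) (covecLiftDeriv φ A w v') = symplecticForm v v' := by
  have h1 : ∀ u, A w.1 (fderiv ℝ φ w.1 u) = u := fun u =>
    DFunLike.congr_fun hAφ.self_of_nhds u
  simp only [symplecticForm, covecLiftDeriv_apply, _root_.add_apply,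
    ContinuousLinearMap.comp_apply, h1, fderiv_inverse_apply_symm hφ hA hAφ v'.1 v.1]
  ring

/-- A linear map that preserves a nondegenerate form is injective, hence surjective in finite
dimension. -/
lemma covecLiftDeriv_surjective (hφ : ContDiffAt ℝ 2 φ w.1) (hA : DifferentiableAt ℝ A w.1)
    (hAφ : ∀ᶠ z in 𝓝 w.1, (A z).comp (fderiv ℝ φ z) = ContinuousLinearMap.id ℝ _) :
    Function.Surjective (covecLiftDeriv φ A w) := by
  have hinj : Function.Injective (covecLiftDeriv φ A w).toLinearMap := by
    intro v v' hv
    refine eq_of_symplecticForm fun x => ?_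
    rw [← symplecticForm_covecLiftDeriv hφ hA hAφ v x, ← symplecticForm_covecLiftDeriv hφ hA hAφ v' x]
    exact congrArg (fun y => symplecticForm y (covecLiftDeriv φ A w x)) hv
  exact LinearMap.surjective_of_injective hinj

/-- A change of canonical coordinates maps Hamiltonian vector fields to each other. -/
lemma covecLiftDeriv_hamField (hφ : ContDiffAt ℝ 2 φ w.1) (hA : DifferentiableAt ℝ A w.1)
    (hAφ : ∀ᶠ z in 𝓝 w.1, (A z).comp (fderiv ℝ φ z) = ContinuousLinearMap.id ℝ _)
    {H₀ H₁ : Vec d × Covec d → ℝ} (hH : H₀ =ᶠ[𝓝 w] H₁ ∘ covecLift φ A)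
    (hH₁ : DifferentiableAt ℝ H₁ (covecLift φ A w)) :
    covecLiftDeriv φ A w (hamField H₀ w) = hamField H₁ (covecLift φ A w) := by
  refine eq_of_symplecticForm fun x' => ?_
  -- With the test vector written as an image, both pairings become the differential of the same
  -- function on `x`.
  obtain ⟨x, rfl⟩ := covecLiftDeriv_surjective hφ hA hAφ x'
  rw [symplecticForm_covecLiftDeriv hφ hA hAφ, hamField, hamField, symplecticForm_symplGrad,
    symplecticForm_symplGrad, hH.fderiv_eq, (hH₁.hasFDerivAt.comp w
      (hasFDerivAt_covecLift (hφ.differentiableAt (by simp)) hA)).fderiv]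
  rfl

end Symplectic
end Cogeodesic

end

/-! ### Metric coefficients and the Hamiltonian in coordinates -/

section
namespace Cogeodesic
open Set

section MetricAlgebra
variable {d : ℕ}

/-- A positive definite symmetric bilinear form on `ℝ^d`. -/
structure IsMetric (B : Vec d →L[ℝ] Vec d →L[ℝ] ℝ) : Prop where
  symm : ∀ u v, B u v = B v u
  pos : ∀ v, v ≠ 0 → 0 < B v v

variable {B : Vec d →L[ℝ] Vec d →L[ℝ] ℝ}

lemma IsMetric.isInvertible (hB : IsMetric B) : B.IsInvertible := by
  have hinj : Function.Injective B.toLinearMap := by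
    rw [← LinearMap.ker_eq_bot, LinearMap.ker_eq_bot']
    intro v hv
    by_contra hne
    have := hB.pos v hne
    have h0 : B v = 0 := hv
    rw [h0] at this
    simp at this
  have hfr : Module.finrank ℝ (Vec d) = Module.finrank ℝ (Covec d) := by
    rw [← (LinearMap.toContinuousLinearMap (𝕜 := ℝ) (E := Vec d) (F' := ℝ)).finrank_eq]
    exact (Subspace.dual_finrank_eq).symm
  refine ⟨(LinearEquiv.ofInjectiveOfFinrankEq B.toLinearMap hinj hfr).toContinuousLinearEquiv, ?_⟩
  ext v
  rfl

lemma IsMetric.apply_inverse (hB : IsMetric B) (β : Covec d) : B (B.inverse β) = β := by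
  obtain ⟨e, he⟩ := hB.isInvertible
  rw [← he, ContinuousLinearMap.inverse_equiv]
  exact e.apply_symm_apply β

lemma IsMetric.inverse_apply (hB : IsMetric B) (v : Vec d) : B.inverse (B v) = v := by
  obtain ⟨e, he⟩ := hB.isInvertible
  rw [← he, ContinuousLinearMap.inverse_equiv]
  exact e.symm_apply_apply v

lemma IsMetric.inverse_ne_zero (hB : IsMetric B) {β : Covec d} (hβ : β ≠ 0) :
    B.inverse β ≠ 0 := by
  intro h
  rw [← hB.apply_inverse β, h, map_zero] at hβ
  exact hβ rfl

lemma IsMetric.dual_pos (hB : IsMetric B) {β : Covec d} (hβ : β ≠ 0) : 0 < β (B.inverse β) := by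
  have := hB.pos _ (hB.inverse_ne_zero hβ)
  rwa [hB.apply_inverse] at this

lemma IsMetric.dual_symm (hB : IsMetric B) (β γ : Covec d) :
    β (B.inverse γ) = γ (B.inverse β) := by
  conv_lhs => rw [← hB.apply_inverse β]
  conv_rhs => rw [← hB.apply_inverse γ]
  exact hB.symm _ _

/-- Raising an index is natural: both sides have the same `B'`-pairing with every vector of the form
`T v`, and these are all vectors. -/
lemma IsMetric.inverse_pullback {B' : Vec d →L[ℝ] Vec d →L[ℝ] ℝ} (hB : IsMetric B)
    (hB' : IsMetric B') {T : Vec d →L[ℝ] Vec d} (hT : Function.Surjective T)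
    (h : ∀ u v, B u v = B' (T u) (T v)) (β : Covec d) :
    B'.inverse β = T (B.inverse (β.comp T)) := by
  rw [← hB'.inverse_apply (T (B.inverse (β.comp T)))]
  congr 1
  ext v
  obtain ⟨v, rfl⟩ := hT v
  rw [← h, hB.apply_inverse]
  rfl

/-- The Hamiltonian `(g^{αβ} ξ_α ξ_β)^{1/2}` in canonical coordinates, for a field `G` of metric
coefficients. -/
def chartHam (G : Vec d → Vec d →L[ℝ] Vec d →L[ℝ] ℝ) (w : Vec d × Covec d) : ℝ :=
  Real.sqrt (w.2 ((G w.1).inverse w.2))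

variable {G : Vec d → Vec d →L[ℝ] Vec d →L[ℝ] ℝ} {w : Vec d × Covec d}

lemma chartHam_pos (hG : IsMetric (G w.1)) (hw : w.2 ≠ 0) : 0 < chartHam G w :=
  Real.sqrt_pos.2 (hG.dual_pos hw)

lemma contDiffAt_inverse {n : WithTop ℕ∞} (hG : IsMetric (G w.1)) (hd : ContDiffAt ℝ n G w.1) :
    ContDiffAt ℝ n (fun z => (G z).inverse) w.1 :=
  hG.isInvertible.contDiffAt_map_inverse.comp w.1 hd

lemma contDiffAt_chartHam (hG : IsMetric (G w.1)) (hd : ContDiffAt ℝ ∞ G w.1) (hw : w.2 ≠ 0) :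
    ContDiffAt ℝ ∞ (chartHam G) w := by
  have h1 : ContDiffAt ℝ ∞ (fun w : Vec d × Covec d => (G w.1).inverse) w :=
    (contDiffAt_inverse hG hd).comp w contDiffAt_fst
  exact (contDiffAt_snd.clm_apply (h1.clm_apply contDiffAt_snd)).sqrt (hG.dual_pos hw).ne'

lemma chartHam_smul {s : ℝ} (hs : 0 ≤ s) (w : Vec d × Covec d) :
    chartHam G (w.1, s • w.2) = s * chartHam G w := by
  have : (s • w.2) ((G w.1).inverse (s • w.2)) = s ^ 2 * (w.2 ((G w.1).inverse w.2)) := by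
    simp; ring
  rw [chartHam, chartHam, this, Real.sqrt_mul (sq_nonneg s), Real.sqrt_sq hs]

/-- Euler's identity for the Hamiltonian. -/
lemma snd_apply_hamField_fst (hd : DifferentiableAt ℝ (chartHam G) w) :
    w.2 (hamField (chartHam G) w).1 = chartHam G w := by
  rw [hamField, apply_symplGrad_fst]
  -- Euler's identity is the derivative at `s = 1` of the homogeneity relation along the ray through
  -- `w.2`.
  have h1 : HasDerivAt (fun s : ℝ => ((w.1, s • w.2) : Vec d × Covec d)) (0, w.2) 1 := by
    refine (hasDerivAt_const _ _).prodMk ?_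
    simpa using (hasDerivAt_id (1 : ℝ)).smul_const w.2
  have h2 : HasDerivAt (fun s : ℝ => chartHam G (w.1, s • w.2)) (fderiv ℝ (chartHam G) w (0, w.2))
      1 := by
    have h3 : HasFDerivAt (chartHam G) (fderiv ℝ (chartHam G) w)
        ((fun s : ℝ => ((w.1, s • w.2) : Vec d × Covec d)) 1) := by
      simpa using hd.hasFDerivAt
    exact h3.comp_hasDerivAt (1 : ℝ) h1
  have h4 : HasDerivAt (fun s : ℝ => chartHam G (w.1, s • w.2)) (chartHam G w) 1 := by
    have : HasDerivAt (fun s : ℝ => s * chartHam G w) (chartHam G w) 1 := by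
      simpa using (hasDerivAt_id (1 : ℝ)).mul_const (chartHam G w)
    refine this.congr_of_eventuallyEq ?_
    filter_upwards [lt_mem_nhds one_pos] with s hs
    exact chartHam_smul hs.le w
  exact h2.unique h4

end MetricAlgebra

variable {d : ℕ} {M : Type*} [TopologicalSpace M] [ChartedSpace (Vec d) M] [IsManifold (𝓡 d) ∞ M]

lemma isMetric_lower (g : RiemMetric d M) (x : M) : IsMetric (lower g x) :=
  ⟨g.symm x, g.pos x⟩

lemma metricCoeff_apply (g : RiemMetric d M) {x₀ : M} {z : Vec d} (u v : Vec d) :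
    metricCoeff g x₀ z u v = lower g ((extChartAt (𝓡 d) x₀).symm z)
      (frame x₀ ((extChartAt (𝓡 d) x₀).symm z) u) (frame x₀ ((extChartAt (𝓡 d) x₀).symm z) v) :=
  rfl

lemma metricCoeff_extChartAt (g : RiemMetric d M) {x₀ x : M}
    (hx : x ∈ (chartAt (Vec d) x₀).source) (u v : Vec d) :
    metricCoeff g x₀ (extChartAt (𝓡 d) x₀ x) u v = lower g x (frame x₀ x u) (frame x₀ x v) := by
  have : (extChartAt (𝓡 d) x₀).symm (extChartAt (𝓡 d) x₀ x) = x :=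
    (extChartAt (𝓡 d) x₀).left_inv (by simpa using hx)
  rw [metricCoeff_apply, this]

lemma metricCoeff_self (g : RiemMetric d M) (x : M) :
    metricCoeff g x (extChartAt (𝓡 d) x x) = lower g x := by
  ext u v
  rw [metricCoeff_extChartAt g (mem_chart_source _ _), frame_self]
  rfl

lemma isMetric_metricCoeff (g : RiemMetric d M) {x₀ : M} {z : Vec d}
    (hz : z ∈ (extChartAt (𝓡 d) x₀).target) : IsMetric (metricCoeff g x₀ z) := by
  have hx : (extChartAt (𝓡 d) x₀).symm z ∈ (chartAt (Vec d) x₀).source := by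
    simpa using (extChartAt (𝓡 d) x₀).map_target hz
  refine ⟨fun u v => (isMetric_lower g _).symm _ _, fun v hv => (isMetric_lower g _).pos _ ?_⟩
  intro h
  exact hv ((frame_bijective hx).1 (by rw [map_zero]; exact h))

/-- In the trivialization at `x₀` of the bundle of bilinear forms, the smooth section `g.inner` has
precisely `metricCoeff g x₀` as its coordinate expression. -/
lemma contDiffOn_metricCoeff (g : RiemMetric d M) (x₀ : M) :
    ContDiffOn ℝ ∞ (metricCoeff g x₀) (extChartAt (𝓡 d) x₀).target := by
  intro z hz
  have hmem : ∀ z ∈ (extChartAt (𝓡 d) x₀).target,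
      (extChartAt (𝓡 d) x₀).symm z ∈ (chartAt (Vec d) x₀).source := fun z hz => by
    simpa using (extChartAt (𝓡 d) x₀).map_target hz
  have : ∀ x : M, ContinuousAdd (TangentSpace (𝓡 d) x →L[ℝ] ℝ) := fun x =>
    inferInstanceAs (ContinuousAdd (Vec d →L[ℝ] ℝ))
  have h1 := g.contMDiff ((extChartAt (𝓡 d) x₀).symm z)
  set e := trivializationAt (Vec d →L[ℝ] Vec d →L[ℝ] ℝ)
    (fun x : M => TangentSpace (𝓡 d) x →L[ℝ] TangentSpace (𝓡 d) x →L[ℝ] ℝ) x₀ with he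
  have hxe : (extChartAt (𝓡 d) x₀).symm z ∈ e.baseSet := by simpa [he] using hmem z hz
  rw [Bundle.Trivialization.contMDiffAt_section_iff e hxe] at h1
  have h2 : ContMDiffWithinAt 𝓘(ℝ, Vec d) (𝓡 d) ∞ (extChartAt (𝓡 d) x₀).symm
      (extChartAt (𝓡 d) x₀).target z := contMDiffOn_extChartAt_symm x₀ z hz
  have h3 := ContMDiffAt.comp_contMDiffWithinAt z h1 h2
  rw [contMDiffWithinAt_iff_contDiffWithinAt] at h3
  refine h3.congr_of_eventuallyEq_of_mem ?_ hz
  filter_upwards [self_mem_nhdsWithin] with z' hz'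
  have hx' := hmem z' hz'
  ext u v
  simp only [Function.comp_apply, he]
  rw [hom_trivializationAt_apply]
  simp only
  rw [inCoordinates_apply_eq₂ (by simpa using hx') (by simpa using hx') (by simp),
    metricCoeff_apply]
  have hs : ∀ w, frame x₀ ((extChartAt (𝓡 d) x₀).symm z') w =
      (trivializationAt (Vec d) (TangentSpace (𝓡 d)) x₀).symm ((extChartAt (𝓡 d) x₀).symm z') w :=
    fun w => Bundle.Trivialization.symmL_apply _ (by simpa using hx') w
  rw [hs, hs]
  simp only [Bundle.Trivial.fiberBundle_trivializationAt',
    Bundle.Trivial.linearMapAt_trivialization]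
  rfl

lemma metricCoeff_transition (g : RiemMetric d M) {x₀ x₁ x : M}
    (h₀ : x ∈ (chartAt (Vec d) x₀).source) (h₁ : x ∈ (chartAt (Vec d) x₁).source) (u v : Vec d) :
    metricCoeff g x₀ (extChartAt (𝓡 d) x₀ x) u v =
      metricCoeff g x₁ (extChartAt (𝓡 d) x₁ x) (tangentCoordChange (𝓡 d) x₀ x₁ x u)
        (tangentCoordChange (𝓡 d) x₀ x₁ x v) := by
  rw [metricCoeff_extChartAt g h₀, metricCoeff_extChartAt g h₁, ← frame_comp h₀ h₁]
  rfl

lemma hamiltonian_covectorAt (g : RiemMetric d M) (x : M) (ξ : Covec d) :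
    hamiltonian g (covectorAt x ξ) = Real.sqrt (ξ ((lower g x).inverse ξ)) := rfl

lemma hamiltonian_covectorAt_eq (g : RiemMetric d M) {x₀ x : M}
    (hx : x ∈ (chartAt (Vec d) x₀).source) (ξ : Covec d) :
    hamiltonian g (covectorAt x ξ) =
      chartHam (metricCoeff g x₀) (cochart d x₀ (covectorAt x ξ)) := by
  rw [hamiltonian_covectorAt, chartHam, cochart_covectorAt]
  have hz : extChartAt (𝓡 d) x₀ x ∈ (extChartAt (𝓡 d) x₀).target :=
    (extChartAt (𝓡 d) x₀).map_source (by simpa using hx)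
  rw [IsMetric.inverse_pullback (isMetric_metricCoeff g hz) (isMetric_lower g x)
    (frame_bijective hx).2 (metricCoeff_extChartAt g hx)]
  rfl

lemma hamiltonian_eq_chartHam (g : RiemMetric d M) {x₀ : M} {p : CotangentBundle d M}
    (hp : p.1 ∈ (chartAt (Vec d) x₀).source) :
    hamiltonian g p = chartHam (metricCoeff g x₀) (cochart d x₀ p) :=
  hamiltonian_covectorAt_eq g hp p.2

end Cogeodesic

end

/-! ### The cogeodesic vector field and its independence of coordinates -/

section
namespace Cogeodesic
open Set
variable {d : ℕ} {M : Type*} [TopologicalSpace M] [ChartedSpace (Vec d) M] [IsManifold (𝓡 d) ∞ M]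

/-- The cogeodesic vector field in the canonical coordinates at `x₀`. -/
def chartField (g : RiemMetric d M) (x₀ : M) : Vec d × Covec d → Vec d × Covec d :=
  hamField (chartHam (metricCoeff g x₀))

/-- The domain of nonzero covectors in the canonical coordinates at `x₀`. -/
def phaseDomain (d : ℕ) {M : Type*} [TopologicalSpace M] [ChartedSpace (Vec d) M] (x₀ : M) :
    Set (Vec d × Covec d) :=
  (extChartAt (𝓡 d) x₀).target ×ˢ {0}ᶜ

lemma isOpen_phaseDomain (x₀ : M) : IsOpen (phaseDomain d x₀) :=
  (isOpen_extChartAt_target x₀).prod isOpen_compl_singleton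

lemma phaseDomain_subset (x₀ : M) : phaseDomain d x₀ ⊆ (cochart d x₀).target := by
  rw [cochart_target]
  exact prod_mono_right (subset_univ _)

lemma contDiffAt_metricCoeff (g : RiemMetric d M) {x₀ : M} {z : Vec d}
    (hz : z ∈ (extChartAt (𝓡 d) x₀).target) : ContDiffAt ℝ ∞ (metricCoeff g x₀) z :=
  (contDiffOn_metricCoeff g x₀).contDiffAt ((isOpen_extChartAt_target x₀).mem_nhds hz)

lemma contDiffAt_chartHam_metricCoeff (g : RiemMetric d M) {x₀ : M} {w : Vec d × Covec d}
    (hw : w ∈ phaseDomain d x₀) : ContDiffAt ℝ ∞ (chartHam (metricCoeff g x₀)) w :=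
  contDiffAt_chartHam (isMetric_metricCoeff g hw.1) (contDiffAt_metricCoeff g hw.1) hw.2

lemma contDiffOn_chartField (g : RiemMetric d M) (x₀ : M) :
    ContDiffOn ℝ ∞ (chartField g x₀) (phaseDomain d x₀) := by
  have h : ContDiffOn ℝ ∞ (chartHam (metricCoeff g x₀)) (phaseDomain d x₀) := fun w hw =>
    (contDiffAt_chartHam_metricCoeff g hw).contDiffWithinAt
  exact symplGrad.contDiff.comp_contDiffOn
    (h.fderiv_of_isOpen (m := ∞) (isOpen_phaseDomain x₀) (by simp))

lemma comp_frame_ne_zero {x₀ x : M} (hx : x ∈ (chartAt (Vec d) x₀).source) {ξ : Covec d} :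
    ξ.comp (frame x₀ x) ≠ 0 ↔ ξ ≠ 0 := by
  refine not_congr ⟨fun h => ?_, fun h => by rw [h]; rfl⟩
  ext v
  obtain ⟨u, rfl⟩ := (frame_bijective hx).2 v
  exact DFunLike.congr_fun h u

lemma cochart_snd_ne_zero {x₀ : M} {p : CotangentBundle d M}
    (hp : p.1 ∈ (chartAt (Vec d) x₀).source) : (cochart d x₀ p).2 ≠ 0 ↔ p.2 ≠ 0 := by
  rw [cochart_apply]
  exact comp_frame_ne_zero hp

lemma cochart_mem_phaseDomain {x₀ : M} {p : CotangentBundle d M}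
    (hp : p.1 ∈ (chartAt (Vec d) x₀).source) (hp2 : p.2 ≠ 0) :
    cochart d x₀ p ∈ phaseDomain d x₀ := by
  refine ⟨?_, (cochart_snd_ne_zero hp).2 hp2⟩
  rw [cochart_apply]
  exact (extChartAt (𝓡 d) x₀).map_source (by simpa using hp)

lemma cochart_symm_mem {x₀ : M} {w : Vec d × Covec d} (hw : w ∈ phaseDomain d x₀) :
    ((cochart d x₀).symm w).1 ∈ (chartAt (Vec d) x₀).source ∧ ((cochart d x₀).symm w).2 ≠ 0 := by
  have h1 := phaseDomain_subset x₀ hw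
  have h2 := mem_cochart_source.1 ((cochart d x₀).map_target h1)
  refine ⟨h2, ?_⟩
  rw [← cochart_snd_ne_zero h2, (cochart d x₀).right_inv h1]
  exact hw.2

/-- The inverse of the Jacobian of the change of coordinates from `x₀` to `x₁`. -/
def transitionInv (d : ℕ) {M : Type*} [TopologicalSpace M] [ChartedSpace (Vec d) M]
    [IsManifold (𝓡 d) ∞ M] (x₀ x₁ : M) (z : Vec d) : Vec d →L[ℝ] Vec d :=
  tangentCoordChange (𝓡 d) x₁ x₀ ((extChartAt (𝓡 d) x₀).symm z)

lemma transition_mem_overlap {x₀ x₁ : M} {z : Vec d} (hz : z ∈ overlap d x₀ x₁) :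
    transition d x₀ x₁ z ∈ overlap d x₁ x₀ ∧
      (extChartAt (𝓡 d) x₁).symm (transition d x₀ x₁ z) = (extChartAt (𝓡 d) x₀).symm z := by
  obtain ⟨h1, h2⟩ := mem_overlap.1 hz
  have h2' : (extChartAt (𝓡 d) x₀).symm z ∈ (extChartAt (𝓡 d) x₁).source := by
    rwa [extChartAt_source]
  have h3 : (extChartAt (𝓡 d) x₁).symm (transition d x₀ x₁ z) = (extChartAt (𝓡 d) x₀).symm z :=
    (extChartAt (𝓡 d) x₁).left_inv h2'
  refine ⟨mem_overlap.2 ⟨(extChartAt (𝓡 d) x₁).map_source h2', ?_⟩, h3⟩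
  rw [h3, ← extChartAt_source (𝓡 d)]
  exact (extChartAt (𝓡 d) x₀).map_target h1

/-- The inverse Jacobian is the Jacobian of the reverse transition, evaluated at the image point. -/
lemma contDiffOn_transitionInv (x₀ x₁ : M) :
    ContDiffOn ℝ ∞ (transitionInv d x₀ x₁) (overlap d x₀ x₁) := by
  have h1 : ContDiffOn ℝ ∞ (fderiv ℝ (transition d x₁ x₀)) (overlap d x₁ x₀) :=
    (contDiffOn_transition x₁ x₀).fderiv_of_isOpen (isOpen_overlap x₁ x₀) (by simp)
  refine (h1.comp (contDiffOn_transition x₀ x₁) fun z hz =>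
    (transition_mem_overlap hz).1).congr fun z hz => ?_
  obtain ⟨h2, h3⟩ := transition_mem_overlap hz
  rw [Function.comp_apply, (hasFDerivAt_transition h2).fderiv, h3]
  rfl

lemma transitionInv_comp_fderiv {x₀ x₁ : M} {z : Vec d} (hz : z ∈ overlap d x₀ x₁) :
    (transitionInv d x₀ x₁ z).comp (fderiv ℝ (transition d x₀ x₁) z) =
      ContinuousLinearMap.id ℝ _ := by
  obtain ⟨h1, h2⟩ := mem_overlap.1 hz
  rw [(hasFDerivAt_transition hz).fderiv]
  refine tangentCoordChange_comp_symm ?_ h2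
  rw [← extChartAt_source (𝓡 d)]
  exact (extChartAt (𝓡 d) x₀).map_target h1

lemma extChartAt_mem_overlap {x₀ x₁ x : M} (h₀ : x ∈ (chartAt (Vec d) x₀).source)
    (h₁ : x ∈ (chartAt (Vec d) x₁).source) : extChartAt (𝓡 d) x₀ x ∈ overlap d x₀ x₁ := by
  have h₀' : x ∈ (extChartAt (𝓡 d) x₀).source := by rwa [extChartAt_source]
  refine mem_overlap.2 ⟨(extChartAt (𝓡 d) x₀).map_source h₀', ?_⟩
  rwa [(extChartAt (𝓡 d) x₀).left_inv h₀']

lemma cochart_fst (x₀ : M) (p : CotangentBundle d M) :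
    (cochart d x₀ p).1 = extChartAt (𝓡 d) x₀ p.1 := rfl

lemma cochart_fst_mem_overlap {x₀ x₁ : M} {p : CotangentBundle d M}
    (h₀ : p.1 ∈ (chartAt (Vec d) x₀).source) (h₁ : p.1 ∈ (chartAt (Vec d) x₁).source) :
    (cochart d x₀ p).1 ∈ overlap d x₀ x₁ :=
  extChartAt_mem_overlap h₀ h₁

/-- The change of canonical coordinates. -/
lemma cochart_eq_covecLift {x₀ x₁ : M} {p : CotangentBundle d M}
    (h₀ : p.1 ∈ (chartAt (Vec d) x₀).source) (h₁ : p.1 ∈ (chartAt (Vec d) x₁).source) :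
    cochart d x₁ p =
      covecLift (transition d x₀ x₁) (transitionInv d x₀ x₁) (cochart d x₀ p) := by
  have h₀' : p.1 ∈ (extChartAt (𝓡 d) x₀).source := by rwa [extChartAt_source]
  rw [cochart_apply, cochart_apply, covecLift, transition, transitionInv]
  simp only [Function.comp_apply, (extChartAt (𝓡 d) x₀).left_inv h₀']
  rw [← frame_comp h₁ h₀]
  rfl

section Transition
variable {x₀ x₁ : M} {p : CotangentBundle d M}

lemma contDiffAt_transition (h₀ : p.1 ∈ (chartAt (Vec d) x₀).source)
    (h₁ : p.1 ∈ (chartAt (Vec d) x₁).source) :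
    ContDiffAt ℝ ∞ (transition d x₀ x₁) (cochart d x₀ p).1 :=
  (contDiffOn_transition x₀ x₁).contDiffAt ((isOpen_overlap x₀ x₁).mem_nhds
    (cochart_fst_mem_overlap h₀ h₁))

lemma differentiableAt_transitionInv (h₀ : p.1 ∈ (chartAt (Vec d) x₀).source)
    (h₁ : p.1 ∈ (chartAt (Vec d) x₁).source) :
    DifferentiableAt ℝ (transitionInv d x₀ x₁) (cochart d x₀ p).1 :=
  ((contDiffOn_transitionInv x₀ x₁).contDiffAt ((isOpen_overlap x₀ x₁).mem_nhds
    (cochart_fst_mem_overlap h₀ h₁))).differentiableAt (by simp)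

lemma eventually_transitionInv_comp (h₀ : p.1 ∈ (chartAt (Vec d) x₀).source)
    (h₁ : p.1 ∈ (chartAt (Vec d) x₁).source) :
    ∀ᶠ z in 𝓝 (cochart d x₀ p).1, (transitionInv d x₀ x₁ z).comp (fderiv ℝ (transition d x₀ x₁) z) =
      ContinuousLinearMap.id ℝ _ := by
  filter_upwards [(isOpen_overlap x₀ x₁).mem_nhds (cochart_fst_mem_overlap h₀ h₁)] with z hz
  exact transitionInv_comp_fderiv hz

/-- The differential of the change of canonical coordinates. -/
def cochartChange (d : ℕ) {M : Type*} [TopologicalSpace M] [ChartedSpace (Vec d) M]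
    [IsManifold (𝓡 d) ∞ M] (x₀ x₁ : M) (p : CotangentBundle d M) :
    (Vec d × Covec d) →L[ℝ] Vec d × Covec d :=
  covecLiftDeriv (transition d x₀ x₁) (transitionInv d x₀ x₁) (cochart d x₀ p)

lemma hasFDerivAt_cochart_change (h₀ : p.1 ∈ (chartAt (Vec d) x₀).source)
    (h₁ : p.1 ∈ (chartAt (Vec d) x₁).source) :
    HasFDerivAt (covecLift (transition d x₀ x₁) (transitionInv d x₀ x₁)) (cochartChange d x₀ x₁ p)
      (cochart d x₀ p) :=
  hasFDerivAt_covecLift ((contDiffAt_transition h₀ h₁).differentiableAt (by simp))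
    (differentiableAt_transitionInv h₀ h₁)

/-- The cogeodesic vector field does not depend on the canonical coordinates. -/
lemma cochartChange_chartField (g : RiemMetric d M) (h₀ : p.1 ∈ (chartAt (Vec d) x₀).source)
    (h₁ : p.1 ∈ (chartAt (Vec d) x₁).source) (hp : p.2 ≠ 0) :
    cochartChange d x₀ x₁ p (chartField g x₀ (cochart d x₀ p)) =
      chartField g x₁ (cochart d x₁ p) := by
  have hd := (contDiffAt_chartHam_metricCoeff g (cochart_mem_phaseDomain h₁ hp)).differentiableAt
    (by simp)
  rw [cochart_eq_covecLift h₀ h₁] at hd ⊢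
  refine covecLiftDeriv_hamField ((contDiffAt_transition h₀ h₁).of_le
    (show ((2 : ℕ∞) : WithTop ℕ∞) ≤ ∞ from WithTop.coe_le_coe.2 le_top))
    (differentiableAt_transitionInv h₀ h₁) (eventually_transitionInv_comp h₀ h₁) ?_ hd
  have hw := cochart_mem_phaseDomain h₀ hp
  have hfst : Filter.Tendsto Prod.fst (𝓝 (cochart d x₀ p)) (𝓝 (cochart d x₀ p).1) :=
    continuous_fst.continuousAt
  filter_upwards [(isOpen_phaseDomain x₀).mem_nhds hw,
    hfst.eventually ((isOpen_overlap x₀ x₁).mem_nhds (cochart_fst_mem_overlap h₀ h₁))] with w hw hw1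
  have hwt := phaseDomain_subset x₀ hw
  have hs0 := (cochart_symm_mem hw).1
  have hs1 : ((cochart d x₀).symm w).1 ∈ (chartAt (Vec d) x₁).source := by
    rw [cochart_symm_fst hwt]
    exact (mem_overlap.1 hw1).2
  have e0 := hamiltonian_eq_chartHam g hs0
  have e1 := hamiltonian_eq_chartHam g hs1
  rw [cochart_eq_covecLift hs0 hs1] at e1
  rw [(cochart d x₀).right_inv hwt] at e0 e1
  rw [← e0, e1]
  rfl

end Transition

/-- Hamilton's equations for `γ` at the time `t`. -/
def SolvesAt (g : RiemMetric d M) (γ : ℝ → CotangentBundle d M) (t : ℝ) : Prop :=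
  (γ t).2 ≠ 0 ∧ ∃ (x' : Vec d) (ξ' : Covec d),
    HasMFDerivAt 𝓘(ℝ, ℝ) (cotangentModel d) γ t
      (ContinuousLinearMap.toSpanSingleton ℝ ((x', ξ') : Vec d × Covec d)) ∧
    (∀ β : Covec d, β x' =
      mfderiv (cotangentModel d) 𝓘(ℝ, ℝ) (hamiltonian g) (γ t) ((0, β) : Vec d × Covec d)) ∧
    (∀ u : Vec d, ξ' u =
      -mfderiv (cotangentModel d) 𝓘(ℝ, ℝ) (hamiltonian g) (γ t) ((u, 0) : Vec d × Covec d))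

lemma isHamiltonianCurve_iff {g : RiemMetric d M} {γ : ℝ → CotangentBundle d M} :
    IsHamiltonianCurve g γ ↔ ∀ t, SolvesAt g γ t := Iff.rfl

lemma contMDiffAt_hamiltonian (g : RiemMetric d M) {p : CotangentBundle d M} (hp : p.2 ≠ 0) :
    ContMDiffAt (cotangentModel d) 𝓘(ℝ, ℝ) ∞ (hamiltonian g) p := by
  have h1 := (contMDiffOn_cochart p.1).contMDiffAt
    ((isOpen_cochart_source p.1).mem_nhds (mem_cochart_source_self p))
  have h2 := (contDiffAt_chartHam_metricCoeff g
    (cochart_mem_phaseDomain (mem_chart_source (Vec d) p.1) hp)).contMDiffAt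
  refine (h2.comp p h1).congr_of_eventuallyEq ?_
  filter_upwards [(isOpen_cochart_source p.1).mem_nhds (mem_cochart_source_self p)] with q hq
  exact hamiltonian_eq_chartHam g (mem_cochart_source.1 hq)

lemma mfderiv_hamiltonian (g : RiemMetric d M) {p : CotangentBundle d M} (hp : p.2 ≠ 0) :
    mfderiv (cotangentModel d) 𝓘(ℝ, ℝ) (hamiltonian g) p =
      fderiv ℝ (chartHam (metricCoeff g p.1)) (cochart d p.1 p) := by
  rw [((contMDiffAt_hamiltonian g hp).mdifferentiableAt (by simp)).mfderiv,
    ModelWithCorners.range_eq_univ, fderivWithin_univ, extChartAt_cotangent]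
  refine Filter.EventuallyEq.fderiv_eq ?_
  have hw := cochart_mem_phaseDomain (mem_chart_source (Vec d) p.1) hp
  filter_upwards [(isOpen_phaseDomain p.1).mem_nhds hw] with w hw
  rw [writtenInExtChartAt]
  simp only [Function.comp_apply, extChartAt_model_space_eq_id, PartialEquiv.refl_coe, id_eq,
    extChartAt_cotangent]
  rw [hamiltonian_eq_chartHam g (cochart_symm_mem hw).1,
    (cochart d p.1).right_inv (phaseDomain_subset p.1 hw)]

/-- In the chart at `γ t` manifold derivatives are ordinary ones, and the two families of tests in
Hamilton's equations characterize the symplectic gradient. From here on the equations are an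
ordinary differential equation in a coordinate space. -/
lemma solvesAt_iff_self {g : RiemMetric d M} {γ : ℝ → CotangentBundle d M} {t : ℝ} :
    SolvesAt g γ t ↔ (γ t).2 ≠ 0 ∧ ContinuousAt γ t ∧
      HasDerivAt (fun s => cochart d (γ t).1 (γ s))
        (chartField g (γ t).1 (cochart d (γ t).1 (γ t))) t := by
  refine and_congr_right fun hp => ?_
  set L : (Vec d × Covec d) →L[ℝ] ℝ :=
    fderiv ℝ (chartHam (metricCoeff g (γ t).1)) (cochart d (γ t).1 (γ t)) with hL
  have hmL : ∀ v : Vec d × Covec d,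
      mfderiv (cotangentModel d) 𝓘(ℝ, ℝ) (hamiltonian g) (γ t) v = L v := fun v => by
    rw [mfderiv_hamiltonian g hp]
    rfl
  have hmf : ∀ v : Vec d × Covec d, HasMFDerivAt 𝓘(ℝ, ℝ) (cotangentModel d) γ t
      (ContinuousLinearMap.toSpanSingleton ℝ v) ↔ ContinuousAt γ t ∧
      HasDerivAt (fun s => cochart d (γ t).1 (γ s)) v t := by
    intro v
    refine and_congr_right fun _ => ?_
    rw [ModelWithCorners.range_eq_univ]
    exact hasFDerivWithinAt_univ (f := fun s => cochart d (γ t).1 (γ s))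
  constructor
  · rintro ⟨x', ξ', h1, h2, h3⟩
    rw [hmf] at h1
    refine ⟨h1.1, ?_⟩
    convert! h1.2 using 1
    refine eq_of_symplecticForm fun w => ?_
    have h4 : ∀ β : Covec d, β x' = L (0, β) := fun β => (h2 β).trans (hmL _)
    have h5 : ∀ u : Vec d, ξ' u = -L (u, 0) := fun u => (h3 u).trans (congrArg Neg.neg (hmL _))
    rw [chartField, hamField, symplecticForm_symplGrad, symplecticForm, h4, h5, sub_neg_eq_add,
      ← map_add]
    simp [L]
  · rintro ⟨h1, h2⟩
    exact ⟨_, _, (hmf _).2 ⟨h1, h2⟩, fun β => (apply_symplGrad_fst L β).trans (hmL _).symm,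
      fun u => (symplGrad_snd_apply L u).trans (congrArg Neg.neg (hmL _).symm)⟩

lemma hasDerivAt_cochart_change {g : RiemMetric d M} {γ : ℝ → CotangentBundle d M} {t : ℝ}
    {x₀ x₁ : M} (h₀ : (γ t).1 ∈ (chartAt (Vec d) x₀).source)
    (h₁ : (γ t).1 ∈ (chartAt (Vec d) x₁).source) (hp : (γ t).2 ≠ 0) (hc : ContinuousAt γ t)
    (h : HasDerivAt (fun s => cochart d x₀ (γ s)) (chartField g x₀ (cochart d x₀ (γ t))) t) :
    HasDerivAt (fun s => cochart d x₁ (γ s)) (chartField g x₁ (cochart d x₁ (γ t))) t := by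
  rw [← cochartChange_chartField g h₀ h₁ hp]
  refine ((hasFDerivAt_cochart_change h₀ h₁).comp_hasDerivAt t h).congr_of_eventuallyEq ?_
  filter_upwards [hc.eventually ((isOpen_cochart_source x₀).mem_nhds (mem_cochart_source.2 h₀)),
    hc.eventually ((isOpen_cochart_source x₁).mem_nhds (mem_cochart_source.2 h₁))] with s hs0 hs1
  exact cochart_eq_covecLift (mem_cochart_source.1 hs0) (mem_cochart_source.1 hs1)

/-- Hamilton's equations in arbitrary canonical coordinates. -/
lemma solvesAt_iff {g : RiemMetric d M} {γ : ℝ → CotangentBundle d M} {t : ℝ} {x₀ : M}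
    (h₀ : (γ t).1 ∈ (chartAt (Vec d) x₀).source) :
    SolvesAt g γ t ↔ (γ t).2 ≠ 0 ∧ ContinuousAt γ t ∧
      HasDerivAt (fun s => cochart d x₀ (γ s)) (chartField g x₀ (cochart d x₀ (γ t))) t := by
  rw [solvesAt_iff_self]
  refine and_congr_right fun hp => and_congr_right fun hc =>
    ⟨hasDerivAt_cochart_change (mem_chart_source _ _) h₀ hp hc,
      hasDerivAt_cochart_change h₀ (mem_chart_source _ _) hp hc⟩

end Cogeodesic

end

/-! ### Local flow, uniqueness, conservation of energy and coordinate compactness -/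

section
namespace Cogeodesic
open Set
variable {d : ℕ} {M : Type*} [TopologicalSpace M] [ChartedSpace (Vec d) M] [IsManifold (𝓡 d) ∞ M]

lemma eventually_snd_ne_zero {p : CotangentBundle d M} (hp : p.2 ≠ 0) : ∀ᶠ q in 𝓝 p, q.2 ≠ 0 := by
  have hc : ContinuousAt (cochart d p.1) p := continuousAt_extChartAt p
  filter_upwards [hc.eventually ((isOpen_phaseDomain p.1).mem_nhds
      (cochart_mem_phaseDomain (mem_chart_source (Vec d) p.1) hp)),
    (isOpen_cochart_source p.1).mem_nhds (mem_cochart_source_self p)] with q hq hq'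
  exact (cochart_snd_ne_zero (mem_cochart_source.1 hq')).1 hq.2

/-- Points over the same base point are separated inside one chart, others by the projection. The
Hausdorff property is what lets agreement of two solutions pass to limits. -/
instance instT2SpaceCotangentBundle [T2Space M] : T2Space (CotangentBundle d M) := by
  refine ⟨fun p q hpq => ?_⟩
  by_cases h : p.1 = q.1
  · have hq : q ∈ (cochart d p.1).source := mem_cochart_source.2 (h ▸ mem_chart_source _ _)
    have hp := mem_cochart_source_self p
    obtain ⟨u, v, hu, hv, hpu, hqv, huv⟩ := t2_separation
      (fun h => hpq ((cochart d p.1).injOn hp hq h))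
    have hc : ContinuousOn (cochart d p.1) (cochart d p.1).source := continuousOn_extChartAt _
    exact ⟨_, _, hc.isOpen_inter_preimage (isOpen_cochart_source _) hu,
      hc.isOpen_inter_preimage (isOpen_cochart_source _) hv, ⟨hp, hpu⟩, ⟨hq, hqv⟩,
      (huv.preimage _).mono inter_subset_right inter_subset_right⟩
  · exact separated_by_continuous (FiberBundle.continuous_proj (Covec d) _) h

section Local
variable {g : RiemMetric d M} {γ γ₁ γ₂ : ℝ → CotangentBundle d M} {t : ℝ}

lemma SolvesAt.ne_zero (h : SolvesAt g γ t) : (γ t).2 ≠ 0 := h.1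

lemma SolvesAt.continuousAt (h : SolvesAt g γ t) : ContinuousAt γ t :=
  (solvesAt_iff_self.1 h).2.1

lemma SolvesAt.congr (h : SolvesAt g γ₁ t) (he : γ₁ =ᶠ[𝓝 t] γ₂) : SolvesAt g γ₂ t := by
  rw [solvesAt_iff_self] at h ⊢
  rw [← he.self_of_nhds]
  refine ⟨h.1, h.2.1.congr he, h.2.2.congr_of_eventuallyEq ?_⟩
  filter_upwards [he] with s hs
  rw [hs]

lemma SolvesAt.comp_add {s : ℝ} (h : SolvesAt g γ (t + s)) : SolvesAt g (fun τ => γ (τ + s)) t := by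
  rw [solvesAt_iff_self] at h ⊢
  refine ⟨h.1, ?_, h.2.2.comp_add_const t s⟩
  exact ContinuousAt.comp (g := γ) (f := fun τ => τ + s) h.2.1 (by fun_prop)

/-- Near a nonzero covector Hamilton's equations have a smooth local flow. -/
lemma exists_local_flow (g : RiemMetric d M) {p₀ : CotangentBundle d M} (hp₀ : p₀.2 ≠ 0) :
    ∃ F : ℝ → CotangentBundle d M → CotangentBundle d M, ∃ ε > 0, ∀ᶠ q in 𝓝 p₀, F 0 q = q ∧
      ∀ s, |s| < ε → SolvesAt g (fun s => F s q) s ∧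
        ContMDiffAt (𝓘(ℝ, ℝ).prod (cotangentModel d)) (cotangentModel d) ∞
          (fun u : ℝ × CotangentBundle d M => F u.1 u.2) (s, q) := by
  set x₀ := p₀.1
  have hw₀ := cochart_mem_phaseDomain (mem_chart_source (Vec d) x₀) hp₀
  obtain ⟨φ, hφ⟩ := SmoothDependence.exists_smooth_local_flow (isOpen_phaseDomain x₀)
    (contDiffOn_chartField g x₀) hw₀
  obtain ⟨ε, hε, hball⟩ := Metric.eventually_nhds_iff_ball.1 hφ
  have hin : ∀ s w, |s| < ε → w ∈ Metric.ball (cochart d x₀ p₀) ε →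
      ((s, w) : ℝ × _) ∈ Metric.ball ((0 : ℝ), cochart d x₀ p₀) ε := by
    intro s w hs hw
    rw [← ball_prod_same]
    exact ⟨by simpa using hs, hw⟩
  have hc : ContinuousAt (cochart d x₀) p₀ := continuousAt_extChartAt p₀
  refine ⟨fun s q => (cochart d x₀).symm (φ (s, cochart d x₀ q)), ε, hε, ?_⟩
  filter_upwards [hc.eventually (Metric.ball_mem_nhds _ hε),
    (isOpen_cochart_source x₀).mem_nhds (mem_cochart_source_self p₀)] with q hq hqs
  refine ⟨?_, fun s hs => ?_⟩
  · rw [(hball _ (hin 0 _ (by simpa using hε) hq)).1]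
    exact (cochart d x₀).left_inv hqs
  obtain ⟨-, h2, h3, h4⟩ := hball _ (hin s _ hs hq)
  have hsm : ContMDiffAt 𝓘(ℝ, Vec d × Covec d) (cotangentModel d) ∞ (cochart d x₀).symm
      (φ (s, cochart d x₀ q)) := (contMDiffOn_cochart_symm x₀).contMDiffAt
    ((isOpen_cochart_target x₀).mem_nhds (phaseDomain_subset x₀ h2))
  have hcont : ContMDiffAt (𝓘(ℝ, ℝ).prod (cotangentModel d)) (cotangentModel d) ∞
      (fun u : ℝ × CotangentBundle d M => (cochart d x₀).symm (φ (u.1, cochart d x₀ u.2)))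
      (s, q) := by
    have h5 : ContMDiffAt (𝓘(ℝ, ℝ).prod (cotangentModel d)) 𝓘(ℝ, Vec d × Covec d) ∞
        (fun u : ℝ × CotangentBundle d M => cochart d x₀ u.2) (s, q) :=
      ContMDiffAt.comp (s, q) ((contMDiffOn_cochart x₀).contMDiffAt
        ((isOpen_cochart_source x₀).mem_nhds hqs)) contMDiffAt_snd
    have h6 : ContMDiffAt (𝓘(ℝ, ℝ).prod (cotangentModel d)) 𝓘(ℝ, ℝ × (Vec d × Covec d)) ∞
        (fun u : ℝ × CotangentBundle d M => (u.1, cochart d x₀ u.2)) (s, q) :=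
      contMDiffAt_fst.prodMk_space h5
    exact hsm.comp (s, q) (h3.contMDiffAt.comp (s, q) h6)
  refine ⟨?_, hcont⟩
  obtain ⟨h7, h8⟩ := cochart_symm_mem h2
  rw [solvesAt_iff h7]
  refine ⟨h8, ?_, ?_⟩
  · exact ContinuousAt.comp (g := (cochart d x₀).symm) hsm.continuousAt h4.continuousAt
  · rw [(cochart d x₀).right_inv (phaseDomain_subset x₀ h2)]
    refine h4.congr_of_eventuallyEq ?_
    filter_upwards [h4.continuousAt.eventually ((isOpen_phaseDomain x₀).mem_nhds h2)] with τ hτ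
    exact (cochart d x₀).right_inv (phaseDomain_subset x₀ hτ)

/-- A smooth field is locally Lipschitz, so Gronwall applies to both curves in the chart at their
common point. -/
lemma eventuallyEq_of_solvesAt (h₁ : ∀ᶠ s in 𝓝 t, SolvesAt g γ₁ s)
    (h₂ : ∀ᶠ s in 𝓝 t, SolvesAt g γ₂ s) (he : γ₁ t = γ₂ t) : γ₁ =ᶠ[𝓝 t] γ₂ := by
  set x₀ := (γ₁ t).1 with hx₀
  have hw := cochart_mem_phaseDomain (mem_chart_source (Vec d) x₀) h₁.self_of_nhds.ne_zero
  obtain ⟨K, s, hs, hK⟩ := (((contDiffOn_chartField g x₀).contDiffAt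
    ((isOpen_phaseDomain x₀).mem_nhds hw)).of_le
      (show (1 : WithTop ℕ∞) ≤ ∞ by simp)).exists_lipschitzOnWith
  have aux : ∀ γ : ℝ → CotangentBundle d M, (∀ᶠ s in 𝓝 t, SolvesAt g γ s) → γ t = γ₁ t →
      (∀ᶠ τ in 𝓝 t, HasDerivAt (fun τ => cochart d x₀ (γ τ)) (chartField g x₀ (cochart d x₀ (γ τ))) τ
        ∧ cochart d x₀ (γ τ) ∈ s) ∧ ∀ᶠ τ in 𝓝 t, γ τ ∈ (cochart d x₀).source := by
    intro γ h hγ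
    have hc := h.self_of_nhds.continuousAt
    have hsrc : ∀ᶠ τ in 𝓝 t, γ τ ∈ (cochart d x₀).source := by
      refine hc.eventually_mem ((isOpen_cochart_source x₀).mem_nhds ?_)
      rw [hγ]; exact mem_cochart_source_self _
    refine ⟨?_, hsrc⟩
    have hcc : ContinuousAt (cochart d x₀) (γ t) := by
      rw [hγ]; exact continuousAt_extChartAt (γ₁ t)
    have hcs : ∀ᶠ τ in 𝓝 t, cochart d x₀ (γ τ) ∈ s := by
      refine (ContinuousAt.comp (f := γ) hcc hc).eventually_mem ?_
      rw [Function.comp_apply, hγ]; exact hs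
    filter_upwards [h, hsrc, hcs] with τ h1 h2 h3
    exact ⟨((solvesAt_iff (mem_cochart_source.1 h2)).1 h1).2.2, h3⟩
  obtain ⟨h3, h4⟩ := aux γ₁ h₁ rfl
  obtain ⟨h5, h6⟩ := aux γ₂ h₂ he.symm
  have := ODE_solution_unique_of_eventually (v := fun _ => chartField g x₀) (s := fun _ => s)
    (Filter.Eventually.of_forall fun _ => hK) h3 h5 (by simp only [he])
  filter_upwards [this, h4, h6] with τ h7 h8 h9
  exact (cochart d x₀).injOn h8 h9 h7

/-- Uniqueness for Hamilton's equations. -/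
lemma eqOn_of_solvesAt [T2Space M] {a b t₀ : ℝ} (h₁ : ∀ s ∈ Ioo a b, SolvesAt g γ₁ s)
    (h₂ : ∀ s ∈ Ioo a b, SolvesAt g γ₂ s) (ht₀ : t₀ ∈ Ioo a b) (he : γ₁ t₀ = γ₂ t₀) :
    EqOn γ₁ γ₂ (Ioo a b) := by
  have key : ∀ s ∈ Ioo a b, γ₁ s = γ₂ s → γ₁ =ᶠ[𝓝 s] γ₂ := fun s hs hse =>
    eventuallyEq_of_solvesAt (by filter_upwards [isOpen_Ioo.mem_nhds hs] with τ hτ using h₁ τ hτ)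
      (by filter_upwards [isOpen_Ioo.mem_nhds hs] with τ hτ using h₂ τ hτ) hse
  -- Connectedness argument: the set of times near which the curves agree is open, and it is
  -- relatively closed because equality at a limit time propagates to a neighbourhood.
  have hsub : Ioo a b ⊆ {s | γ₁ =ᶠ[𝓝 s] γ₂} := by
    refine isPreconnected_Ioo.subset_of_closure_inter_subset isOpen_setOfPred_eventually_nhds
      ⟨t₀, ht₀, key t₀ ht₀ he⟩ ?_
    rintro s ⟨hs, hsI⟩
    refine key s hsI (tendsto_nhds_unique_of_frequently_eq (h₁ s hsI).continuousAt
      (h₂ s hsI).continuousAt ?_)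
    rw [mem_closure_iff_frequently] at hs
    exact hs.mono fun τ hτ => Filter.EventuallyEq.eq_of_nhds hτ
  exact fun s hs => (hsub hs).eq_of_nhds

/-- The derivative of `h` along its own symplectic gradient `X` is `ω(X, X) = 0`. -/
lemma SolvesAt.hasDerivAt_hamiltonian (h : SolvesAt g γ t) :
    HasDerivAt (fun s => hamiltonian g (γ s)) 0 t := by
  set x₀ := (γ t).1
  obtain ⟨h1, h2, h3⟩ := solvesAt_iff_self.1 h
  have hd := (contDiffAt_chartHam_metricCoeff g (cochart_mem_phaseDomain
    (mem_chart_source (Vec d) x₀) h1)).differentiableAt (by simp)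
  have h4 := hd.hasFDerivAt.comp_hasDerivAt t h3
  have h5 : fderiv ℝ (chartHam (metricCoeff g x₀)) (cochart d x₀ (γ t))
      (chartField g x₀ (cochart d x₀ (γ t))) = 0 := by
    rw [← symplecticForm_symplGrad, chartField, hamField, symplecticForm, sub_self]
  rw [h5] at h4
  refine h4.congr_of_eventuallyEq ?_
  filter_upwards [h2.eventually ((isOpen_cochart_source x₀).mem_nhds
    (mem_cochart_source_self (γ t)))] with s hs
  exact hamiltonian_eq_chartHam g (mem_cochart_source.1 hs)

lemma hamiltonian_eq_of_solvesAt {a b s t : ℝ} (h : ∀ s ∈ Ioo a b, SolvesAt g γ s)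
    (hs : s ∈ Ioo a b) (ht : t ∈ Ioo a b) : hamiltonian g (γ s) = hamiltonian g (γ t) :=
  isOpen_Ioo.is_const_of_deriv_eq_zero isPreconnected_Ioo
    (fun τ hτ => (h τ hτ).hasDerivAt_hamiltonian.differentiableAt.differentiableWithinAt)
    (fun τ hτ => (h τ hτ).hasDerivAt_hamiltonian.deriv) hs ht

end Local

section Compactness

lemma hamiltonian_pos (g : RiemMetric d M) {p : CotangentBundle d M} (hp : p.2 ≠ 0) :
    0 < hamiltonian g p := by
  rw [hamiltonian_eq_chartHam g (mem_chart_source (Vec d) p.1)]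
  have := cochart_mem_phaseDomain (mem_chart_source (Vec d) p.1) hp
  exact chartHam_pos (isMetric_metricCoeff g this.1) this.2

lemma snd_ne_zero_of_hamiltonian_pos {g : RiemMetric d M} {p : CotangentBundle d M}
    (hp : 0 < hamiltonian g p) : p.2 ≠ 0 := by
  intro h
  have h0 : ∀ ξ : Covec d, ξ = 0 → hamiltonian g (covectorAt p.1 ξ) = 0 := by
    rintro _ rfl
    exact Real.sqrt_zero
  exact hp.ne' (h0 p.2 h)

lemma continuousOn_chartHam (g : RiemMetric d M) (x₀ : M) :
    ContinuousOn (chartHam (metricCoeff g x₀)) (cochart d x₀).target := by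
  rw [cochart_target]
  intro w hw
  have h1 : ContinuousAt (fun w : Vec d × Covec d => (metricCoeff g x₀ w.1).inverse) w :=
    ContinuousAt.comp (f := Prod.fst) (g := fun z => (metricCoeff g x₀ z).inverse)
      (contDiffAt_inverse (isMetric_metricCoeff g hw.1)
        (contDiffAt_metricCoeff g hw.1)).continuousAt continuousAt_fst
  exact (Real.continuous_sqrt.continuousAt.comp
    (continuousAt_snd.clm_apply (h1.clm_apply continuousAt_snd))).continuousWithinAt

/-- On unit covectors over `K` the Hamiltonian is positive and continuous, so its reciprocal has a
bound `C`. By homogeneity a covector on the level `c` has norm at most `c * C`, and the level is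
closed in a compact product. -/
lemma isCompact_chartHam_level (g : RiemMetric d M) (x₀ : M) {K : Set (Vec d)} (hK : IsCompact K)
    (hKt : K ⊆ (extChartAt (𝓡 d) x₀).target) (c : ℝ) (hc : 0 < c) :
    IsCompact {w : Vec d × Covec d | w.1 ∈ K ∧ chartHam (metricCoeff g x₀) w = c} := by
  have hsub : ∀ S : Set (Covec d), K ×ˢ S ⊆ (cochart d x₀).target := fun S => by
    rw [cochart_target]; exact prod_mono hKt (subset_univ _)
  have hpos : ∀ w ∈ K ×ˢ Metric.sphere (0 : Covec d) 1, 0 < chartHam (metricCoeff g x₀) w := by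
    intro w hw
    refine chartHam_pos (isMetric_metricCoeff g (hKt hw.1)) ?_
    intro h0
    have := hw.2
    simp [h0] at this
  obtain ⟨C, hC⟩ := (hK.prod (isCompact_sphere (0 : Covec d) 1)).exists_bound_of_continuousOn
    (f := fun w => (chartHam (metricCoeff g x₀) w)⁻¹)
    (((continuousOn_chartHam g x₀).mono (hsub _)).inv₀ fun w hw => (hpos w hw).ne')
  have hbd : {w : Vec d × Covec d | w.1 ∈ K ∧ chartHam (metricCoeff g x₀) w = c} ⊆
      K ×ˢ Metric.closedBall (0 : Covec d) (c * C) := by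
    rintro ⟨z, ξ⟩ ⟨hz, hw⟩
    refine ⟨hz, ?_⟩
    rw [mem_closedBall_zero_iff]
    have hξ : ξ ≠ 0 := by
      rintro rfl
      have : chartHam (metricCoeff g x₀) (z, (0 : Covec d)) = 0 := by simp [chartHam]
      rw [this] at hw
      exact hc.ne hw
    have hn : 0 < ‖ξ‖ := norm_pos_iff.2 hξ
    have h1 := hC (z, ‖ξ‖⁻¹ • ξ) ⟨hz, by simp [norm_smul, hn.ne']⟩
    have h2 := chartHam_smul (G := metricCoeff g x₀) (s := ‖ξ‖⁻¹) (by positivity) (z, ξ)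
    simp only at h2
    rw [h2, hw, Real.norm_of_nonneg (by positivity), mul_inv, inv_inv, ← div_eq_mul_inv,
      div_le_iff₀ hc] at h1
    linarith
  have hcl : IsClosed ((K ×ˢ Metric.closedBall (0 : Covec d) (c * C)) ∩
      chartHam (metricCoeff g x₀) ⁻¹' {c}) :=
    ((continuousOn_chartHam g x₀).mono (hsub _)).preimage_isClosed_of_isClosed
      (hK.isClosed.prod Metric.isClosed_closedBall) isClosed_singleton
  convert (hK.prod (isCompact_closedBall _ _)).of_isClosed_subset hcl inter_subset_left using 1
  ext w
  exact ⟨fun h => ⟨hbd h, h.2⟩, fun h => ⟨h.1.1, h.2⟩⟩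

end Compactness
end Cogeodesic

end

/-! ### Completeness and smoothness of the flow on a closed manifold -/

section
namespace Cogeodesic
open Set
variable {d : ℕ} {M : Type*} [TopologicalSpace M] [ChartedSpace (Vec d) M] [IsManifold (𝓡 d) ∞ M]

lemma exists_nhds_isCompact_level (g : RiemMetric d M) (x₀ : M) {c : ℝ} (hc : 0 < c) :
    ∃ N ∈ 𝓝 x₀, IsCompact {p : CotangentBundle d M | p.1 ∈ N ∧ hamiltonian g p = c} := by
  set e := extChartAt (𝓡 d) x₀
  obtain ⟨r, hr, hball⟩ := Metric.nhds_basis_closedBall.mem_iff.1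
    ((isOpen_extChartAt_target (I := 𝓡 d) x₀).mem_nhds (mem_extChartAt_target (I := 𝓡 d) x₀))
  refine ⟨e.source ∩ e ⁻¹' Metric.closedBall (e x₀) r,
    Filter.inter_mem (extChartAt_source_mem_nhds x₀)
      ((continuousAt_extChartAt x₀).preimage_mem_nhds (Metric.closedBall_mem_nhds _ hr)), ?_⟩
  have hcomp := isCompact_chartHam_level g x₀ (isCompact_closedBall (e x₀) r) hball c hc
  have hsub : {w : Vec d × Covec d | w.1 ∈ Metric.closedBall (e x₀) r ∧
      chartHam (metricCoeff g x₀) w = c} ⊆ (cochart d x₀).target := by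
    rw [cochart_target]
    exact fun w hw => ⟨hball hw.1, mem_univ _⟩
  have himg := hcomp.image_of_continuousOn
    ((contMDiffOn_cochart_symm (d := d) x₀).continuousOn.mono hsub)
  convert himg using 1
  ext p
  constructor
  · rintro ⟨⟨h1, h2⟩, h3⟩
    rw [extChartAt_source] at h1
    refine ⟨cochart d x₀ p, ⟨?_, ?_⟩, (cochart d x₀).left_inv (mem_cochart_source.2 h1)⟩
    · rw [cochart_fst]; exact h2
    · rw [← hamiltonian_eq_chartHam g h1, h3]
  · rintro ⟨w, hw, rfl⟩
    have h0 := (cochart d x₀).map_target (hsub hw)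
    have h1 := mem_cochart_source.1 h0
    refine ⟨⟨by rw [extChartAt_source]; exact h1, ?_⟩, ?_⟩
    · change e _ ∈ Metric.closedBall (e x₀) r
      rw [← cochart_fst, (cochart d x₀).right_inv (hsub hw)]
      exact hw.1
    · rw [hamiltonian_eq_chartHam g h1, (cochart d x₀).right_inv (hsub hw)]
      exact hw.2

/-- The cosphere bundles of a compact Riemannian manifold are compact. -/
lemma isCompact_hamiltonian_level [CompactSpace M] (g : RiemMetric d M) {c : ℝ} (hc : 0 < c) :
    IsCompact {p : CotangentBundle d M | hamiltonian g p = c} := by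
  choose N hN hcomp using fun x₀ : M => exists_nhds_isCompact_level g x₀ hc
  obtain ⟨t, -, ht⟩ := isCompact_univ.elim_nhds_subcover N fun x _ => hN x
  convert t.isCompact_biUnion fun x _ => hcomp x using 1
  ext p
  simp only [mem_iUnion, mem_ofPred_eq]
  refine ⟨fun h => ?_, fun ⟨x, _, h⟩ => h.2⟩
  obtain ⟨x, hx, hp⟩ := mem_iUnion₂.1 (ht (mem_univ p.1))
  exact ⟨x, hx, hp, h⟩

section Extension
variable {g : RiemMetric d M}

/-- Local uniqueness at `t₀` makes the two curves agree on a neighbourhood, so switching there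
creates no corner. -/
lemma exists_solution_glue {γ₁ γ₂ : ℝ → CotangentBundle d M} {a b t₁ t₂ t₀ : ℝ}
    (h₁ : ∀ s ∈ Ioo a t₁, SolvesAt g γ₁ s) (h₂ : ∀ s ∈ Ioo t₂ b, SolvesAt g γ₂ s)
    (h₀ : t₀ ∈ Ioo a t₁) (h₀' : t₀ ∈ Ioo t₂ b) (he : γ₁ t₀ = γ₂ t₀) :
    ∃ γ : ℝ → CotangentBundle d M, (∀ s ∈ Ioo a b, SolvesAt g γ s) ∧
      (∀ s ≤ t₀, γ s = γ₁ s) ∧ ∀ s ≥ t₀, γ s = γ₂ s := by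
  classical
  have hcong := eventuallyEq_of_solvesAt (Filter.mem_of_superset (isOpen_Ioo.mem_nhds h₀) h₁)
    (Filter.mem_of_superset (isOpen_Ioo.mem_nhds h₀') h₂) he
  refine ⟨fun s => if s < t₀ then γ₁ s else γ₂ s, fun s hs => ?_, fun s hs => ?_, fun s hs => ?_⟩
  · rcases lt_trichotomy s t₀ with h | rfl | h
    · refine (h₁ s ⟨hs.1, h.trans h₀.2⟩).congr ?_
      filter_upwards [eventually_lt_nhds h] with τ hτ
      rw [if_pos hτ]
    · refine (h₂ s h₀').congr ?_
      filter_upwards [hcong] with τ hτ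
      rw [hτ, ite_self]
    · refine (h₂ s ⟨h₀'.1.trans h, hs.2⟩).congr ?_
      filter_upwards [eventually_gt_nhds h] with τ hτ
      rw [if_neg hτ.le.not_gt]
  · rcases hs.lt_or_eq with h | rfl
    · simp [h]
    · simp [he]
  · simp [hs.not_gt]

/-- Restarting at the times `a / 2` and `-a / 2` gains `a / 2` on each side. The restart is allowed
because the hypothesis covers the whole level set, which the solution does not leave. -/
lemma exists_solution_extend {c a : ℝ} (ha : 0 < a)
    (h : ∀ p : CotangentBundle d M, hamiltonian g p = c →
      ∃ γ, γ 0 = p ∧ ∀ s ∈ Ioo (-a) a, SolvesAt g γ s)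
    (p : CotangentBundle d M) (hp : hamiltonian g p = c) :
    ∃ γ, γ 0 = p ∧ ∀ s ∈ Ioo (-(3 / 2 * a)) (3 / 2 * a), SolvesAt g γ s := by
  obtain ⟨γ₀, h00, hs0⟩ := h p hp
  have hlev : ∀ s ∈ Ioo (-a) a, hamiltonian g (γ₀ s) = c := fun s hs => by
    rw [hamiltonian_eq_of_solvesAt hs0 hs (t := 0) ⟨by linarith, ha⟩, h00, hp]
  obtain ⟨γ₁, h10, hs1⟩ := h (γ₀ (a / 2)) (hlev _ ⟨by linarith, by linarith⟩)
  obtain ⟨γ₂, h20, hs2⟩ := h (γ₀ (-(a / 2))) (hlev _ ⟨by linarith, by linarith⟩)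
  obtain ⟨γ₃, h3, h3', -⟩ := exists_solution_glue (γ₂ := fun τ => γ₁ (τ + -(a / 2))) (t₀ := a / 2)
    (t₂ := -(a / 2)) (b := 3 / 2 * a) hs0
    (fun s hs => (hs1 _ ⟨by linarith [hs.1], by linarith [hs.2]⟩).comp_add)
    ⟨by linarith, by linarith⟩ ⟨by linarith, by linarith⟩ (by simp [h10])
  obtain ⟨γ₄, h4, -, h4'⟩ := exists_solution_glue (γ₁ := fun τ => γ₂ (τ + a / 2)) (t₀ := -(a / 2))
    (a := -(3 / 2 * a)) (t₁ := a / 2)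
    (fun s hs => (hs2 _ ⟨by linarith [hs.1], by linarith [hs.2]⟩).comp_add) h3
    ⟨by linarith, by linarith⟩ ⟨by linarith, by linarith⟩
    (by rw [h3' _ (by linarith)]; simp [h20])
  exact ⟨γ₄, by rw [h4' _ (by linarith), h3' _ (by linarith), h00], h4⟩

variable [T2Space M] [CompactSpace M]

/-- Each point of the level set has a neighbourhood with a common lifespan; compactness leaves
finitely many lifespans to minimize. -/
lemma exists_uniform_time (g : RiemMetric d M) {c : ℝ} (hc : 0 < c) :
    ∃ ε > 0, ∀ p : CotangentBundle d M, hamiltonian g p = c →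
      ∃ γ, γ 0 = p ∧ ∀ s ∈ Ioo (-ε) ε, SolvesAt g γ s := by
  refine (isCompact_hamiltonian_level g hc).induction_on
    (p := fun S => ∃ ε > 0, ∀ p ∈ S, ∃ γ, γ 0 = p ∧ ∀ s ∈ Ioo (-ε) ε, SolvesAt g γ s)
    ⟨1, one_pos, by simp⟩ ?_ ?_ ?_
  · rintro S T hST ⟨ε, hε, h⟩
    exact ⟨ε, hε, fun p hp => h p (hST hp)⟩
  · rintro S T ⟨ε, hε, h⟩ ⟨δ, hδ, h'⟩
    refine ⟨min ε δ, lt_min hε hδ, ?_⟩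
    rintro p (hp | hp)
    · obtain ⟨γ, h0, hs⟩ := h p hp
      exact ⟨γ, h0, fun s hs' => hs s ⟨by linarith [hs'.1, min_le_left ε δ],
        hs'.2.trans_le (min_le_left _ _)⟩⟩
    · obtain ⟨γ, h0, hs⟩ := h' p hp
      exact ⟨γ, h0, fun s hs' => hs s ⟨by linarith [hs'.1, min_le_right ε δ],
        hs'.2.trans_le (min_le_right _ _)⟩⟩
  · intro p hp
    have hp0 : p.2 ≠ 0 := snd_ne_zero_of_hamiltonian_pos (g := g) (by
      have : hamiltonian g p = c := hp
      rwa [this])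
    obtain ⟨F, ε, hε, hF⟩ := exists_local_flow g hp0
    refine ⟨_, mem_nhdsWithin_of_mem_nhds hF, ε, hε, fun q hq => ⟨fun s => F s q, hq.1, ?_⟩⟩
    exact fun s hs => (hq.2 s (abs_lt.2 hs)).1

lemma exists_isHamiltonianCurve (g : RiemMetric d M) {p : CotangentBundle d M} (hp : p.2 ≠ 0) :
    ∃ γ, γ 0 = p ∧ IsHamiltonianCurve g γ := by
  have hc := hamiltonian_pos g hp
  obtain ⟨ε, hε, h⟩ := exists_uniform_time g hc
  have hpow : ∀ n : ℕ, ∀ q : CotangentBundle d M, hamiltonian g q = hamiltonian g p →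
      ∃ γ, γ 0 = q ∧ ∀ s ∈ Ioo (-((3 / 2) ^ n * ε)) ((3 / 2) ^ n * ε), SolvesAt g γ s := by
    intro n
    induction n with
    | zero => simpa using h
    | succ n ih =>
      intro q hq
      have := exists_solution_extend (by positivity) ih q hq
      rwa [← mul_assoc, ← pow_succ'] at this
  have hall : ∀ n : ℕ, ∃ γ : ℝ → CotangentBundle d M, γ 0 = p ∧
      ∀ s ∈ Ioo (-(n + 1 : ℝ)) (n + 1), SolvesAt g γ s := by
    intro n
    obtain ⟨m, hm⟩ := pow_unbounded_of_one_lt ((n + 1) / ε) (show (1 : ℝ) < 3 / 2 by norm_num)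
    rw [div_lt_iff₀ hε] at hm
    obtain ⟨γ, h0, hs⟩ := hpow m p rfl
    exact ⟨γ, h0, fun s hs' => hs s ⟨by linarith [hs'.1], by linarith [hs'.2]⟩⟩
  choose Γ hΓ0 hΓ using hall
  have hmono : ∀ m n : ℕ, m ≤ n → EqOn (Γ m) (Γ n) (Ioo (-(m + 1 : ℝ)) (m + 1)) := by
    intro m n hmn
    have hmn' : (m : ℝ) ≤ n := by exact_mod_cast hmn
    exact eqOn_of_solvesAt (t₀ := 0) (hΓ m)
      (fun s hs => hΓ n s ⟨by linarith [hs.1], by linarith [hs.2]⟩)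
      ⟨by linarith [Nat.cast_nonneg (α := ℝ) m], by positivity⟩ (by rw [hΓ0, hΓ0])
  -- `Γ n` lives on `(-(n + 1), n + 1)`, and `|s| < ⌊|s|⌋₊ + 1`; so evaluating `Γ ⌊|s|⌋₊` at `s` is
  -- always legitimate and coincides with every later curve.
  have hglue : ∀ n : ℕ, ∀ s ∈ Ioo (-(n + 1 : ℝ)) (n + 1), Γ ⌊|s|⌋₊ s = Γ n s := by
    intro n s hs
    have h1 := Nat.lt_floor_add_one |s|
    refine hmono _ _ ?_ (abs_lt.1 h1)
    have : |s| < (n + 1 : ℕ) := by push_cast; exact abs_lt.2 hs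
    exact Nat.lt_succ_iff.1 ((Nat.floor_lt (abs_nonneg s)).2 this)
  refine ⟨fun s => Γ ⌊|s|⌋₊ s, hΓ0 _, isHamiltonianCurve_iff.2 fun t => ?_⟩
  have ht := abs_lt.1 (Nat.lt_floor_add_one |t|)
  refine (hΓ ⌊|t|⌋₊ t ht).congr ?_
  filter_upwards [isOpen_Ioo.mem_nhds ht] with s hs
  exact (hglue _ s hs).symm

end Extension

section Flow
variable {g : RiemMetric d M} [T2Space M] [CompactSpace M] {p : CotangentBundle d M} {s t : ℝ}

lemma flow_spec (g : RiemMetric d M) (hp : p.2 ≠ 0) :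
    flow g 0 p = p ∧ IsHamiltonianCurve g (fun s => flow g s p) := by
  have H := exists_isHamiltonianCurve g hp
  have : (fun s => flow g s p) = H.choose := by
    funext s
    rw [flow, dif_pos H]
  refine ⟨?_, by rw [this]; exact H.choose_spec.2⟩
  exact (congrFun this 0).trans H.choose_spec.1

lemma flow_zero (hp : p.2 ≠ 0) : flow g 0 p = p := (flow_spec g hp).1

lemma solvesAt_flow (hp : p.2 ≠ 0) (t : ℝ) : SolvesAt g (fun s => flow g s p) t :=
  isHamiltonianCurve_iff.1 (flow_spec g hp).2 t

lemma flow_snd_ne_zero (hp : p.2 ≠ 0) (t : ℝ) : (flow g t p).2 ≠ 0 := (solvesAt_flow hp t).ne_zero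

lemma flow_eq_of_solvesAt {γ : ℝ → CotangentBundle d M} {a : ℝ} (hp : p.2 ≠ 0) (h0 : γ 0 = p)
    (h : ∀ s, |s| < a → SolvesAt g γ s) (hs : |s| < a) : flow g s p = γ s :=
  eqOn_of_solvesAt (γ₁ := fun s => flow g s p) (fun s _ => solvesAt_flow hp s)
    (fun s hs => h s (abs_lt.2 hs)) (t₀ := 0) (abs_lt.1 (by
      rw [abs_zero]; exact (abs_nonneg s).trans_lt hs)) (by rw [flow_zero hp, h0]) (abs_lt.1 hs)

lemma flow_flow (hp : p.2 ≠ 0) (s t : ℝ) : flow g s (flow g t p) = flow g (s + t) p :=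
  flow_eq_of_solvesAt (γ := fun τ => flow g (τ + t) p) (a := |s| + 1) (flow_snd_ne_zero hp t)
    (by simp) (fun τ _ => (solvesAt_flow hp (τ + t)).comp_add) (by linarith)

lemma flow_neg_flow (hp : p.2 ≠ 0) (t : ℝ) : flow g (-t) (flow g t p) = p := by
  rw [flow_flow hp, neg_add_cancel, flow_zero hp]

lemma hamiltonian_flow (hp : p.2 ≠ 0) (t : ℝ) : hamiltonian g (flow g t p) = hamiltonian g p := by
  have := hamiltonian_eq_of_solvesAt (γ := fun s => flow g s p) (a := -(|t| + 1)) (b := |t| + 1)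
    (fun s _ => solvesAt_flow hp s) (s := t) (t := 0) (abs_lt.1 (by linarith))
    (abs_lt.1 (by simp; positivity))
  rwa [flow_zero hp] at this

/-- By uniqueness the globally chosen flow coincides near each point with a smooth local flow, and
compactness of the level set makes the time bound uniform. -/
lemma exists_contMDiffAt_flow (g : RiemMetric d M) {c : ℝ} (hc : 0 < c) :
    ∃ ε > 0, ∀ p : CotangentBundle d M, hamiltonian g p = c → ∀ s, |s| < ε →
      ContMDiffAt (𝓘(ℝ, ℝ).prod (cotangentModel d)) (cotangentModel d) ∞
        (fun u : ℝ × CotangentBundle d M => flow g u.1 u.2) (s, p) := by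
  refine (isCompact_hamiltonian_level g hc).induction_on
    (p := fun S => ∃ ε > 0, ∀ p ∈ S, ∀ s, |s| < ε →
      ContMDiffAt (𝓘(ℝ, ℝ).prod (cotangentModel d)) (cotangentModel d) ∞
        (fun u : ℝ × CotangentBundle d M => flow g u.1 u.2) (s, p))
    ⟨1, one_pos, by simp⟩ ?_ ?_ ?_
  · rintro S T hST ⟨ε, hε, h⟩
    exact ⟨ε, hε, fun p hp => h p (hST hp)⟩
  · rintro S T ⟨ε, hε, h⟩ ⟨δ, hδ, h'⟩
    refine ⟨min ε δ, lt_min hε hδ, ?_⟩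
    rintro p (hp | hp) s hs
    · exact h p hp s (hs.trans_le (min_le_left _ _))
    · exact h' p hp s (hs.trans_le (min_le_right _ _))
  · intro p hp
    have hp0 : p.2 ≠ 0 := snd_ne_zero_of_hamiltonian_pos (g := g) (by
      have : hamiltonian g p = c := hp
      rwa [this])
    obtain ⟨F, ε, hε, hF⟩ := exists_local_flow g hp0
    have hF' := (hF.and (eventually_snd_ne_zero hp0)).eventually_nhds
    refine ⟨_, mem_nhdsWithin_of_mem_nhds hF', ε, hε, fun q hq s hs => ?_⟩
    refine (hq.self_of_nhds.1.2 s hs).2.congr_of_eventuallyEq ?_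
    have hab : ∀ᶠ τ in 𝓝 s, |τ| < ε := continuous_abs.continuousAt.eventually_lt_const hs
    filter_upwards [hab.prod_nhds hq] with u hu
    exact flow_eq_of_solvesAt (γ := fun s => F s u.2) hu.2.2 hu.2.1.1
      (fun s hs => (hu.2.1.2 s hs).1) hu.1

/-- The cogeodesic flow is smooth on `ℝ × T'M`. -/
lemma contMDiffAt_flow_uncurry (g : RiemMetric d M) (hp : p.2 ≠ 0) (t : ℝ) :
    ContMDiffAt (𝓘(ℝ, ℝ).prod (cotangentModel d)) (cotangentModel d) ∞
      (fun u : ℝ × CotangentBundle d M => flow g u.1 u.2) (t, p) := by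
  obtain ⟨ε, hε, h⟩ := exists_contMDiffAt_flow g (hamiltonian_pos g hp)
  have key : ∀ n : ℕ, ∀ t, |t| < (n + 1) * ε →
      ContMDiffAt (𝓘(ℝ, ℝ).prod (cotangentModel d)) (cotangentModel d) ∞
        (fun u : ℝ × CotangentBundle d M => flow g u.1 u.2) (t, p) := by
    intro n
    induction n with
    | zero => intro t ht; exact h p rfl t (by simpa using ht)
    | succ n ih =>
      intro t ht
      push_cast at ht
      -- The time is shortened proportionally, so `t'` falls under the inductive hypothesis while
      -- the remainder `t - t' = t / (n + 2)` is below `ε`. Conservation of energy keeps the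
      -- intermediate point on the level for which `ε` was chosen.
      set t' := t * ((n + 1) / (n + 2)) with ht'
      have hn : (0 : ℝ) < n + 2 := by positivity
      have h1 : |t'| < (n + 1) * ε := by
        rw [ht', abs_mul, abs_of_pos (show (0 : ℝ) < (n + 1) / (n + 2) by positivity),
          ← mul_div_assoc, div_lt_iff₀ hn]
        nlinarith [abs_nonneg t]
      have h2 : |t - t'| < ε := by
        have : t - t' = t / (n + 2) := by rw [ht']; field_simp; ring
        rw [this, abs_div, abs_of_pos hn, div_lt_iff₀ hn]
        linarith
      have h3 := h (flow g t' p) (hamiltonian_flow hp t') _ h2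
      have h4 : ContMDiffAt (𝓘(ℝ, ℝ).prod (cotangentModel d)) (cotangentModel d) ∞
          (fun u : ℝ × CotangentBundle d M => flow g t' u.2) (t, p) :=
        ContMDiffAt.comp (t, p) (g := fun u : ℝ × CotangentBundle d M => flow g u.1 u.2)
          (f := fun u : ℝ × CotangentBundle d M => (t', u.2)) (ih t' h1)
          (contMDiffAt_const.prodMk contMDiffAt_snd)
      have h5 : ContMDiffAt (𝓘(ℝ, ℝ).prod (cotangentModel d)) 𝓘(ℝ, ℝ) ∞
          (fun u : ℝ × CotangentBundle d M => u.1 - t') (t, p) :=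
        contMDiffAt_fst.sub contMDiffAt_const
      have h6 := ContMDiffAt.comp (t, p) (g := fun u : ℝ × CotangentBundle d M => flow g u.1 u.2)
          (f := fun u : ℝ × CotangentBundle d M => (u.1 - t', flow g t' u.2)) h3 (h5.prodMk h4)
      refine h6.congr_of_eventuallyEq ?_
      filter_upwards [continuousAt_snd.eventually (eventually_snd_ne_zero hp)] with u hu
      simp [flow_flow hu]
  obtain ⟨n, hn⟩ := exists_nat_gt (|t| / ε)
  rw [div_lt_iff₀ hε] at hn
  exact key n t (by nlinarith)

lemma contMDiffAt_flow (g : RiemMetric d M) (hp : p.2 ≠ 0) (t : ℝ) :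
    ContMDiffAt (cotangentModel d) (cotangentModel d) ∞ (flow g t) p :=
  ContMDiffAt.comp p (g := fun u : ℝ × CotangentBundle d M => flow g u.1 u.2)
    (f := fun p => (t, p)) (contMDiffAt_flow_uncurry g hp t)
    (contMDiffAt_const.prodMk contMDiffAt_id)

end Flow
end Cogeodesic

end

/-! ### The leaves are Lagrangian and immersed -/

section
namespace Cogeodesic
open Set
variable {d : ℕ} {M : Type*} [TopologicalSpace M] [ChartedSpace (Vec d) M] [IsManifold (𝓡 d) ∞ M]

lemma covectorAt_eq_cochart_symm (y : M) (η : Covec d) :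
    covectorAt y η = (cochart d y).symm (extChartAt (𝓡 d) y y, η) := by
  rw [← cochart_self]
  exact ((cochart d y).left_inv (mem_cochart_source_self (covectorAt y η))).symm

lemma contMDiff_covectorAt (y : M) :
    ContMDiff 𝓘(ℝ, Covec d) (cotangentModel d) ∞ (covectorAt (d := d) y) := by
  intro η
  have h1 : ((extChartAt (𝓡 d) y y, η) : Vec d × Covec d) ∈ (cochart d y).target := by
    rw [← cochart_self]
    exact (cochart d y).map_source (mem_cochart_source_self (covectorAt y η))
  have h2 := (contMDiffOn_cochart_symm (d := d) y).contMDiffAt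
    ((isOpen_cochart_target y).mem_nhds h1)
  have h3 : ContMDiffAt 𝓘(ℝ, Covec d) 𝓘(ℝ, Vec d × Covec d) ∞
      (fun η : Covec d => ((extChartAt (𝓡 d) y y, η) : Vec d × Covec d)) η :=
    (contDiff_const.prodMk contDiff_id).contMDiff η
  refine (h2.comp η h3).congr_of_eventuallyEq (Filter.Eventually.of_forall fun η' => ?_)
  exact covectorAt_eq_cochart_symm y η'

section Leaf
variable [T2Space M] [CompactSpace M] {g : RiemMetric d M} {y x₀ : M} {t : ℝ} {η : Covec d}

lemma contMDiffAt_flow_covectorAt_uncurry (g : RiemMetric d M) (y : M) (t : ℝ) (hη : η ≠ 0) :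
    ContMDiffAt 𝓘(ℝ, ℝ × Covec d) (cotangentModel d) ∞
      (fun u : ℝ × Covec d => flow g u.1 (covectorAt y u.2)) (t, η) := by
  have h1 : ContMDiffAt 𝓘(ℝ, ℝ × Covec d) 𝓘(ℝ, ℝ) ∞ (fun u : ℝ × Covec d => u.1) (t, η) :=
    contDiff_fst.contMDiff _
  have h2 : ContMDiffAt 𝓘(ℝ, ℝ × Covec d) 𝓘(ℝ, Covec d) ∞ (fun u : ℝ × Covec d => u.2) (t, η) :=
    contDiff_snd.contMDiff _
  exact ContMDiffAt.comp (t, η) (g := fun u : ℝ × CotangentBundle d M => flow g u.1 u.2)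
    (f := fun u : ℝ × Covec d => (u.1, covectorAt y u.2))
    (contMDiffAt_flow_uncurry g (p := covectorAt y η) hη t)
    (h1.prodMk (ContMDiffAt.comp (t, η) (contMDiff_covectorAt y η) h2))

lemma contMDiffAt_flow_covectorAt (g : RiemMetric d M) (y : M) (t : ℝ) (hη : η ≠ 0) :
    ContMDiffAt 𝓘(ℝ, Covec d) (cotangentModel d) ∞ (fun η => flow g t (covectorAt y η)) η :=
  ContMDiffAt.comp η (contMDiffAt_flow g (p := covectorAt y η) hη t) (contMDiff_covectorAt y η)

/-- `(t, η) ↦ (x*, ξ*)` in the canonical coordinates at `x₀`. -/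
def leafChart (g : RiemMetric d M) (y x₀ : M) (u : ℝ × Covec d) : Vec d × Covec d :=
  cochart d x₀ (flow g u.1 (covectorAt y u.2))

/-- The set of `(t, η)` such that `x*(t; y, η)` is in the domain of the preferred chart at `x₀`. -/
def leafDomain (g : RiemMetric d M) (y x₀ : M) : Set (ℝ × Covec d) :=
  {u | u.2 ≠ 0 ∧ (flow g u.1 (covectorAt y u.2)).1 ∈ (chartAt (Vec d) x₀).source}

lemma mem_leafDomain_self (hη : η ≠ 0) : (t, η) ∈ leafDomain g y (xStar g y t η) :=
  ⟨hη, mem_chart_source _ _⟩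

lemma isOpen_leafDomain (g : RiemMetric d M) (y x₀ : M) : IsOpen (leafDomain g y x₀) := by
  rw [isOpen_iff_mem_nhds]
  rintro ⟨t, η⟩ ⟨h1, h2⟩
  have hc := (contMDiffAt_flow_covectorAt_uncurry g y t h1).continuousAt
  filter_upwards [continuousAt_snd.eventually_ne h1,
    hc.eventually_mem ((isOpen_cochart_source x₀).mem_nhds (mem_cochart_source.2 h2))] with u h3 h4
  exact ⟨h3, mem_cochart_source.1 h4⟩

lemma contDiffAt_leafChart {u : ℝ × Covec d} (h : u ∈ leafDomain g y x₀) :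
    ContDiffAt ℝ ∞ (leafChart g y x₀) u := by
  have h1 := (contMDiffOn_cochart (d := d) x₀).contMDiffAt
    ((isOpen_cochart_source x₀).mem_nhds (mem_cochart_source.2 h.2))
  exact (ContMDiffAt.comp u h1 (contMDiffAt_flow_covectorAt_uncurry g y u.1 h.1)).contDiffAt

lemma leafChart_mem_phaseDomain {u : ℝ × Covec d} (h : u ∈ leafDomain g y x₀) :
    leafChart g y x₀ u ∈ phaseDomain d x₀ :=
  cochart_mem_phaseDomain h.2 (flow_snd_ne_zero (p := covectorAt y u.2) h.1 u.1)

lemma fderiv_leafChart_time {u : ℝ × Covec d} (h : u ∈ leafDomain g y x₀) :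
    fderiv ℝ (leafChart g y x₀) u (1, 0) = chartField g x₀ (leafChart g y x₀ u) := by
  have h1 := ((solvesAt_iff (x₀ := x₀) h.2).1
    (solvesAt_flow (g := g) (p := covectorAt y u.2) h.1 u.1)).2.2
  have h2 : HasDerivAt (fun s : ℝ => ((s, u.2) : ℝ × Covec d)) (1, 0) u.1 :=
    (hasDerivAt_id _).prodMk (hasDerivAt_const _ _)
  have h3 : HasDerivAt (fun s => leafChart g y x₀ (s, u.2))
      (fderiv ℝ (leafChart g y x₀) u (1, 0)) u.1 :=
    HasFDerivAt.comp_hasDerivAt (l := leafChart g y x₀) u.1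
      ((contDiffAt_leafChart h).differentiableAt (by simp)).hasFDerivAt h2
  exact h3.unique h1

/-- The differential of `η ↦ (x*, ξ*)` in the canonical coordinates at `x₀`. -/
def leafDeriv (g : RiemMetric d M) (y x₀ : M) (t : ℝ) (η : Covec d) : Covec d →L[ℝ] Vec d × Covec d :=
  (fderiv ℝ (leafChart g y x₀) (t, η)).comp (ContinuousLinearMap.inr ℝ ℝ (Covec d))

lemma hasFDerivAt_leafChart (h : (t, η) ∈ leafDomain g y x₀) :
    HasFDerivAt (fun η => leafChart g y x₀ (t, η)) (leafDeriv g y x₀ t η) η :=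
  ((contDiffAt_leafChart h).differentiableAt (by simp)).hasFDerivAt.comp η
    (hasFDerivAt_prodMk_right t η)

lemma contDiffAt_leafDeriv (h : (t, η) ∈ leafDomain g y x₀) :
    ContDiffAt ℝ ∞ (fun η => leafDeriv g y x₀ t η) η := by
  have h1 : ContDiffAt ℝ ∞ (fderiv ℝ (leafChart g y x₀)) (t, η) :=
    (contDiffAt_leafChart h).fderiv_right (m := ∞) (by simp)
  exact (ContDiffAt.comp η h1 (contDiff_prodMk_right t).contDiffAt).clm_comp contDiffAt_const

lemma flowDeriv_eq_leafDeriv (hη : η ≠ 0) :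
    flowDeriv g y t η = leafDeriv g y (xStar g y t η) t η := by
  have h1 := hasFDerivAt_leafChart (mem_leafDomain_self (g := g) (y := y) (t := t) hη)
  rw [flowDeriv, ((contMDiffAt_flow_covectorAt g y t hη).mdifferentiableAt (by simp)).mfderiv,
    ModelWithCorners.range_eq_univ, fderivWithin_univ]
  exact h1.fderiv

/-- The point `(x*, ξ*)` of the leaf. -/
lemma leafDeriv_change {x₁ : M} (h₀ : (t, η) ∈ leafDomain g y x₀) (h₁ : (t, η) ∈ leafDomain g y x₁) :
    (cochartChange d x₀ x₁ (flow g t (covectorAt y η))).comp (leafDeriv g y x₀ t η) =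
      leafDeriv g y x₁ t η := by
  have h2 := (hasFDerivAt_cochart_change h₀.2 h₁.2).comp η (hasFDerivAt_leafChart h₀)
  refine h2.unique ((hasFDerivAt_leafChart h₁).congr_of_eventuallyEq ?_)
  have hc : ContinuousAt (fun η : Covec d => ((t, η) : ℝ × Covec d)) η := by fun_prop
  filter_upwards [hc.eventually_mem ((isOpen_leafDomain g y x₀).mem_nhds h₀),
    hc.eventually_mem ((isOpen_leafDomain g y x₁).mem_nhds h₁)] with η' h3 h4
  exact (cochart_eq_covecLift h3.2 h4.2).symm

lemma leafChart_change {x₁ : M} (h₀ : (t, η) ∈ leafDomain g y x₀) (h₁ : (t, η) ∈ leafDomain g y x₁) :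
    leafChart g y x₁ (t, η) =
      covecLift (transition d x₀ x₁) (transitionInv d x₀ x₁) (leafChart g y x₀ (t, η)) :=
  cochart_eq_covecLift h₀.2 h₁.2

/-- The one-form `ξ dx` is intrinsic: the Jacobian acting on `dx` and its inverse acting on `ξ`
cancel. -/
lemma canonicalForm_change {x₁ : M} (h₀ : (t, η) ∈ leafDomain g y x₀)
    (h₁ : (t, η) ∈ leafDomain g y x₁) (u : Covec d) :
    (leafChart g y x₁ (t, η)).2 (leafDeriv g y x₁ t η u).1 =
      (leafChart g y x₀ (t, η)).2 (leafDeriv g y x₀ t η u).1 := by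
  rw [← leafDeriv_change h₀ h₁, leafChart_change h₀ h₁]
  have := (eventually_transitionInv_comp h₀.2 h₁.2).self_of_nhds
  have h2 := DFunLike.congr_fun this (leafDeriv g y x₀ t η u).1
  exact congrArg (leafChart g y x₀ (t, η)).2 h2

/-- Obtained by differentiating Euler's identity `ξ · X₁ = H`, where `X = (X₁, X₂)`, in the
direction `v`: since `dH(v) = v₂ · X₁ - X₂ · v₁`, the terms `v₂ · X₁` cancel. This is the
infinitesimal invariance of `ξ dx`. -/
lemma fderiv_chartField_fst (g : RiemMetric d M) {w : Vec d × Covec d} (hw : w ∈ phaseDomain d x₀)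
    (v : Vec d × Covec d) :
    w.2 (fderiv ℝ (chartField g x₀) w v).1 = -(chartField g x₀ w).2 v.1 := by
  have hX : HasFDerivAt (chartField g x₀) (fderiv ℝ (chartField g x₀) w) w :=
    (((contDiffOn_chartField g x₀).contDiffAt
      ((isOpen_phaseDomain x₀).mem_nhds hw)).differentiableAt (by simp)).hasFDerivAt
  have h8 : HasFDerivAt (fun w : Vec d × Covec d => w.2 (chartField g x₀ w).1) _ w :=
    hasFDerivAt_snd.clm_apply (hasFDerivAt_fst.comp w hX)
  have h9 := h8.unique (((contDiffAt_chartHam_metricCoeff g hw).differentiableAt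
    (by simp)).hasFDerivAt.congr_of_eventuallyEq (by
      filter_upwards [(isOpen_phaseDomain x₀).mem_nhds hw] with w hw
      exact snd_apply_hamField_fst
        ((contDiffAt_chartHam_metricCoeff g hw).differentiableAt (by simp))))
  have h10 := DFunLike.congr_fun h9 v
  rw [← symplecticForm_symplGrad (fderiv ℝ (chartHam (metricCoeff g x₀)) w)] at h10
  change _ = symplecticForm (chartField g x₀ w) v at h10
  simp [symplecticForm] at h10
  linarith

/-- The equation of variation: the time and `η` derivatives commute, and the time derivative of the
leaf chart is the vector field. -/
lemma hasDerivAt_leafDeriv (h : (t, η) ∈ leafDomain g y x₀) (u : Covec d) :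
    HasDerivAt (fun s => leafDeriv g y x₀ s η u)
      (fderiv ℝ (chartField g x₀) (leafChart g y x₀ (t, η)) (leafDeriv g y x₀ t η u)) t := by
  have hsm := contDiffAt_leafChart h
  have hd : HasFDerivAt (fderiv ℝ (leafChart g y x₀)) (fderiv ℝ (fderiv ℝ (leafChart g y x₀)) (t, η))
      (t, η) := ((hsm.fderiv_right (m := ∞) (by simp)).differentiableAt (by simp)).hasFDerivAt
  have hsymm : IsSymmSndFDerivAt ℝ (leafChart g y x₀) (t, η) := hsm.isSymmSndFDerivAt (by
    rw [minSmoothness_of_isRCLikeNormedField]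
    exact WithTop.coe_le_coe.2 le_top)
  have hX : HasFDerivAt (chartField g x₀) _ (leafChart g y x₀ (t, η)) :=
    (((contDiffOn_chartField g x₀).contDiffAt ((isOpen_phaseDomain x₀).mem_nhds
      (leafChart_mem_phaseDomain h))).differentiableAt (by simp)).hasFDerivAt
  have h2 : HasDerivAt (fun s => fderiv ℝ (leafChart g y x₀) (s, η))
      (fderiv ℝ (fderiv ℝ (leafChart g y x₀)) (t, η) (1, 0)) t :=
    HasFDerivAt.comp_hasDerivAt (l := fderiv ℝ (leafChart g y x₀)) t hd
      ((hasDerivAt_id t).prodMk (hasDerivAt_const t η))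
  have h3 : HasDerivAt (fun s => leafDeriv g y x₀ s η u)
      (fderiv ℝ (fderiv ℝ (leafChart g y x₀)) (t, η) (1, 0) (0, u)) t :=
    (h2.clm_apply (hasDerivAt_const t ((0 : ℝ), u))).congr_deriv (by simp)
  refine h3.congr_deriv ?_
  rw [hsymm.eq]
  have h4 : HasFDerivAt (fun w => fderiv ℝ (leafChart g y x₀) w (1, 0)) _ (t, η) :=
    hd.clm_apply (hasFDerivAt_const ((1 : ℝ), (0 : Covec d)) _)
  have h5 : HasFDerivAt (fun w => chartField g x₀ (leafChart g y x₀ w)) _ (t, η) :=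
    hX.comp (t, η) (hsm.differentiableAt (by simp)).hasFDerivAt
  have h6 := h4.unique (h5.congr_of_eventuallyEq (by
    filter_upwards [(isOpen_leafDomain g y x₀).mem_nhds h] with w hw
    exact fderiv_leafChart_time hw))
  have h7 := DFunLike.congr_fun h6 (0, u)
  simpa [leafDeriv] using h7

lemma hasDerivAt_canonicalForm (h : (t, η) ∈ leafDomain g y x₀) (u : Covec d) :
    HasDerivAt (fun s => (leafChart g y x₀ (s, η)).2 (leafDeriv g y x₀ s η u).1) 0 t := by
  have h1 : HasDerivAt (fun s => leafChart g y x₀ (s, η)) (chartField g x₀ (leafChart g y x₀ (t, η)))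
      t := ((solvesAt_iff (x₀ := x₀) h.2).1
    (solvesAt_flow (g := g) (p := covectorAt y η) h.1 t)).2.2
  have h11 : HasDerivAt (fun s => (leafChart g y x₀ (s, η)).2) _ t :=
    hasFDerivAt_snd.comp_hasDerivAt t h1
  have h12 : HasDerivAt (fun s => (leafDeriv g y x₀ s η u).1) _ t :=
    hasFDerivAt_fst.comp_hasDerivAt t (hasDerivAt_leafDeriv h u)
  refine (h11.clm_apply h12).congr_deriv ?_
  have := fderiv_chartField_fst g (leafChart_mem_phaseDomain h) (leafDeriv g y x₀ t η u)
  simp only [ContinuousLinearMap.coe_fst', ContinuousLinearMap.coe_snd'] at this ⊢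
  linarith

/-- The canonical one-form vanishes on the leaves. -/
lemma canonicalForm_leaf (h : (t, η) ∈ leafDomain g y x₀) (u : Covec d) :
    (leafChart g y x₀ (t, η)).2 (leafDeriv g y x₀ t η u).1 = 0 := by
  have hη : η ≠ 0 := h.1
  set F : ℝ → ℝ := fun s => (leafChart g y (xStar g y s η) (s, η)).2
    (leafDeriv g y (xStar g y s η) s η u).1
  have hF : ∀ s, HasDerivAt F 0 s := by
    intro s
    have hs := mem_leafDomain_self (g := g) (y := y) (t := s) hη
    refine (hasDerivAt_canonicalForm hs u).congr_of_eventuallyEq ?_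
    have hc : ContinuousAt (fun s : ℝ => ((s, η) : ℝ × Covec d)) s := by fun_prop
    filter_upwards [hc.eventually_mem ((isOpen_leafDomain g y _).mem_nhds hs)] with τ hτ
    exact canonicalForm_change hτ (mem_leafDomain_self hη) u
  have hconst := is_const_of_deriv_eq_zero (fun s => (hF s).differentiableAt)
    (fun s => (hF s).deriv) t 0
  rw [← canonicalForm_change h (mem_leafDomain_self hη)]
  refine hconst.trans ?_
  have h0 : (0, η) ∈ leafDomain g y y :=
    ⟨hη, by rw [flow_zero (p := covectorAt y η) hη]; exact mem_chart_source _ _⟩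
  have h1 : HasFDerivAt (fun η => (leafChart g y y (0, η)).1)
      ((ContinuousLinearMap.fst ℝ _ _).comp (leafDeriv g y y 0 η)) η :=
    hasFDerivAt_fst.comp η (hasFDerivAt_leafChart h0)
  -- At time zero the base point is `y` for every nonzero momentum, so the position component does
  -- not vary.
  have h2 : (leafDeriv g y y 0 η u).1 = 0 := by
    refine DFunLike.congr_fun (h1.unique ((hasFDerivAt_const (extChartAt (𝓡 d) y y)
      η).congr_of_eventuallyEq ?_)) u
    filter_upwards [eventually_ne_nhds hη] with η' hη'
    change (cochart d y (flow g 0 (covectorAt y η'))).1 = _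
    rw [flow_zero (p := covectorAt y η') hη']
    rfl
  refine (canonicalForm_change h0 (mem_leafDomain_self hη) u).trans ?_
  rw [h2, map_zero]

/-- Differentiate the vanishing of `ξ dx` on the direction `u` along `v`, exchange the roles and
subtract. The second derivatives of the parametrization cancel by symmetry and the symplectic form
remains. -/
lemma symplecticForm_leafDeriv (h : (t, η) ∈ leafDomain g y x₀) (u v : Covec d) :
    symplecticForm (leafDeriv g y x₀ t η u) (leafDeriv g y x₀ t η v) = 0 := by
  have hc : ContinuousAt (fun η : Covec d => ((t, η) : ℝ × Covec d)) η := by fun_prop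
  have hev := hc.eventually_mem ((isOpen_leafDomain g y x₀).mem_nhds h)
  have hd := ((contDiffAt_leafDeriv h).differentiableAt (by simp)).hasFDerivAt
  have key : ∀ u v : Covec d, (leafChart g y x₀ (t, η)).2
      (fderiv ℝ (fun η => leafDeriv g y x₀ t η) η v u).1 +
      (leafDeriv g y x₀ t η v).2 (leafDeriv g y x₀ t η u).1 = 0 := by
    intro u v
    have h1 : HasFDerivAt (fun η => (leafChart g y x₀ (t, η)).2) _ η :=
      hasFDerivAt_snd.comp η (hasFDerivAt_leafChart h)
    have h2 : HasFDerivAt (fun η => (leafDeriv g y x₀ t η u).1) _ η :=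
      hasFDerivAt_fst.comp η (hd.clm_apply (hasFDerivAt_const u η))
    have h3 := (h1.clm_apply h2).unique ((hasFDerivAt_const (0 : ℝ) η).congr_of_eventuallyEq (by
      filter_upwards [hev] with η' h'
      exact canonicalForm_leaf h' u))
    simpa using DFunLike.congr_fun h3 v
  have hsymm : fderiv ℝ (fun η => leafDeriv g y x₀ t η) η v u =
      fderiv ℝ (fun η => leafDeriv g y x₀ t η) η u v := by
    have h4 : ContDiffAt ℝ ∞ (fun η => leafChart g y x₀ (t, η)) η :=
      (contDiffAt_leafChart h).comp η (contDiff_prodMk_right t).contDiffAt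
    have h5 : IsSymmSndFDerivAt ℝ (fun η => leafChart g y x₀ (t, η)) η :=
      h4.isSymmSndFDerivAt (by
        rw [minSmoothness_of_isRCLikeNormedField]
        exact WithTop.coe_le_coe.2 le_top)
    have h6 : fderiv ℝ (fun η => leafChart g y x₀ (t, η)) =ᶠ[𝓝 η] fun η => leafDeriv g y x₀ t η := by
      filter_upwards [hev] with η' h' using (hasFDerivAt_leafChart h').fderiv
    rw [← h6.fderiv_eq]
    exact h5.eq v u
  have h7 := key u v
  have h8 := key v u
  rw [hsymm] at h7
  rw [symplecticForm]
  linarith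

/-- The leaves are Lagrangian. -/
lemma symplecticForm_flowDeriv (hη : η ≠ 0) (u v : Covec d) :
    symplecticForm (flowDeriv g y t η u) (flowDeriv g y t η v) = 0 := by
  rw [flowDeriv_eq_leafDeriv hη]
  exact symplecticForm_leafDeriv (mem_leafDomain_self hη) u v

/-- The momentum at time `0`, as a function on `T'M`. -/
def initialMomentum (g : RiemMetric d M) (y : M) (t : ℝ) (p : CotangentBundle d M) : Covec d :=
  (cochart d y (flow g (-t) p)).2

lemma initialMomentum_flow (hη : η ≠ 0) :
    initialMomentum g y t (flow g t (covectorAt y η)) = η := by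
  rw [initialMomentum, flow_neg_flow (p := covectorAt y η) hη, cochart_self]

lemma contMDiffAt_initialMomentum (hη : η ≠ 0) :
    ContMDiffAt (cotangentModel d) 𝓘(ℝ, Covec d) ∞ (initialMomentum g y t)
      (flow g t (covectorAt y η)) := by
  have h1 := contMDiffAt_flow g (flow_snd_ne_zero (g := g) (p := covectorAt y η) hη t) (-t)
  have h2 := (contMDiffOn_cochart (d := d) y).contMDiffAt ((isOpen_cochart_source y).mem_nhds
    (mem_cochart_source_self (covectorAt y η)))
  rw [← flow_neg_flow (g := g) (p := covectorAt y η) hη t] at h2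
  have h3 : ContMDiffAt 𝓘(ℝ, Vec d × Covec d) 𝓘(ℝ, Covec d) ∞ Prod.snd
    (cochart d y (flow g (-t) (flow g t (covectorAt y η)))) := contDiff_snd.contMDiff _
  exact ContMDiffAt.comp _ h3 (ContMDiffAt.comp _ h2 h1)

/-- The chain rule applied to the smooth left inverse `initialMomentum`. -/
lemma flowDeriv_injective (hη : η ≠ 0) : Function.Injective (flowDeriv g y t η) := by
  have h1 := ((contMDiffAt_initialMomentum (g := g) (y := y) (t := t) hη).mdifferentiableAt
    (by simp)).hasMFDerivAt
  have h2 := ((contMDiffAt_flow_covectorAt g y t hη).mdifferentiableAt (by simp)).hasMFDerivAt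
  have h3 := HasMFDerivAt.comp η h1 h2
  have h4 : HasMFDerivAt 𝓘(ℝ, Covec d) 𝓘(ℝ, Covec d)
      (initialMomentum g y t ∘ fun η => flow g t (covectorAt y η)) η
      (ContinuousLinearMap.id ℝ (Covec d)) := by
    refine (hasMFDerivAt_id (I := 𝓘(ℝ, Covec d)) η).congr_of_eventuallyEq ?_
    filter_upwards [eventually_ne_nhds hη] with η' hη'
    exact initialMomentum_flow hη'
  have h5 := hasMFDerivAt_unique h3 h4
  intro u v huv
  have hu := DFunLike.congr_fun h5 u
  have hv := DFunLike.congr_fun h5 v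
  have : (flowDeriv g y t η u) = flowDeriv g y t η v := huv
  exact hu.symm.trans ((congrArg (mfderiv (cotangentModel d) 𝓘(ℝ, Covec d) (initialMomentum g y t)
    (flow g t (covectorAt y η))) this).trans hv)

end Leaf
end Cogeodesic

end

/-! ### Covariant derivatives of covectors and their tensoriality -/

section
set_option maxSynthPendingDepth 3
namespace Cogeodesic
open Set

section Covariant
variable {d : ℕ}

/-- The covariant derivative of a covector field along a curve, in coordinates: for the velocity
`v = (q, ζ)` of a curve in `T*M` at `w = (z, ξ)`, the covector `ζ_γ - Γ^ρ_{γβ} ξ_ρ q^β`. -/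
def covDer (G : Vec d → Vec d →L[ℝ] Vec d →L[ℝ] ℝ) (w : Vec d × Covec d) :
    (Vec d × Covec d) →L[ℝ] Covec d :=
  ContinuousLinearMap.snd ℝ _ _ - ((1 / 2 : ℝ) •
    (((ContinuousLinearMap.compL ℝ (Vec d) (Covec d) ℝ
        (ContinuousLinearMap.apply ℝ ℝ ((G w.1).inverse w.2))).comp (fderiv ℝ G w.1)).flip +
      (ContinuousLinearMap.compL ℝ (Vec d) (Covec d) ℝ
        (ContinuousLinearMap.apply ℝ ℝ ((G w.1).inverse w.2))).comp (fderiv ℝ G w.1) -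
      fderiv ℝ G w.1 ((G w.1).inverse w.2))).comp (ContinuousLinearMap.fst ℝ _ _)

lemma covDer_apply {G : Vec d → Vec d →L[ℝ] Vec d →L[ℝ] ℝ} {w v : Vec d × Covec d} (u : Vec d) :
    covDer G w v u = v.2 u - 1 / 2 * (fderiv ℝ G w.1 u v.1 ((G w.1).inverse w.2) +
      fderiv ℝ G w.1 v.1 u ((G w.1).inverse w.2) -
      fderiv ℝ G w.1 ((G w.1).inverse w.2) v.1 u) := by
  simp [covDer]

/-- In finite dimension an operator-valued map is smooth as soon as its values on each fixed vector
are, so forms can be treated entry by entry. -/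
lemma contDiffAt_clm_apply {E F D : Type*} [NormedAddCommGroup E] [NormedSpace ℝ E]
    [NormedAddCommGroup F] [NormedSpace ℝ F] [NormedAddCommGroup D] [NormedSpace ℝ D]
    [FiniteDimensional ℝ E] {n : WithTop ℕ∞} {f : D → E →L[ℝ] F} {x : D} :
    ContDiffAt ℝ n f x ↔ ∀ v, ContDiffAt ℝ n (fun x => f x v) x := by
  refine ⟨fun h v => h.clm_apply contDiffAt_const, fun h => ?_⟩
  let m := Module.finrank ℝ E
  have hm : m = Module.finrank ℝ (Fin m → ℝ) := (Module.finrank_fin_fun ℝ).symm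
  let e₁ := ContinuousLinearEquiv.ofFinrankEq hm
  let e₂ := (e₁.arrowCongr (1 : F ≃L[ℝ] F)).trans (ContinuousLinearEquiv.piRing (Fin m))
  rw [← Function.id_comp f, ← e₂.symm_comp_self]
  exact e₂.symm.contDiff.contDiffAt.comp x (contDiffAt_pi.mpr fun i => h _)

lemma contDiffAt_covDer {G : Vec d → Vec d →L[ℝ] Vec d →L[ℝ] ℝ} {E : Type*} [NormedAddCommGroup E]
    [NormedSpace ℝ E] {f : E → Vec d × Covec d} {D : E → Vec d × Covec d} {x : E}
    (hG : ContDiffAt ℝ ∞ G (f x).1) (hm : IsMetric (G (f x).1)) (hf : ContDiffAt ℝ ∞ f x)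
    (hD : ContDiffAt ℝ ∞ D x) : ContDiffAt ℝ ∞ (fun x => covDer G (f x) (D x)) x := by
  have hf1 : ContDiffAt ℝ ∞ (fun x => (f x).1) x := hf.fst
  have h1 : ContDiffAt ℝ ∞ (fun x => fderiv ℝ G (f x).1) x :=
    ContDiffAt.comp x (hG.fderiv_right (m := ∞) (by simp)) hf1
  have h2 : ContDiffAt ℝ ∞ (fun x => (G (f x).1).inverse (f x).2) x :=
    (ContDiffAt.comp (g := fun z => (G z).inverse) x (contDiffAt_inverse (w := f x) hm hG) hf1).clm_apply
      hf.snd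
  refine contDiffAt_clm_apply.2 fun u => ?_
  simp only [covDer_apply]
  have h3 : ContDiffAt ℝ ∞ (fun x => (D x).2) x := hD.snd
  have h4 : ContDiffAt ℝ ∞ (fun x => (D x).1) x := hD.fst
  have hu : ContDiffAt ℝ ∞ (fun _ : E => u) x := contDiffAt_const
  exact (h3.clm_apply hu).sub (contDiffAt_const.mul
    (((((h1.clm_apply hu).clm_apply h4).clm_apply h2).add
      (((h1.clm_apply h4).clm_apply hu).clm_apply h2)).sub
      (((h1.clm_apply h2).clm_apply h4).clm_apply hu)))

variable {φ : Vec d → Vec d} {A : Vec d → Vec d →L[ℝ] Vec d} {w : Vec d × Covec d}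
  {G₀ G₁ : Vec d → Vec d →L[ℝ] Vec d →L[ℝ] ℝ}

lemma fderiv_metric_pullback (hφ : ContDiffAt ℝ 2 φ w.1)
    (hG₁ : DifferentiableAt ℝ G₁ (φ w.1)) (hG₀ : DifferentiableAt ℝ G₀ w.1)
    (hG : ∀ᶠ z in 𝓝 w.1, ∀ u v, G₀ z u v = G₁ (φ z) (fderiv ℝ φ z u) (fderiv ℝ φ z v))
    (a u v : Vec d) :
    fderiv ℝ G₀ w.1 a u v =
      fderiv ℝ G₁ (φ w.1) (fderiv ℝ φ w.1 a) (fderiv ℝ φ w.1 u) (fderiv ℝ φ w.1 v) +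
      G₁ (φ w.1) (fderiv ℝ (fderiv ℝ φ) w.1 a u) (fderiv ℝ φ w.1 v) +
      G₁ (φ w.1) (fderiv ℝ φ w.1 u) (fderiv ℝ (fderiv ℝ φ) w.1 a v) := by
  have hd : HasFDerivAt (fderiv ℝ φ) (fderiv ℝ (fderiv ℝ φ) w.1) w.1 :=
    ((hφ.fderiv_right (m := 1) (by norm_num)).differentiableAt (by simp)).hasFDerivAt
  have h1 : HasFDerivAt (fun z => G₁ (φ z)) _ w.1 :=
    HasFDerivAt.comp (g := G₁) w.1 hG₁.hasFDerivAt (hφ.differentiableAt (by simp)).hasFDerivAt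
  have h2 : HasFDerivAt (fun z => G₁ (φ z) (fderiv ℝ φ z u) (fderiv ℝ φ z v)) _ w.1 :=
    (h1.clm_apply (hd.clm_apply (hasFDerivAt_const u w.1))).clm_apply
      (hd.clm_apply (hasFDerivAt_const v w.1))
  have h3 : HasFDerivAt (fun z => G₀ z u v) _ w.1 :=
    (hG₀.hasFDerivAt.clm_apply (hasFDerivAt_const u w.1)).clm_apply (hasFDerivAt_const v w.1)
  have h4 := DFunLike.congr_fun (h3.unique (h2.congr_of_eventuallyEq (by
    filter_upwards [hG] with z hz using hz u v))) a
  simp at h4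
  linarith

/-- The covariant derivative does not depend on the coordinates. -/
lemma covDer_covecLift (hφ : ContDiffAt ℝ 2 φ w.1) (hA : DifferentiableAt ℝ A w.1)
    (hAφ : ∀ᶠ z in 𝓝 w.1, (A z).comp (fderiv ℝ φ z) = ContinuousLinearMap.id ℝ _)
    (hG₁ : DifferentiableAt ℝ G₁ (φ w.1)) (hG₀ : DifferentiableAt ℝ G₀ w.1)
    (hG : ∀ᶠ z in 𝓝 w.1, ∀ u v, G₀ z u v = G₁ (φ z) (fderiv ℝ φ z u) (fderiv ℝ φ z v))
    (hm₀ : IsMetric (G₀ w.1)) (hm₁ : IsMetric (G₁ (φ w.1))) (v : Vec d × Covec d) (u : Vec d) :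
    covDer G₁ (covecLift φ A w) (covecLiftDeriv φ A w v) (fderiv ℝ φ w.1 u) = covDer G₀ w v u := by
  have hsymm : IsSymmSndFDerivAt ℝ φ w.1 := hφ.isSymmSndFDerivAt (by simp)
  have hAφ' : ∀ u, A w.1 (fderiv ℝ φ w.1 u) = u := fun u => DFunLike.congr_fun hAφ.self_of_nhds u
  have hsurj : Function.Surjective (fderiv ℝ φ w.1) := by
    have : Function.Injective (fderiv ℝ φ w.1).toLinearMap := fun u u' h => by
      rw [← hAφ' u, ← hAφ' u']
      exact congrArg (A w.1) h
    exact LinearMap.surjective_of_injective this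
  have hsharp : (G₁ (φ w.1)).inverse (w.2.comp (A w.1)) = fderiv ℝ φ w.1 ((G₀ w.1).inverse w.2) := by
    rw [hm₀.inverse_pullback hm₁ hsurj hG.self_of_nhds]
    congr 2
    ext u
    simp [hAφ']
  have hdA : fderiv ℝ A w.1 v.1 (fderiv ℝ φ w.1 u) =
      -A w.1 (fderiv ℝ (fderiv ℝ φ) w.1 v.1 u) := by
    have hd : HasFDerivAt (fderiv ℝ φ) (fderiv ℝ (fderiv ℝ φ) w.1) w.1 :=
      ((hφ.fderiv_right (m := 1) (by norm_num)).differentiableAt (by simp)).hasFDerivAt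
    have h1 := (hA.hasFDerivAt.clm_comp hd).congr_of_eventuallyEq
      (Filter.EventuallyEq.symm hAφ)
    have h3 := DFunLike.congr_fun (DFunLike.congr_fun
      (h1.unique (hasFDerivAt_const _ _)) v.1) u
    simp only [_root_.add_apply, ContinuousLinearMap.comp_apply,
      ContinuousLinearMap.compL_apply, ContinuousLinearMap.flip_apply,
      _root_.zero_apply] at h3
    rw [add_comm] at h3
    exact eq_neg_of_add_eq_zero_left h3
  have hG₁A : G₁ (φ w.1) (fderiv ℝ (fderiv ℝ φ) w.1 v.1 u)
      (fderiv ℝ φ w.1 ((G₀ w.1).inverse w.2)) = w.2 (A w.1 (fderiv ℝ (fderiv ℝ φ) w.1 v.1 u)) := by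
    obtain ⟨x, hx⟩ := hsurj (fderiv ℝ (fderiv ℝ φ) w.1 v.1 u)
    rw [← hx, ← hG.self_of_nhds, hAφ', hm₀.symm, hm₀.apply_inverse]
  rw [covDer_apply, covDer_apply]
  simp only [covecLift, covecLiftDeriv_apply, hsharp]
  -- Six terms with `D²φ` arise from the three metric derivatives. Four cancel by symmetry; the
  -- other two add up to `ξ(A D²φ(v, u))` after the factor `1 / 2`, which offsets the derivative of
  -- `A` in the transformed momentum.
  rw [fderiv_metric_pullback hφ hG₁ hG₀ hG, fderiv_metric_pullback hφ hG₁ hG₀ hG,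
    fderiv_metric_pullback hφ hG₁ hG₀ hG, hsymm.eq u v.1, hsymm.eq ((G₀ w.1).inverse w.2) v.1,
    hsymm.eq ((G₀ w.1).inverse w.2) u]
  have s1 := hm₁.symm (fderiv ℝ (fderiv ℝ φ) w.1 v.1 ((G₀ w.1).inverse w.2)) (fderiv ℝ φ w.1 u)
  simp only [_root_.add_apply, ContinuousLinearMap.comp_apply, hAφ', hdA, map_neg] 
  linarith

end Covariant
end Cogeodesic

end

/-! ### The forms `Q` and `P`: positivity and smoothness -/

section
set_option maxSynthPendingDepth 3
namespace Cogeodesic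
open Set
variable {d : ℕ} {M : Type*} [TopologicalSpace M] [ChartedSpace (Vec d) M] [IsManifold (𝓡 d) ∞ M]

/-- Symmetry of the inverse metric moves the raising from the Christoffel symbols onto `ξ`, leaving
an expression in first derivatives of the metric only. -/
lemma sub_comp_christoffel (g : RiemMetric d M) (x : M) (ξ : Covec d) (v : Vec d × Covec d) :
    v.2 - ξ.comp (christoffel g x v.1) =
      covDer (metricCoeff g x) (extChartAt (𝓡 d) x x, ξ) v := by
  ext u
  have h : ∀ β : Covec d, ξ ((lower g x).inverse β) = β ((lower g x).inverse ξ) := fun β =>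
    (isMetric_lower g x).dual_symm ξ β
  rw [covDer_apply]
  simp only [christoffel, raise, _root_.sub_apply, ContinuousLinearMap.comp_apply, h,
    metricCoeff_self]
  simp

section Forms
variable [T2Space M] [CompactSpace M] {g : RiemMetric d M} {y x₀ : M} {t : ℝ} {η : Covec d}

lemma leafChart_self (g : RiemMetric d M) (y : M) (t : ℝ) (η : Covec d) :
    leafChart g y (xStar g y t η) (t, η) =
      (extChartAt (𝓡 d) (xStar g y t η) (xStar g y t η), xiStar g y t η) :=
  cochart_self (xStar g y t η) (xiStar g y t η)

/-- The covector obtained from `p(δη)` by lowering the index, in the canonical coordinates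
at `x₀`. -/
def momentumDeriv (g : RiemMetric d M) (y x₀ : M) (t : ℝ) (η : Covec d) : Covec d →L[ℝ] Covec d :=
  (covDer (metricCoeff g x₀) (leafChart g y x₀ (t, η))).comp (leafDeriv g y x₀ t η)

lemma positionForm_self (hη : η ≠ 0) (u v : Covec d) :
    positionForm g y t η u v = lower g (xStar g y t η) (leafDeriv g y (xStar g y t η) t η u).1
      (leafDeriv g y (xStar g y t η) t η v).1 := by
  rw [← flowDeriv_eq_leafDeriv hη]
  rfl

lemma pVec_eq (hη : η ≠ 0) (u : Covec d) :
    pVec g y t η u = raise g (xStar g y t η) (momentumDeriv g y (xStar g y t η) t η u) := by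
  have h : (flowDeriv g y t η u).2 - (xiStar g y t η : Covec d).comp
      (christoffel g (xStar g y t η) (flowDeriv g y t η u).1) =
      covDer (metricCoeff g (xStar g y t η)) (leafChart g y (xStar g y t η) (t, η))
        (flowDeriv g y t η u) := by
    rw [leafChart_self]
    exact sub_comp_christoffel g (xStar g y t η) (xiStar g y t η) (flowDeriv g y t η u)
  refine congrArg (raise g (xStar g y t η)) (h.trans ?_)
  rw [flowDeriv_eq_leafDeriv hη]
  rfl

lemma momentumForm_self (hη : η ≠ 0) (u v : Covec d) :
    momentumForm g y t η u v = momentumDeriv g y (xStar g y t η) t η u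
      ((lower g (xStar g y t η)).inverse (momentumDeriv g y (xStar g y t η) t η v)) := by
  have h : ∀ β γ : Covec d, lower g (xStar g y t η) ((lower g (xStar g y t η)).inverse β)
      ((lower g (xStar g y t η)).inverse γ) = β ((lower g (xStar g y t η)).inverse γ) := fun β γ => by
    rw [(isMetric_lower g _).apply_inverse]
  rw [← h]
  change g.inner _ (pVec g y t η u) (pVec g y t η v) = _
  rw [pVec_eq hη, pVec_eq hη]
  rfl

lemma leafChart_fst_mem (h : (t, η) ∈ leafDomain g y x₀) :
    (leafChart g y x₀ (t, η)).1 ∈ (extChartAt (𝓡 d) x₀).target :=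
  (leafChart_mem_phaseDomain h).1

lemma eventually_metricCoeff_transition (g : RiemMetric d M) {x₀ x₁ : M} {z : Vec d}
    (hz : z ∈ overlap d x₀ x₁) :
    ∀ᶠ z' in 𝓝 z, ∀ u v, metricCoeff g x₀ z' u v = metricCoeff g x₁ (transition d x₀ x₁ z')
      (fderiv ℝ (transition d x₀ x₁) z' u) (fderiv ℝ (transition d x₀ x₁) z' v) := by
  filter_upwards [(isOpen_overlap x₀ x₁).mem_nhds hz] with z' hz' u v
  obtain ⟨h1, h2⟩ := mem_overlap.1 hz'
  have h3 : (extChartAt (𝓡 d) x₀).symm z' ∈ (chartAt (Vec d) x₀).source := by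
    simpa using (extChartAt (𝓡 d) x₀).map_target h1
  have := metricCoeff_transition g h3 h2 u v
  rw [(extChartAt (𝓡 d) x₀).right_inv h1] at this
  rw [this, (hasFDerivAt_transition hz').fderiv]
  rfl

/-- The definition uses the preferred chart at `x*`, which jumps as `η` varies. Tensoriality allows
a fixed chart instead, where smoothness in `η` becomes visible. -/
lemma positionForm_eq (h : (t, η) ∈ leafDomain g y x₀) (u v : Covec d) :
    positionForm g y t η u v = metricCoeff g x₀ (leafChart g y x₀ (t, η)).1
      (leafDeriv g y x₀ t η u).1 (leafDeriv g y x₀ t η v).1 := by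
  have h₁ : (t, η) ∈ leafDomain g y (xStar g y t η) := mem_leafDomain_self h.1
  have h3 : metricCoeff g x₀ (leafChart g y x₀ (t, η)).1
      (leafDeriv g y x₀ t η u).1 (leafDeriv g y x₀ t η v).1 = _ :=
    (eventually_metricCoeff_transition g (cochart_fst_mem_overlap h.2 h₁.2)).self_of_nhds _ _
  have h4 := positionForm_self (g := g) (y := y) (t := t) h.1 u v
  rw [h4, h3, ← metricCoeff_self, ← leafDeriv_change h h₁]
  have h2 := congrArg Prod.fst (leafChart_change h h₁)
  rw [leafChart_self] at h2
  exact congrArg (fun z => metricCoeff g (xStar g y t η) z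
    (fderiv ℝ (transition d x₀ (xStar g y t η)) (leafChart g y x₀ (t, η)).1
      (leafDeriv g y x₀ t η u).1)
    (fderiv ℝ (transition d x₀ (xStar g y t η)) (leafChart g y x₀ (t, η)).1
      (leafDeriv g y x₀ t η v).1)) h2

lemma momentumForm_eq (h : (t, η) ∈ leafDomain g y x₀) (u v : Covec d) :
    momentumForm g y t η u v = momentumDeriv g y x₀ t η u
      ((metricCoeff g x₀ (leafChart g y x₀ (t, η)).1).inverse (momentumDeriv g y x₀ t η v)) := by
  set x₁ := xStar g y t η with hx₁
  have h₁ : (t, η) ∈ leafDomain g y x₁ := mem_leafDomain_self (g := g) (y := y) (t := t) h.1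
  set w := leafChart g y x₀ (t, η) with hw
  set φ := transition d x₀ x₁
  have hw1 : (leafChart g y x₁ (t, η)).1 = φ w.1 := congrArg Prod.fst (leafChart_change h h₁)
  have hm₀ : IsMetric (metricCoeff g x₀ w.1) := isMetric_metricCoeff g (leafChart_fst_mem h)
  have ht₁ : φ w.1 ∈ (extChartAt (𝓡 d) x₁).target := by
    rw [← hw1]; exact leafChart_fst_mem h₁
  have hm₁ : IsMetric (metricCoeff g x₁ (φ w.1)) := isMetric_metricCoeff g ht₁
  have hG := eventually_metricCoeff_transition g (cochart_fst_mem_overlap h.2 h₁.2)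
  have hφ : ContDiffAt ℝ 2 φ w.1 := (contDiffAt_transition h.2 h₁.2).of_le
    (show ((2 : ℕ∞) : WithTop ℕ∞) ≤ ∞ from WithTop.coe_le_coe.2 le_top)
  have hAφ := eventually_transitionInv_comp h.2 h₁.2
  -- The lowered `p(δη)` transforms as a covector; combined with naturality of raising indices this
  -- gives the invariance of `P`.
  have key : ∀ u : Covec d, (momentumDeriv g y x₁ t η u).comp (fderiv ℝ φ w.1) =
      momentumDeriv g y x₀ t η u := by
    intro u
    ext u'
    have := covDer_covecLift hφ (differentiableAt_transitionInv h.2 h₁.2) hAφ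
      ((contDiffAt_metricCoeff g ht₁).differentiableAt (by simp))
      ((contDiffAt_metricCoeff g (leafChart_fst_mem h)).differentiableAt (by simp)) hG hm₀ hm₁
      (leafDeriv g y x₀ t η u) u'
    have e1 : covecLiftDeriv φ (transitionInv d x₀ x₁) w (leafDeriv g y x₀ t η u) =
      leafDeriv g y x₁ t η u := DFunLike.congr_fun (leafDeriv_change h h₁) u
    have e2 : covecLift φ (transitionInv d x₀ x₁) w = leafChart g y x₁ (t, η) :=
      (leafChart_change h h₁).symm
    rw [e1, e2] at this
    exact this
  have hAφ' : ∀ u, transitionInv d x₀ x₁ w.1 (fderiv ℝ φ w.1 u) = u := fun u =>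
    DFunLike.congr_fun hAφ.self_of_nhds u
  have hsurj : Function.Surjective (fderiv ℝ φ w.1) := by
    have : Function.Injective (fderiv ℝ φ w.1).toLinearMap := fun u u' h => by
      rw [← hAφ' u, ← hAφ' u']
      exact congrArg (transitionInv d x₀ x₁ w.1) h
    exact LinearMap.surjective_of_injective this
  rw [momentumForm_self h.1, ← metricCoeff_self, ← hx₁]
  have hz : extChartAt (𝓡 d) x₁ x₁ = φ w.1 := by
    rw [← hw1, leafChart_self]
  rw [hz, hm₀.inverse_pullback hm₁ hsurj hG.self_of_nhds, key, ← key u]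
  rfl

/-- The bilinear form `c₁ Q + c₂ P`. -/
def combinedForm (g : RiemMetric d M) (y : M) (t c₁ c₂ : ℝ) (η : Covec d) :
    Covec d →L[ℝ] Covec d →L[ℝ] ℝ :=
  c₁ • (lower g (xStar g y t η)).bilinearComp
      ((ContinuousLinearMap.fst ℝ _ _).comp (leafDeriv g y (xStar g y t η) t η))
      ((ContinuousLinearMap.fst ℝ _ _).comp (leafDeriv g y (xStar g y t η) t η)) +
    c₂ • (((ContinuousLinearMap.apply ℝ ℝ : Vec d →L[ℝ] Covec d →L[ℝ] ℝ).comp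
      (lower g (xStar g y t η)).inverse).bilinearComp
        (momentumDeriv g y (xStar g y t η) t η) (momentumDeriv g y (xStar g y t η) t η)).flip

lemma combinedForm_apply (hη : η ≠ 0) (c₁ c₂ : ℝ) (u v : Covec d) :
    combinedForm g y t c₁ c₂ η u v =
      c₁ * positionForm g y t η u v + c₂ * momentumForm g y t η u v := by
  rw [positionForm_self hη, momentumForm_self hη]
  rfl

lemma positionForm_symm (u v : Covec d) :
    positionForm g y t η u v = positionForm g y t η v u := g.symm _ _ _

lemma momentumForm_symm (u v : Covec d) :
    momentumForm g y t η u v = momentumForm g y t η v u := g.symm _ _ _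

/-- The position and momentum forms are nonnegative and have no common null vectors. -/
lemma combinedForm_pos (hη : η ≠ 0) {c₁ c₂ : ℝ} (h₁ : 0 < c₁) (h₂ : 0 < c₂) {u : Covec d}
    (hu : u ≠ 0) : 0 < combinedForm g y t c₁ c₂ η u u := by
  rw [combinedForm_apply hη, positionForm_self hη, momentumForm_self hη]
  set x := xStar g y t η
  have hm := isMetric_lower g x
  by_cases hq : (leafDeriv g y x t η u).1 = 0
  -- With no position variation the Christoffel correction disappears, and injectivity of the
  -- differential forces the momentum variation to be nonzero.
  · have h3 : (leafDeriv g y x t η u).2 ≠ 0 := by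
      intro h0
      refine hu (flowDeriv_injective (g := g) (y := y) (t := t) hη ?_)
      rw [map_zero, flowDeriv_eq_leafDeriv hη]
      exact Prod.ext hq h0
    have h4 : momentumDeriv g y x t η u = (leafDeriv g y x t η u).2 := by
      simp [momentumDeriv, covDer, hq]
    rw [hq, h4, map_zero, mul_zero, zero_add]
    exact mul_pos h₂ (hm.dual_pos h3)
  · refine add_pos_of_pos_of_nonneg (mul_pos h₁ (hm.pos _ hq)) (mul_nonneg h₂.le ?_)
    by_cases hp : momentumDeriv g y x t η u = 0
    · rw [hp]; simp
    · exact (hm.dual_pos hp).le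

lemma contDiffAt_positionForm (hη : η ≠ 0) (u v : Covec d) :
    ContDiffAt ℝ ∞ (fun η => positionForm g y t η u v) η := by
  set x₀ := xStar g y t η
  have h := mem_leafDomain_self (g := g) (y := y) (t := t) hη
  have hf : ContDiffAt ℝ ∞ (fun η => leafChart g y x₀ (t, η)) η :=
    (contDiffAt_leafChart h).comp η (contDiff_prodMk_right t).contDiffAt
  have hD : ∀ u, ContDiffAt ℝ ∞ (fun η => (leafDeriv g y x₀ t η u).1) η := fun u =>
    ((contDiffAt_leafDeriv h).clm_apply contDiffAt_const).fst
  have h1 : ContDiffAt ℝ ∞ (fun η => metricCoeff g x₀ (leafChart g y x₀ (t, η)).1) η :=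
    ContDiffAt.comp (g := metricCoeff g x₀) η
      (contDiffAt_metricCoeff g (leafChart_fst_mem h)) hf.fst
  refine ((h1.clm_apply (hD u)).clm_apply (hD v)).congr_of_eventuallyEq ?_
  have hc : ContinuousAt (fun η : Covec d => ((t, η) : ℝ × Covec d)) η := by fun_prop
  filter_upwards [hc.eventually_mem ((isOpen_leafDomain g y _).mem_nhds h)] with η' h'
  exact positionForm_eq h' u v

lemma contDiffAt_momentumForm (hη : η ≠ 0) (u v : Covec d) :
    ContDiffAt ℝ ∞ (fun η => momentumForm g y t η u v) η := by
  set x₀ := xStar g y t η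
  have h := mem_leafDomain_self (g := g) (y := y) (t := t) hη
  have hf : ContDiffAt ℝ ∞ (fun η => leafChart g y x₀ (t, η)) η :=
    (contDiffAt_leafChart h).comp η (contDiff_prodMk_right t).contDiffAt
  have hG := contDiffAt_metricCoeff g (leafChart_fst_mem h)
  have hm := isMetric_metricCoeff g (leafChart_fst_mem h)
  have hD : ∀ u, ContDiffAt ℝ ∞ (fun η => momentumDeriv g y x₀ t η u) η := fun u =>
    contDiffAt_covDer (f := fun η => leafChart g y x₀ (t, η)) hG hm hf
      ((contDiffAt_leafDeriv h).clm_apply contDiffAt_const)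
  have h1 : ContDiffAt ℝ ∞ (fun η => (metricCoeff g x₀ (leafChart g y x₀ (t, η)).1).inverse) η :=
    ContDiffAt.comp (g := fun z => (metricCoeff g x₀ z).inverse) η
      (contDiffAt_inverse (w := leafChart g y x₀ (t, η)) hm hG) hf.fst
  refine ((hD u).clm_apply (h1.clm_apply (hD v))).congr_of_eventuallyEq ?_
  have hc : ContinuousAt (fun η : Covec d => ((t, η) : ℝ × Covec d)) η := by fun_prop
  filter_upwards [hc.eventually_mem ((isOpen_leafDomain g y _).mem_nhds h)] with η' h'
  exact momentumForm_eq h' u v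

lemma contDiffAt_combinedForm (hη : η ≠ 0) {c₁ c₂ : Covec d → ℝ} (h₁ : ContDiffAt ℝ ∞ c₁ η)
    (h₂ : ContDiffAt ℝ ∞ c₂ η) :
    ContDiffAt ℝ ∞ (fun η => combinedForm g y t (c₁ η) (c₂ η) η) η := by
  refine contDiffAt_clm_apply.2 fun u => contDiffAt_clm_apply.2 fun v => ?_
  refine ((h₁.mul (contDiffAt_positionForm (g := g) (y := y) (t := t) hη u v)).add
    (h₂.mul (contDiffAt_momentumForm (g := g) (y := y) (t := t) hη u v))).congr_of_eventuallyEq ?_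
  filter_upwards [eventually_ne_nhds hη] with η' hη'
  exact combinedForm_apply hη' _ _ u v

lemma contDiffAt_hamiltonian_covectorAt (g : RiemMetric d M) (y : M) (hη : η ≠ 0) :
    ContDiffAt ℝ ∞ (fun η => hamiltonian g (covectorAt y η)) η :=
  (ContMDiffAt.comp η (contMDiffAt_hamiltonian g (p := covectorAt y η) hη)
    (contMDiff_covectorAt y η)).contDiffAt

end Forms
end Cogeodesic

end

/-! ### Maximal atlases and metrics on manifolds with a single chart -/

section
set_option maxSynthPendingDepth 3
namespace Cogeodesic
open Set

section MaximalAtlas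
variable {E H N : Type*} [NormedAddCommGroup E] [NormedSpace ℝ E] [TopologicalSpace H]
  {I : ModelWithCorners ℝ E H} [TopologicalSpace N] [ChartedSpace H N]

lemma mem_contDiffGroupoid_of_contMDiffOn {f : OpenPartialHomeomorph H H}
    (h₁ : ContMDiffOn I I ∞ f f.source) (h₂ : ContMDiffOn I I ∞ f.symm f.target) :
    f ∈ contDiffGroupoid ∞ I := by
  have key : ∀ (f : H → H) (s : Set H), ContMDiffOn I I ∞ f s →
      ContDiffOn ℝ ∞ (I ∘ f ∘ I.symm) (I.symm ⁻¹' s ∩ range I) := by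
    intro f s h
    have := (contMDiffOn_iff.1 h).2 (I.symm 0) (I.symm 0)
    rw [extChartAt, chartAt_self_eq] at this
    simp only [mfld_simps] at this
    rwa [inter_comm] at this
  rw [contDiffGroupoid, mem_groupoid_of_pregroupoid]
  exact ⟨key _ _ h₁, key _ _ h₂⟩

lemma mem_maximalAtlas_of_contMDiffOn [IsManifold I ∞ N] {e : OpenPartialHomeomorph N H}
    (h₁ : ContMDiffOn I I ∞ e e.source) (h₂ : ContMDiffOn I I ∞ e.symm e.target) :
    e ∈ IsManifold.maximalAtlas I ∞ N := by
  rw [IsManifold.mem_maximalAtlas_iff, mem_maximalAtlas_iff]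
  intro e' he'
  have he'' := IsManifold.subset_maximalAtlas (I := I) (n := ∞) he'
  have h3 : ContMDiffOn I I ∞ e' e'.source := contMDiffOn_of_mem_maximalAtlas he''
  have h4 : ContMDiffOn I I ∞ e'.symm e'.target := contMDiffOn_symm_of_mem_maximalAtlas he''
  refine ⟨mem_contDiffGroupoid_of_contMDiffOn ?_ ?_, mem_contDiffGroupoid_of_contMDiffOn ?_ ?_⟩
  · exact (h3.comp' h₂).mono (by simp)
  · exact (h₁.comp' h4).mono (by simp)
  · exact (h₁.comp' h4).mono (by simp)
  · exact (h3.comp' h₂).mono (by simp)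

end MaximalAtlas

section SingleChart
variable {F L : Type*} [NormedAddCommGroup F] [NormedSpace ℝ F] [TopologicalSpace L]
  [ChartedSpace F L] {e : OpenPartialHomeomorph L F}

lemma contMDiff_of_chartAt_eq [IsManifold 𝓘(ℝ, F) ∞ L] (he : ∀ x : L, chartAt F x = e) :
    ContMDiff 𝓘(ℝ, F) 𝓘(ℝ, F) ∞ e := fun x => by
  rw [← he x]
  exact (contMDiffOn_chart (I := 𝓘(ℝ, F)) (n := ∞)).contMDiffAt
    ((chartAt F x).open_source.mem_nhds (mem_chart_source F x))

lemma contMDiffOn_symm_of_chartAt_eq [Nonempty L] [IsManifold 𝓘(ℝ, F) ∞ L]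
    (he : ∀ x : L, chartAt F x = e) :
    ContMDiffOn 𝓘(ℝ, F) 𝓘(ℝ, F) ∞ e.symm e.target := by
  rw [← he (Classical.arbitrary L)]
  exact contMDiffOn_chart_symm

/-- If `m` is a positive lower bound of `B v v` on the unit sphere, then `m ‖v‖² ≤ B v v`
everywhere. This boundedness is one of the fields of a Riemannian metric. -/
lemma isVonNBounded_of_pos [FiniteDimensional ℝ F] {B : F →L[ℝ] F →L[ℝ] ℝ}
    (hB : ∀ v, v ≠ 0 → 0 < B v v) : Bornology.IsVonNBounded ℝ {v : F | B v v < 1} := by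
  have hc : Continuous fun v => B v v := B.continuous.clm_apply continuous_id
  obtain ⟨m, hm, h⟩ := (isCompact_sphere (0 : F) 1).exists_forall_le' hc.continuousOn (a := 0)
    (fun v hv => hB v (by rintro rfl; simp at hv))
  rw [NormedSpace.isVonNBounded_iff]
  refine (Metric.isBounded_closedBall (x := (0 : F)) (r := Real.sqrt m⁻¹)).subset fun v hv => ?_
  rw [mem_closedBall_zero_iff]
  rcases eq_or_ne v 0 with rfl | hv0
  · simp
  have hn : 0 < ‖v‖ := norm_pos_iff.2 hv0
  have h1 := h (‖v‖⁻¹ • v) (by simp [norm_smul, hn.ne'])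
  simp only [map_smul, _root_.smul_apply, smul_eq_mul] at h1
  have h2 : m * ‖v‖ ^ 2 ≤ B v v := by
    calc m * ‖v‖ ^ 2 ≤ (‖v‖⁻¹ * (‖v‖⁻¹ * B v v)) * ‖v‖ ^ 2 := by gcongr
      _ = B v v := by field_simp
  refine Real.le_sqrt_of_sq_le ?_
  have h3 : B v v < 1 := hv
  rw [le_inv_comm₀ (by positivity) hm, ]
  rw [← one_div, le_div_iff₀ (by positivity)]
  linarith

/-- With one chart the tangent bundle has trivial transition maps, so a metric and its components
are the same data. -/
lemma tangentCoordChange_of_chartAt_eq [IsManifold 𝓘(ℝ, F) ∞ L] (he : ∀ x : L, chartAt F x = e)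
    (x₀ x : L) (v : F) : tangentCoordChange 𝓘(ℝ, F) x₀ x x v = v := by
  have : achart F x₀ = achart F x := Subtype.ext ((he x₀).trans (he x).symm)
  have h2 : tangentCoordChange 𝓘(ℝ, F) x₀ x = tangentCoordChange 𝓘(ℝ, F) x x := by
    unfold tangentCoordChange
    rw [this]
  rw [h2]
  exact tangentCoordChange_self (mem_extChartAt_source x)

/-- The bilinear form with given components on the tangent space of a manifold with a single
chart. -/
def chartInner (e : OpenPartialHomeomorph L F) (B : F → F →L[ℝ] F →L[ℝ] ℝ) (p : L) :
    TangentSpace 𝓘(ℝ, F) p →L[ℝ] TangentSpace 𝓘(ℝ, F) p →L[ℝ] ℝ :=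
  B (e p)

/-- A Riemannian metric on a manifold with a single chart, given by its components. -/
def metricOfChart [FiniteDimensional ℝ F] [IsManifold 𝓘(ℝ, F) ∞ L] (he : ∀ x : L, chartAt F x = e)
    (B : F → F →L[ℝ] F →L[ℝ] ℝ) (hB : ∀ x : L, ContDiffAt ℝ ∞ B (e x))
    (hsymm : ∀ (x : L) u v, B (e x) u v = B (e x) v u)
    (hpos : ∀ (x : L) u, u ≠ 0 → 0 < B (e x) u u) :
    Bundle.ContMDiffRiemannianMetric 𝓘(ℝ, F) ∞ F (fun p : L => TangentSpace 𝓘(ℝ, F) p) where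
  inner := chartInner e B
  symm p := hsymm p
  pos p := hpos p
  isVonNBounded p := show Bornology.IsVonNBounded ℝ {v : F | B (e p) v v < 1} from
    isVonNBounded_of_pos (hpos p)
  contMDiff := by
    intro p
    have : ∀ x : L, ContinuousAdd (TangentSpace 𝓘(ℝ, F) x →L[ℝ] ℝ) := fun x =>
      inferInstanceAs (ContinuousAdd (F →L[ℝ] ℝ))
    set E := trivializationAt (F →L[ℝ] F →L[ℝ] ℝ)
      (fun x : L => TangentSpace 𝓘(ℝ, F) x →L[ℝ] TangentSpace 𝓘(ℝ, F) x →L[ℝ] ℝ) p with hE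
    have hp : p ∈ E.baseSet := by simp [hE]
    rw [Bundle.Trivialization.contMDiffAt_section_iff E hp]
    refine ((hB p).contMDiffAt.comp p (contMDiff_of_chartAt_eq he p)).congr_of_eventuallyEq ?_
    refine Filter.Eventually.of_forall fun x => ?_
    have hx : x ∈ (chartAt F p).source := by
      rw [he p, ← he x]; exact mem_chart_source F x
    ext u v
    simp only [Function.comp_apply, hE]
    rw [hom_trivializationAt_apply]
    simp only
    rw [inCoordinates_apply_eq₂ (by simpa using hx) (by simpa using hx) (by simp)]
    have hs : ∀ w, (trivializationAt F (TangentSpace 𝓘(ℝ, F)) p).symm x w = w := fun w => by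
      rw [← Bundle.Trivialization.symmL_apply (R := ℝ) _ (by simpa using hx) w,
        TangentBundle.symmL_trivializationAt_eq_core hx]
      exact tangentCoordChange_of_chartAt_eq he p x w
    rw [hs, hs]
    simp only [Bundle.Trivial.fiberBundle_trivializationAt',
      Bundle.Trivial.linearMapAt_trivialization]
    rfl

end SingleChart
end Cogeodesic

end

/-! ### The leaf as an embedded submanifold with coordinates `η` -/

section
set_option maxSynthPendingDepth 3
namespace Cogeodesic
open Set
variable {d : ℕ} {M : Type*} [TopologicalSpace M] [ChartedSpace (Vec d) M] [IsManifold (𝓡 d) ∞ M]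
  [T2Space M] [CompactSpace M] {g : RiemMetric d M} {y : M} {t : ℝ}

lemma isOpen_setOf_snd_ne_zero : IsOpen {p : CotangentBundle d M | p.2 ≠ 0} :=
  isOpen_iff_mem_nhds.2 fun _ hp => eventually_snd_ne_zero hp

/-- The cogeodesic flow at time `t`, as a homeomorphism of `T'M`. -/
def flowHomeomorph (g : RiemMetric d M) (t : ℝ) :
    OpenPartialHomeomorph (CotangentBundle d M) (CotangentBundle d M) where
  toFun := flow g t
  invFun := flow g (-t)
  source := {p | p.2 ≠ 0}
  target := {p | p.2 ≠ 0}
  map_source' _ hp := flow_snd_ne_zero hp t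
  map_target' _ hp := flow_snd_ne_zero hp (-t)
  left_inv' _ hp := flow_neg_flow hp t
  right_inv' _ hp := by
    have := flow_neg_flow (g := g) hp (-t)
    rwa [neg_neg] at this
  open_source := isOpen_setOf_snd_ne_zero
  open_target := isOpen_setOf_snd_ne_zero
  continuousOn_toFun _ hp := (contMDiffAt_flow g hp t).continuousAt.continuousWithinAt
  continuousOn_invFun _ hp := (contMDiffAt_flow g hp (-t)).continuousAt.continuousWithinAt

/-- The translation of canonical coordinates that moves the base point with coordinates `c` to the
origin. -/
def baseTranslation (c : Vec d) :
    OpenPartialHomeomorph (ModelProd (Vec d) (Covec d)) (ModelProd (Vec d) (Covec d)) :=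
  ((Homeomorph.subRight c).prodCongr (Homeomorph.refl (Covec d))).toOpenPartialHomeomorph

lemma contMDiff_baseTranslation (c : Vec d) :
    ContMDiff (cotangentModel d) (cotangentModel d) ∞ (baseTranslation c) := by
  have h1 : ContMDiff (𝓡 d) (𝓡 d) ∞ (fun z : Vec d => z - c) :=
    (contDiff_id.sub contDiff_const).contMDiff
  have h2 := h1.prodMap (contMDiff_id (I := 𝓘(ℝ, Covec d)) (M := Covec d) (n := ∞))
  rw [chartedSpaceSelf_prod] at h2
  exact h2

lemma contMDiff_baseTranslation_symm (c : Vec d) :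
    ContMDiff (cotangentModel d) (cotangentModel d) ∞ (baseTranslation c).symm := by
  have h1 : ContMDiff (𝓡 d) (𝓡 d) ∞ (fun z : Vec d => z + c) :=
    (contDiff_id.add contDiff_const).contMDiff
  have h2 := h1.prodMap (contMDiff_id (I := 𝓘(ℝ, Covec d)) (M := Covec d) (n := ∞))
  rw [chartedSpaceSelf_prod] at h2
  exact h2

/-- Canonical coordinates at `y`, transported by the cogeodesic flow. -/
def flowChart (g : RiemMetric d M) (y : M) (t : ℝ) :
    OpenPartialHomeomorph (CotangentBundle d M) (ModelProd (Vec d) (Covec d)) :=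
  flowHomeomorph g (-t) ≫ₕ chartAt (ModelProd (Vec d) (Covec d)) (covectorAt y (0 : Covec d)) ≫ₕ
    baseTranslation (extChartAt (𝓡 d) y y)

lemma flowChart_mem_maximalAtlas (g : RiemMetric d M) (y : M) (t : ℝ) :
    flowChart g y t ∈ IsManifold.maximalAtlas (cotangentModel d) ∞ (CotangentBundle d M) := by
  refine mem_maximalAtlas_of_contMDiffOn (fun p hp => ?_) (fun w hw => ?_)
  · have h1 : p.2 ≠ 0 := hp.1
    have h2 : flow g (-t) p ∈ (chartAt (ModelProd (Vec d) (Covec d))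
      (covectorAt y (0 : Covec d))).source := hp.2.1
    have h3 := (contMDiffOn_chart (I := cotangentModel d) (n := ∞)).contMDiffAt
      ((chartAt _ _).open_source.mem_nhds h2)
    exact ((contMDiff_baseTranslation _ _).comp p (h3.comp p
      (contMDiffAt_flow g h1 (-t)))).contMDiffWithinAt
  · set c := chartAt (ModelProd (Vec d) (Covec d)) (covectorAt y (0 : Covec d))
    have h1 : (baseTranslation (extChartAt (𝓡 d) y y)).symm w ∈ c.target := hw.1.2
    have h2 : (c.symm ((baseTranslation (extChartAt (𝓡 d) y y)).symm w)).2 ≠ 0 := hw.2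
    have h3 := (contMDiffOn_chart_symm (I := cotangentModel d) (n := ∞)).contMDiffAt
      (c.open_target.mem_nhds h1)
    have h4 := contMDiffAt_flow g h2 (- -t)
    exact (ContMDiffAt.comp w h4 (ContMDiffAt.comp w h3
      (contMDiff_baseTranslation_symm _ _))).contMDiffWithinAt

lemma mem_flowChart_source {η : Covec d} (hη : η ≠ 0) :
    flow g t (covectorAt y η) ∈ (flowChart g y t).source := by
  refine ⟨flow_snd_ne_zero (p := covectorAt y η) hη t, ?_, trivial⟩
  change flow g (-t) (flow g t (covectorAt y η)) ∈ (chartAt (ModelProd (Vec d) (Covec d))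
      (covectorAt y (0 : Covec d))).source
  rw [flow_neg_flow (p := covectorAt y η) hη, ← extChartAt_source (cotangentModel d)]
  exact mem_cochart_source.2 (mem_chart_source _ _)

/-- Flowing back straightens the leaf to the slice over the origin. The base translation matters
here: the normal form of an immersion is linear, so the slice must pass through `0`. -/
lemma flowChart_flow {η : Covec d} (hη : η ≠ 0) :
    flowChart g y t (flow g t (covectorAt y η)) = ((0, η) : Vec d × Covec d) := by
  change ((cochart d y (flow g (-t) (flow g t (covectorAt y η)))).1 - extChartAt (𝓡 d) y y,
    (cochart d y (flow g (-t) (flow g t (covectorAt y η)))).2) = _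
  rw [flow_neg_flow (p := covectorAt y η) hη, cochart_self, sub_self]

lemma initialMomentum_ne_zero (p : leaf g y t) : initialMomentum g y t p ≠ 0 := by
  obtain ⟨_, η, hη, rfl⟩ := p
  rwa [initialMomentum_flow hη]

/-- The leaf is homeomorphic to `T'_y M`. -/
def leafHomeomorph (g : RiemMetric d M) (y : M) (t : ℝ) : leaf g y t ≃ₜ PuncturedFibre d where
  toFun p := ⟨initialMomentum g y t p, initialMomentum_ne_zero p⟩
  invFun η := ⟨flow g t (covectorAt y η), η, η.2, rfl⟩
  left_inv := by
    rintro ⟨_, η, hη, rfl⟩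
    exact Subtype.ext (congrArg (fun η => flow g t (covectorAt y η)) (initialMomentum_flow hη))
  right_inv η := Subtype.ext (initialMomentum_flow η.2)
  continuous_toFun := by
    refine Continuous.subtype_mk (continuous_iff_continuousAt.2 ?_) _
    rintro ⟨_, η, hη, rfl⟩
    exact ContinuousAt.comp (g := initialMomentum g y t) (f := Subtype.val)
      (contMDiffAt_initialMomentum hη).continuousAt continuous_subtype_val.continuousAt
  continuous_invFun := by
    refine Continuous.subtype_mk (continuous_iff_continuousAt.2 fun η => ?_) _
    exact ContinuousAt.comp (g := fun η => flow g t (covectorAt y η)) (f := Subtype.val)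
      (contMDiffAt_flow_covectorAt g y t η.2).continuousAt continuous_subtype_val.continuousAt

lemma isOpenEmbedding_leaf (g : RiemMetric d M) (y : M) (t : ℝ) :
    Topology.IsOpenEmbedding (fun p : leaf g y t => initialMomentum g y t p) :=
  (PuncturedFibre d).isOpenEmbedding'.comp (leafHomeomorph g y t).isOpenEmbedding

section Structure
variable [Nonempty (leaf g y t)]

/-- The coordinates `η` on the leaf. -/
def leafCoord (g : RiemMetric d M) (y : M) (t : ℝ) [Nonempty (leaf g y t)] :
    OpenPartialHomeomorph (leaf g y t) (Covec d) :=
  (isOpenEmbedding_leaf g y t).toOpenPartialHomeomorph _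

lemma leafCoord_homeomorph_symm (η : PuncturedFibre d) :
    leafCoord g y t ((leafHomeomorph g y t).symm η) = η :=
  initialMomentum_flow η.2

lemma mem_leafCoord_target (η : PuncturedFibre d) : (η : Covec d) ∈ (leafCoord g y t).target :=
  ⟨(leafHomeomorph g y t).symm η, trivial, leafCoord_homeomorph_symm η⟩

lemma leafCoord_symm (η : PuncturedFibre d) :
    (leafCoord g y t).symm η = (leafHomeomorph g y t).symm η := by
  rw [← leafCoord_homeomorph_symm (g := g) (y := y) (t := t) η]
  exact (leafCoord g y t).left_inv trivial

lemma ne_zero_of_mem_leafCoord_target {η : Covec d} (h : η ∈ (leafCoord g y t).target) : η ≠ 0 := by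
  obtain ⟨p, -, rfl⟩ := h
  exact initialMomentum_ne_zero p

variable [ChartedSpace (Covec d) (leaf g y t)] [IsManifold 𝓘(ℝ, Covec d) ∞ (leaf g y t)]

/-- The leaf is diffeomorphic to `T'_y M`. -/
def leafDiffeomorph (he : ∀ p : leaf g y t, chartAt (Covec d) p = leafCoord g y t) :
    PuncturedFibre d ≃ₘ^∞⟮𝓘(ℝ, Covec d), 𝓘(ℝ, Covec d)⟯ leaf g y t where
  toEquiv := (leafHomeomorph g y t).symm.toEquiv
  contMDiff_toFun := by
    have h := (contMDiffOn_symm_of_chartAt_eq he).comp_contMDiff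
      (contMDiff_subtype_val (I := 𝓘(ℝ, Covec d)) (n := ∞) (U := PuncturedFibre d))
      mem_leafCoord_target
    refine h.congr fun η => ?_
    exact (leafCoord_symm η).symm
  contMDiff_invFun := by
    rw [← ContMDiff.subtypeVal_comp_iff]
    exact contMDiff_of_chartAt_eq he

lemma mfderiv_leafDiffeomorph (he : ∀ p : leaf g y t, chartAt (Covec d) p = leafCoord g y t)
    (η : PuncturedFibre d) (u : Covec d) :
    mfderiv 𝓘(ℝ, Covec d) 𝓘(ℝ, Covec d) (leafDiffeomorph he) η u = u := by
  have h : HasMFDerivAt 𝓘(ℝ, Covec d) 𝓘(ℝ, Covec d) (leafDiffeomorph he) η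
      (ContinuousLinearMap.id ℝ (Covec d)) := by
    refine ⟨(leafDiffeomorph he).continuous.continuousAt, ?_⟩
    refine HasFDerivAt.hasFDerivWithinAt ((hasFDerivAt_id _).congr_of_eventuallyEq ?_)
    filter_upwards [TopologicalSpace.Opens.chartAt_subtype_val_symm_eventuallyEq (H := Covec d)
      (PuncturedFibre d) (x := η)] with z hz
    change chartAt (Covec d) (leafDiffeomorph he η) ((leafHomeomorph g y t).symm
      ((chartAt (Covec d) η).symm z)) = z
    rw [he, leafCoord_homeomorph_symm]
    exact hz.symm
  rw [h.mfderiv]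
  rfl

/-- The leaf is a smooth embedded submanifold. -/
lemma isSmoothEmbedding_leaf (he : ∀ p : leaf g y t, chartAt (Covec d) p = leafCoord g y t) :
    Manifold.IsSmoothEmbedding 𝓘(ℝ, Covec d) (cotangentModel d) ∞
      (Subtype.val : leaf g y t → CotangentBundle d M) := by
  refine ⟨Manifold.IsImmersionOfComplement.isImmersion (F := Vec d) fun p => ?_,
    Topology.IsEmbedding.subtypeVal⟩
  -- The complement of the tangent directions is the position space. The swap of factors is needed
  -- because the normal form places the coordinates `η` first and the zero second.
  refine Manifold.IsImmersionAtOfComplement.mk_of_continuousAt continuous_subtype_val.continuousAt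
    (ContinuousLinearEquiv.prodComm ℝ (Covec d) (Vec d)) (leafCoord g y t) (flowChart g y t)
    trivial ?_ ?_ (flowChart_mem_maximalAtlas g y t) ?_
  · obtain ⟨_, η, hη, rfl⟩ := p
    exact mem_flowChart_source hη
  · rw [← he p]
    exact IsManifold.chart_mem_maximalAtlas p
  · intro η hη
    have hη' : η ∈ (leafCoord g y t).target := by simpa using hη
    have h0 := ne_zero_of_mem_leafCoord_target hη'
    have h1 := leafCoord_symm (g := g) (y := y) (t := t) ⟨η, h0⟩
    change flowChart g y t ((leafCoord g y t).symm η) = ((0, η) : Vec d × Covec d)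
    rw [h1]
    exact flowChart_flow h0

end Structure

/-- A smooth field of inner products of the momentum increments is a Riemannian metric on the
leaf. -/
lemma isRiemannianMetricOnLeaf [Nonempty (leaf g y t)] {B : Covec d → Covec d →L[ℝ] Covec d →L[ℝ] ℝ}
    (hB : ∀ η, η ≠ 0 → ContDiffAt ℝ ∞ B η) (hsymm : ∀ η, η ≠ 0 → ∀ u v, B η u v = B η v u)
    (hpos : ∀ η, η ≠ 0 → ∀ u, u ≠ 0 → 0 < B η u u) {b : Covec d → Covec d → Covec d → ℝ}
    (hb : ∀ η, η ≠ 0 → ∀ u v, B η u v = b η u v) :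
    IsRiemannianMetricOnLeaf g y t b := by
  let _ := (leafCoord g y t).singletonChartedSpace rfl
  have he : ∀ p : leaf g y t, chartAt (Covec d) p = leafCoord g y t := fun _ => rfl
  have hM : IsManifold 𝓘(ℝ, Covec d) ∞ (leaf g y t) :=
    (leafCoord g y t).isManifold_singleton rfl
  refine ⟨inferInstance, hM, isSmoothEmbedding_leaf he, leafDiffeomorph he, fun η => rfl,
    metricOfChart he B (fun p => hB _ (initialMomentum_ne_zero p))
      (fun p => hsymm _ (initialMomentum_ne_zero p)) (fun p => hpos _ (initialMomentum_ne_zero p)),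
    fun η u v => ?_⟩
  rw [mfderiv_leafDiffeomorph he η u, mfderiv_leafDiffeomorph he η v]
  refine Eq.trans ?_ (hb _ η.2 u v)
  change B (leafCoord g y t ((leafHomeomorph g y t).symm η)) u v = _
  rw [leafCoord_homeomorph_symm]

lemma isRiemannianMetricOnLeaf_combined [Nonempty (leaf g y t)] {a b : ℝ} (ha : 0 < a) (hb : 0 < b) :
    IsRiemannianMetricOnLeaf g y t (fun η u v =>
      a * hamiltonian g (covectorAt y η) ^ 2 * positionForm g y t η u v +
        b * momentumForm g y t η u v) := by
  refine isRiemannianMetricOnLeaf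
    (B := fun η => combinedForm g y t (a * hamiltonian g (covectorAt y η) ^ 2) b η)
    (fun η hη => contDiffAt_combinedForm hη (contDiffAt_const.mul
      ((contDiffAt_hamiltonian_covectorAt g y hη).pow 2)) contDiffAt_const)
    (fun η hη u v => ?_) (fun η hη u hu => ?_) (fun η hη u v => combinedForm_apply hη _ _ u v)
  · rw [combinedForm_apply hη, combinedForm_apply hη, positionForm_symm u v, momentumForm_symm u v]
  · exact combinedForm_pos hη
      (mul_pos ha (pow_pos (hamiltonian_pos g (p := covectorAt y η) hη) 2)) hb hu

/-- Turning an open embedding into a chart requires a point of its domain; a nonzero covector exists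
in positive dimension. -/
lemma nonempty_leaf (hd : 1 ≤ d) (g : RiemMetric d M) (y : M) (t : ℝ) : Nonempty (leaf g y t) := by
  obtain ⟨η, hη⟩ := exists_covec_ne_zero (u := EuclideanSpace.single (⟨0, hd⟩ : Fin d) (1 : ℝ))
    (by simp)
  exact ⟨⟨_, η, by rintro rfl; exact hη rfl, rfl⟩⟩

/-- A field of bilinear forms that is a Riemannian metric on a leaf is positive definite. -/
lemma IsRiemannianMetricOnLeaf.pos {b : Covec d → Covec d → Covec d → ℝ}
    (h : IsRiemannianMetricOnLeaf g y t b) {η : Covec d} (hη : η ≠ 0) {u : Covec d} (hu : u ≠ 0) :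
    0 < b η u u := by
  obtain ⟨_, _, -, Ψ, -, G, hG⟩ := h
  set η' : PuncturedFibre d := ⟨η, hη⟩
  have h1 := hG η' u u
  rw [← show b (η' : Covec d) u u = b η u u from rfl, ← h1]
  refine G.pos _ _ fun h0 => hu ?_
  exact (Ψ.mfderivToContinuousLinearEquiv (by simp) η').injective
    ((show Ψ.mfderivToContinuousLinearEquiv (by simp) η' u = 0 from h0).trans (map_zero _).symm)

end Cogeodesic

end

/-! ### Cogeodesics of metrics induced from a Euclidean space -/

section
set_option maxSynthPendingDepth 3
namespace Cogeodesic
open Set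
open scoped RealInnerProductSpace
variable {d : ℕ} {M : Type*} [TopologicalSpace M] [ChartedSpace (Vec d) M] [IsManifold (𝓡 d) ∞ M]

section HamiltonCovariant
variable {G : Vec d → Vec d →L[ℝ] Vec d →L[ℝ] ℝ} {w : Vec d × Covec d}

/-- The differential of the Hamiltonian in canonical coordinates. -/
lemma fderiv_chartHam (hG : IsMetric (G w.1)) (hd : ContDiffAt ℝ ∞ G w.1) (hw : w.2 ≠ 0)
    (hmet : ∀ᶠ z in 𝓝 w.1, IsMetric (G z)) (v : Vec d × Covec d) :
    fderiv ℝ (chartHam G) w v = (chartHam G w)⁻¹ * (v.2 ((G w.1).inverse w.2) -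
      1 / 2 * fderiv ℝ G w.1 v.1 ((G w.1).inverse w.2) ((G w.1).inverse w.2)) := by
  have hS : ContDiffAt ℝ ∞ (fun w : Vec d × Covec d => (G w.1).inverse w.2) w :=
    (ContDiffAt.comp (g := fun z => (G z).inverse) w (contDiffAt_inverse (w := w) hG hd)
      contDiffAt_fst).clm_apply contDiffAt_snd
  have hS' := (hS.differentiableAt (by simp)).hasFDerivAt
  set S := fun w : Vec d × Covec d => (G w.1).inverse w.2
  have hG' : HasFDerivAt (fun w : Vec d × Covec d => G w.1) _ w :=
    HasFDerivAt.comp (g := G) w (hd.differentiableAt (by simp)).hasFDerivAt hasFDerivAt_fst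
  -- With `S` the raised momentum, `H² = 2 ξ(S) - G(S, S)`. This expression is stationary in `S`, so
  -- the derivative of the inverse metric never has to be computed.
  have h1 : HasFDerivAt (fun w : Vec d × Covec d => 2 * w.2 (S w) - G w.1 (S w) (S w)) _ w :=
    ((hasFDerivAt_snd.clm_apply hS').const_mul 2).sub ((hG'.clm_apply hS').clm_apply hS')
  have hH := ((contDiffAt_chartHam hG hd hw).differentiableAt (by simp)).hasFDerivAt
  have h2 : HasFDerivAt (fun w => chartHam G w * chartHam G w) _ w := hH.mul hH
  have hfst : ContinuousAt (fun w : Vec d × Covec d => w.1) w := continuousAt_fst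
  have h3 := h2.unique (h1.congr_of_eventuallyEq (by
    filter_upwards [hfst.eventually hmet] with w' hw'
    have h4 : G w'.1 (S w') = w'.2 := hw'.apply_inverse w'.2
    have h5 : 0 ≤ w'.2 (S w') := by
      by_cases h0 : w'.2 = 0
      · rw [h0]; simp
      · exact (hw'.dual_pos h0).le
    rw [h4, chartHam, Real.mul_self_sqrt h5]
    ring))
  have h6 := DFunLike.congr_fun h3 v
  have h7 : ∀ x, G w.1 x (S w) = w.2 x := fun x => by rw [hG.symm, hG.apply_inverse]
  have h8 : G w.1 (S w) = w.2 := hG.apply_inverse w.2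
  have h9 := (chartHam_pos hG hw).ne'
  simp [h7, h8] at h6
  change _ = (chartHam G w)⁻¹ * (v.2 (S w) - 1 / 2 * fderiv ℝ G w.1 v.1 (S w) (S w))
  field_simp
  linarith

/-- Hamilton's equations in covariant form. -/
lemma hamField_chartHam_eq (hG : IsMetric (G w.1)) (hd : ContDiffAt ℝ ∞ G w.1) (hw : w.2 ≠ 0)
    (hmet : ∀ᶠ z in 𝓝 w.1, IsMetric (G z)) {v : Vec d × Covec d}
    (h₁ : v.1 = (chartHam G w)⁻¹ • (G w.1).inverse w.2) (h₂ : covDer G w v = 0) :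
    hamField (chartHam G) w = v := by
  have hsymm : ∀ a b c, fderiv ℝ G w.1 a b c = fderiv ℝ G w.1 a c b := by
    intro a b c
    have hG' := (hd.differentiableAt (by simp)).hasFDerivAt
    have e : ∀ b c : Vec d, HasFDerivAt (fun z => G z b c) _ w.1 := fun b c =>
      (hG'.clm_apply (hasFDerivAt_const b _)).clm_apply (hasFDerivAt_const c _)
    have h3 := (e b c).unique ((e c b).congr_of_eventuallyEq (by
      filter_upwards [hmet] with z hz using hz.symm b c))
    simpa using DFunLike.congr_fun h3 a
  refine eq_of_symplecticForm fun x => ?_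
  rw [hamField, symplecticForm_symplGrad, fderiv_chartHam hG hd hw hmet]
  have h3 := DFunLike.congr_fun h₂ x.1
  rw [covDer_apply, h₁] at h3
  simp only [map_smul, _root_.smul_apply, smul_eq_mul, _root_.zero_apply] at h3
  rw [hsymm ((G w.1).inverse w.2) _ x.1] at h3
  rw [symplecticForm, h₁, map_smul, smul_eq_mul]
  linarith

end HamiltonCovariant

section Immersion
variable {E : Type*} [NormedAddCommGroup E] [InnerProductSpace ℝ E] {ι : M → E}

/-- The differential of a map from `M` to a Euclidean space. -/
def spaceDeriv (ι : M → E) (x : M) : Vec d →L[ℝ] E :=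
  mfderiv (𝓡 d) 𝓘(ℝ, E) ι x

/-- A map from `M` to a Euclidean space, in the preferred chart at `x₀`. -/
def param (d : ℕ) [ChartedSpace (Vec d) M] (ι : M → E) (x₀ : M) : Vec d → E :=
  ι ∘ (extChartAt (𝓡 d) x₀).symm

variable {x₀ x : M}

lemma contDiffOn_param (hι : ContMDiff (𝓡 d) 𝓘(ℝ, E) ∞ ι) (x₀ : M) :
    ContDiffOn ℝ ∞ (param d ι x₀) (extChartAt (𝓡 d) x₀).target :=
  (hι.comp_contMDiffOn (contMDiffOn_extChartAt_symm x₀)).contDiffOn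

lemma contDiffAt_param (hι : ContMDiff (𝓡 d) 𝓘(ℝ, E) ∞ ι) {z : Vec d}
    (hz : z ∈ (extChartAt (𝓡 d) x₀).target) : ContDiffAt ℝ ∞ (param d ι x₀) z :=
  (contDiffOn_param hι x₀).contDiffAt ((isOpen_extChartAt_target x₀).mem_nhds hz)

lemma param_extChartAt (hx : x ∈ (chartAt (Vec d) x₀).source) :
    param d ι x₀ (extChartAt (𝓡 d) x₀ x) = ι x :=
  congrArg ι ((extChartAt (𝓡 d) x₀).left_inv (by simpa using hx))

lemma spaceDeriv_frame (hι : ContMDiff (𝓡 d) 𝓘(ℝ, E) ∞ ι)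
    (hx : x ∈ (chartAt (Vec d) x₀).source) :
    (spaceDeriv ι x).comp (frame x₀ x) = fderiv ℝ (param d ι x₀) (extChartAt (𝓡 d) x₀ x) := by
  have hx' : x ∈ (extChartAt (𝓡 d) x₀).source := by simpa using hx
  have hleft := (extChartAt (𝓡 d) x₀).left_inv hx'
  have h1 : frame x₀ x = mfderiv 𝓘(ℝ, Vec d) (𝓡 d) (extChartAt (𝓡 d) x₀).symm
      (extChartAt (𝓡 d) x₀ x) := by
    rw [frame, TangentBundle.symmL_trivializationAt hx, ModelWithCorners.range_eq_univ,
      mfderivWithin_univ]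
  have h2 : MDifferentiableAt 𝓘(ℝ, Vec d) (𝓡 d) (extChartAt (𝓡 d) x₀).symm
      (extChartAt (𝓡 d) x₀ x) :=
    ((contMDiffOn_extChartAt_symm (n := ∞) x₀).contMDiffAt
      ((isOpen_extChartAt_target x₀).mem_nhds ((extChartAt (𝓡 d) x₀).map_source hx'))
      ).mdifferentiableAt (by simp)
  have h3 : MDifferentiableAt (𝓡 d) 𝓘(ℝ, E) ι
      ((extChartAt (𝓡 d) x₀).symm (extChartAt (𝓡 d) x₀ x)) := (hι _).mdifferentiableAt (by simp)
  have h4 := mfderiv_comp (extChartAt (𝓡 d) x₀ x) h3 h2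
  rw [mfderiv_eq_fderiv, hleft] at h4
  rw [h1]
  exact h4.symm

/-- The bilinear form induced by an immersion. -/
def inducedInner (ι : M → E) (x : M) : TangentSpace (𝓡 d) x →L[ℝ] TangentSpace (𝓡 d) x →L[ℝ] ℝ :=
  (innerSL ℝ).bilinearComp (spaceDeriv ι x) (spaceDeriv ι x)

/-- The Riemannian metric induced by an immersion. -/
def inducedMetric (hι : ContMDiff (𝓡 d) 𝓘(ℝ, E) ∞ ι)
    (hinj : ∀ x, Function.Injective (spaceDeriv (d := d) ι x)) : RiemMetric d M where
  inner := inducedInner ι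
  symm x u v := real_inner_comm (spaceDeriv ι x v) (spaceDeriv ι x u)
  pos x u hu := real_inner_self_pos.2 fun h => hu (hinj x (h.trans (map_zero _).symm))
  isVonNBounded x := show Bornology.IsVonNBounded ℝ
      {v : Vec d | (innerSL ℝ).bilinearComp (spaceDeriv ι x) (spaceDeriv ι x) v v < 1} from
    isVonNBounded_of_pos fun u hu =>
      real_inner_self_pos.2 fun h => hu (hinj x (h.trans (map_zero _).symm))
  contMDiff := by
    intro x₀
    have : ∀ x : M, ContinuousAdd (TangentSpace (𝓡 d) x →L[ℝ] ℝ) := fun x =>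
      inferInstanceAs (ContinuousAdd (Vec d →L[ℝ] ℝ))
    set e := trivializationAt (Vec d →L[ℝ] Vec d →L[ℝ] ℝ)
      (fun x : M => TangentSpace (𝓡 d) x →L[ℝ] TangentSpace (𝓡 d) x →L[ℝ] ℝ) x₀ with he
    have hp : x₀ ∈ e.baseSet := by simp [he]
    rw [Bundle.Trivialization.contMDiffAt_section_iff e hp]
    have hz : extChartAt (𝓡 d) x₀ x₀ ∈ (extChartAt (𝓡 d) x₀).target := mem_extChartAt_target x₀
    have h1 : ContDiffAt ℝ ∞ (fderiv ℝ (param d ι x₀)) (extChartAt (𝓡 d) x₀ x₀) :=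
      (contDiffAt_param hι hz).fderiv_right (m := ∞) (by simp)
    have h2 : ContDiffAt ℝ ∞ (fun z => (innerSL ℝ).bilinearComp (fderiv ℝ (param d ι x₀) z)
        (fderiv ℝ (param d ι x₀) z)) (extChartAt (𝓡 d) x₀ x₀) := by
      refine contDiffAt_clm_apply.2 fun u => contDiffAt_clm_apply.2 fun v => ?_
      exact (h1.clm_apply contDiffAt_const).inner ℝ (h1.clm_apply contDiffAt_const)
    refine (h2.contMDiffAt.comp x₀ contMDiffAt_extChartAt).congr_of_eventuallyEq ?_
    filter_upwards [(chartAt (Vec d) x₀).open_source.mem_nhds (mem_chart_source _ x₀)] with x hx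
    ext u v
    simp only [Function.comp_apply, he]
    rw [hom_trivializationAt_apply]
    simp only
    rw [inCoordinates_apply_eq₂ (by simpa using hx) (by simpa using hx) (by simp)]
    have hs : ∀ w, (trivializationAt (Vec d) (TangentSpace (𝓡 d)) x₀).symm x w = frame x₀ x w :=
      fun w => (Bundle.Trivialization.symmL_apply _ (by simpa using hx) w).symm
    rw [hs, hs]
    simp only [Bundle.Trivial.fiberBundle_trivializationAt',
      Bundle.Trivial.linearMapAt_trivialization, ← spaceDeriv_frame hι hx]
    rfl

variable (hι : ContMDiff (𝓡 d) 𝓘(ℝ, E) ∞ ι)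
  (hinj : ∀ x, Function.Injective (spaceDeriv (d := d) ι x))

lemma metricCoeff_inducedMetric {z : Vec d} (hz : z ∈ (extChartAt (𝓡 d) x₀).target) (u v : Vec d) :
    metricCoeff (inducedMetric hι hinj) x₀ z u v =
      ⟪fderiv ℝ (param d ι x₀) z u, fderiv ℝ (param d ι x₀) z v⟫ := by
  have hx : (extChartAt (𝓡 d) x₀).symm z ∈ (chartAt (Vec d) x₀).source := by
    simpa using (extChartAt (𝓡 d) x₀).map_target hz
  have h := spaceDeriv_frame hι hx
  rw [(extChartAt (𝓡 d) x₀).right_inv hz] at h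
  rw [metricCoeff_apply, ← h]
  rfl

lemma fderiv_metricCoeff_inducedMetric {z : Vec d} (hz : z ∈ (extChartAt (𝓡 d) x₀).target)
    (a u v : Vec d) : fderiv ℝ (metricCoeff (inducedMetric hι hinj) x₀) z a u v =
      ⟪fderiv ℝ (param d ι x₀) z u, fderiv ℝ (fderiv ℝ (param d ι x₀)) z a v⟫ +
      ⟪fderiv ℝ (fderiv ℝ (param d ι x₀)) z a u, fderiv ℝ (param d ι x₀) z v⟫ := by
  have h1 : HasFDerivAt (fderiv ℝ (param d ι x₀)) _ z :=
    (((contDiffAt_param hι hz).fderiv_right (m := ∞) (by simp)).differentiableAt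
      (by simp)).hasFDerivAt
  have h2 : ∀ u : Vec d, HasFDerivAt (fun z => fderiv ℝ (param d ι x₀) z u) _ z := fun u =>
    h1.clm_apply (hasFDerivAt_const u z)
  have h3 : HasFDerivAt (metricCoeff (inducedMetric hι hinj) x₀) _ z :=
    ((contDiffAt_metricCoeff _ hz).differentiableAt (by simp)).hasFDerivAt
  have h4 : HasFDerivAt (fun z => metricCoeff (inducedMetric hι hinj) x₀ z u v) _ z :=
    (h3.clm_apply (hasFDerivAt_const u z)).clm_apply (hasFDerivAt_const v z)
  have h5 := h4.unique (((h2 u).inner ℝ (h2 v)).congr_of_eventuallyEq (by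
    filter_upwards [(isOpen_extChartAt_target x₀).mem_nhds hz] with z' hz'
    exact metricCoeff_inducedMetric hι hinj hz' u v))
  simpa using DFunLike.congr_fun h5 a

/-- The covector at `x` that corresponds to the vector `V` of the ambient space. -/
def spaceCovector (ι : M → E) (x : M) (V : E) : CotangentBundle d M :=
  covectorAt x ((innerSL ℝ V).comp (spaceDeriv ι x))

/-- The covector of the coordinate space that corresponds to the vector `V` of the ambient
space. -/
def paramCovector (d : ℕ) [ChartedSpace (Vec d) M] (ι : M → E) (x₀ : M) (z : Vec d) (V : E) :
    Covec d :=
  (innerSL ℝ V).comp (fderiv ℝ (param d ι x₀) z)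

lemma cochart_spaceCovector (hι : ContMDiff (𝓡 d) 𝓘(ℝ, E) ∞ ι)
    (hx : x ∈ (chartAt (Vec d) x₀).source) (V : E) :
    cochart d x₀ (spaceCovector ι x V) =
      (extChartAt (𝓡 d) x₀ x, paramCovector d ι x₀ (extChartAt (𝓡 d) x₀ x) V) := by
  rw [spaceCovector, cochart_covectorAt, paramCovector, ← spaceDeriv_frame hι hx]
  rfl

/-- Pairing with an ambient tangent vector is lowering the index for the induced metric. -/
lemma inverse_paramCovector {z : Vec d} (hz : z ∈ (extChartAt (𝓡 d) x₀).target) (v : Vec d) :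
    (metricCoeff (inducedMetric hι hinj) x₀ z).inverse
      (paramCovector d ι x₀ z (fderiv ℝ (param d ι x₀) z v)) = v := by
  have h : paramCovector d ι x₀ z (fderiv ℝ (param d ι x₀) z v) =
      metricCoeff (inducedMetric hι hinj) x₀ z v := by
    ext u
    rw [metricCoeff_inducedMetric hι hinj hz]
    rfl
  rw [h, (isMetric_metricCoeff (inducedMetric hι hinj) hz).inverse_apply]

/-- The covariant derivative for the induced metric is the tangential part of the derivative in
the ambient space. -/
lemma covDer_inducedMetric {c : ℝ → Vec d × Covec d} {c' : Vec d × Covec d} {V : ℝ → E} {V' : E}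
    {s : ℝ} (hc : HasDerivAt c c' s) (hV : HasDerivAt V V' s)
    (hz : (c s).1 ∈ (extChartAt (𝓡 d) x₀).target)
    (hcV : ∀ᶠ τ in 𝓝 s, (c τ).2 = paramCovector d ι x₀ (c τ).1 (V τ))
    (htan : V s ∈ range (fderiv ℝ (param d ι x₀) (c s).1)) :
    covDer (metricCoeff (inducedMetric hι hinj) x₀) (c s) c' =
      paramCovector d ι x₀ (c s).1 V' := by
  obtain ⟨v, hv⟩ := htan
  have hsharp : (metricCoeff (inducedMetric hι hinj) x₀ (c s).1).inverse (c s).2 = v := by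
    rw [hcV.self_of_nhds, ← hv, inverse_paramCovector hι hinj hz]
  have hsymm : IsSymmSndFDerivAt ℝ (param d ι x₀) (c s).1 :=
    (contDiffAt_param hι hz).isSymmSndFDerivAt (by
      rw [minSmoothness_of_isRCLikeNormedField]
      exact WithTop.coe_le_coe.2 le_top)
  ext u
  have h1 : HasFDerivAt (fderiv ℝ (param d ι x₀)) (fderiv ℝ (fderiv ℝ (param d ι x₀)) (c s).1)
      (c s).1 := (((contDiffAt_param hι hz).fderiv_right (m := ∞) (by simp)).differentiableAt
      (by simp)).hasFDerivAt
  have hc1 : HasDerivAt (fun τ => (c τ).1) c'.1 s :=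
    HasFDerivAt.comp_hasDerivAt (l := fun w : Vec d × Covec d => w.1) s hasFDerivAt_fst hc
  have hc2 : HasDerivAt (fun τ => (c τ).2) c'.2 s :=
    HasFDerivAt.comp_hasDerivAt (l := fun w : Vec d × Covec d => w.2) s hasFDerivAt_snd hc
  have h2 : HasDerivAt (fun τ => fderiv ℝ (param d ι x₀) (c τ).1 u)
      (fderiv ℝ (fderiv ℝ (param d ι x₀)) (c s).1 c'.1 u) s :=
    ((HasFDerivAt.comp_hasDerivAt (l := fderiv ℝ (param d ι x₀)) s h1 hc1).clm_apply
      (hasDerivAt_const s u)).congr_deriv (by simp)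
  have h3 : HasDerivAt (fun τ => (c τ).2 u) (c'.2 u) s :=
    (hc2.clm_apply (hasDerivAt_const s u)).congr_deriv (by simp)
  have h4 := h3.unique ((hV.inner ℝ h2).congr_of_eventuallyEq (by
    filter_upwards [hcV] with τ hτ
    rw [hτ]
    rfl))
  -- The derivative of the pairing of `V` with the immersion splits into the pairing of `V'` and a
  -- second-derivative term. For an induced metric the Christoffel term is exactly this
  -- second-derivative term, so the two cancel.
  rw [covDer_apply, hsharp, h4]
  simp only [fderiv_metricCoeff_inducedMetric hι hinj hz, hv, hsymm.eq u c'.1, hsymm.eq v c'.1,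
    hsymm.eq v u]
  change _ = ⟪V', fderiv ℝ (param d ι x₀) (c s).1 u⟫
  simp only [real_inner_comm]
  ring_nf

lemma range_fderiv_param (hι : ContMDiff (𝓡 d) 𝓘(ℝ, E) ∞ ι) (hx : x ∈ (chartAt (Vec d) x₀).source) :
    range (fderiv ℝ (param d ι x₀) (extChartAt (𝓡 d) x₀ x)) = range (spaceDeriv (d := d) ι x) := by
  rw [← spaceDeriv_frame hι hx, ContinuousLinearMap.coe_comp, range_comp,
    (frame_bijective hx).2.range_eq, image_univ]

/-- A unit speed curve of the ambient space with normal acceleration is a cogeodesic. -/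
lemma solvesAt_spaceCovector {c : ℝ → M} {V : ℝ → E} {V' : E} {t : ℝ}
    (hc : MDifferentiableAt 𝓘(ℝ, ℝ) (𝓡 d) c t)
    (hcV : HasDerivAt (fun s => ι (c s)) (‖V t‖⁻¹ • V t) t) (hV : HasDerivAt V V' t)
    (h0 : V t ≠ 0) (htan : V t ∈ range (spaceDeriv (d := d) ι (c t)))
    (hnor : ∀ u : Vec d, ⟪V', spaceDeriv ι (c t) u⟫ = 0) :
    SolvesAt (inducedMetric hι hinj) (fun s => spaceCovector ι (c s) (V s)) t := by
  set x₀ := c t with hx₀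
  have hx : c t ∈ (chartAt (Vec d) x₀).source := mem_chart_source _ _
  set z : ℝ → Vec d := fun s => extChartAt (𝓡 d) x₀ (c s) with hz
  have hzt : z t ∈ (extChartAt (𝓡 d) x₀).target := mem_extChartAt_target x₀
  set D := fderiv ℝ (param d ι x₀) (z t) with hD
  have hrange : range D = range (spaceDeriv (d := d) ι x₀) := range_fderiv_param hι hx
  have hev : ∀ᶠ s in 𝓝 t, c s ∈ (chartAt (Vec d) x₀).source :=
    hc.continuousAt.eventually_mem ((chartAt (Vec d) x₀).open_source.mem_nhds hx)
  have hz' : HasDerivAt z (deriv z t) t := by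
    have h1 : MDifferentiableAt (𝓡 d) 𝓘(ℝ, Vec d) (extChartAt (𝓡 d) x₀) (c t) :=
      mdifferentiableAt_extChartAt hx
    exact (h1.comp t hc).differentiableAt.hasDerivAt
  obtain ⟨v, hv⟩ : V t ∈ range D := by rw [hrange]; exact htan
  have hw : cochart d x₀ (spaceCovector ι (c t) (V t)) = (z t, paramCovector d ι x₀ (z t) (V t)) :=
    cochart_spaceCovector hι hx _
  have hcoch : ∀ᶠ s in 𝓝 t, cochart d x₀ (spaceCovector ι (c s) (V s)) =
      (z s, paramCovector d ι x₀ (z s) (V s)) := by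
    filter_upwards [hev] with s hs using cochart_spaceCovector hι hs _
  have hDinj : Function.Injective D := by
    rw [hD, hz, ← spaceDeriv_frame hι hx]
    exact (hinj _).comp (frame_bijective hx).1
  have hzv : deriv z t = ‖V t‖⁻¹ • v := by
    refine hDinj ?_
    have h1 : HasDerivAt (fun s => param d ι x₀ (z s)) (D (deriv z t)) t :=
      HasFDerivAt.comp_hasDerivAt (l := param d ι x₀) t
        ((contDiffAt_param hι hzt).differentiableAt (by simp)).hasFDerivAt hz'
    have h2 := h1.unique (hcV.congr_of_eventuallyEq (by
      filter_upwards [hev] with s hs using param_extChartAt hs))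
    rw [h2, map_smul, hv]
  have hparam : HasDerivAt (fun s => paramCovector d ι x₀ (z s) (V s))
      (deriv (fun s => paramCovector d ι x₀ (z s) (V s)) t) t := by
    have h1 : HasFDerivAt (fderiv ℝ (param d ι x₀)) _ (z t) :=
      (((contDiffAt_param hι hzt).fderiv_right (m := ∞) (by simp)).differentiableAt
        (by simp)).hasFDerivAt
    have h2 : HasDerivAt (fun s => fderiv ℝ (param d ι x₀) (z s)) _ t :=
      HasFDerivAt.comp_hasDerivAt (l := fderiv ℝ (param d ι x₀)) t h1 hz'
    have h3 : HasDerivAt (fun s => innerSL ℝ (V s)) _ t :=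
      HasFDerivAt.comp_hasDerivAt (l := fun v => innerSL ℝ v) t (innerSL ℝ).hasFDerivAt hV
    exact (h3.clm_comp h2).differentiableAt.hasDerivAt
  have hcd := hz'.prodMk hparam
  have hsharp : (metricCoeff (inducedMetric hι hinj) x₀ (z t)).inverse
      (paramCovector d ι x₀ (z t) (V t)) = v := by
    rw [← hv, inverse_paramCovector hι hinj hzt]
  have hVV : paramCovector d ι x₀ (z t) (V t) v = ‖V t‖ ^ 2 := by
    rw [← real_inner_self_eq_norm_sq, paramCovector, ← hD]
    change ⟪V t, D v⟫ = _
    rw [hv]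
  have hne : paramCovector d ι x₀ (z t) (V t) ≠ 0 := by
    intro h
    rw [h] at hVV
    exact (pow_pos (norm_pos_iff.2 h0) 2).ne hVV
  have hH : chartHam (metricCoeff (inducedMetric hι hinj) x₀)
      (z t, paramCovector d ι x₀ (z t) (V t)) = ‖V t‖ := by
    rw [chartHam, hsharp, hVV, Real.sqrt_sq (norm_nonneg _)]
  have hcov := covDer_inducedMetric (x₀ := x₀) hι hinj hcd hV hzt
    (Filter.Eventually.of_forall fun _ => rfl) ⟨v, hv⟩
  have hcov0 : paramCovector d ι x₀ (z t) V' = 0 := by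
    ext u
    obtain ⟨u', hu'⟩ : D u ∈ range (spaceDeriv (d := d) ι x₀) := hrange ▸ mem_range_self u
    change ⟪V', D u⟫ = 0
    rw [← hu']
    exact hnor u'
  -- The covariant form of Hamilton's equations: the velocity is the raised momentum divided by its
  -- length, and the covariant derivative vanishes because `V'` is normal.
  have hfield : chartField (inducedMetric hι hinj) x₀ (z t, paramCovector d ι x₀ (z t) (V t)) =
      (deriv z t, deriv (fun s => paramCovector d ι x₀ (z s) (V s)) t) := by
    refine hamField_chartHam_eq (isMetric_metricCoeff _ hzt) (contDiffAt_metricCoeff _ hzt) hne ?_ ?_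
      (hcov.trans hcov0)
    · filter_upwards [(isOpen_extChartAt_target x₀).mem_nhds hzt] with z' hz'
      exact isMetric_metricCoeff _ hz'
    · rw [hH, hsharp, hzv]
  have hcd' : HasDerivAt (fun s => cochart d x₀ (spaceCovector ι (c s) (V s)))
      (chartField (inducedMetric hι hinj) x₀ (cochart d x₀ (spaceCovector ι (c t) (V t)))) t := by
    rw [hw, hfield]
    exact hcd.congr_of_eventuallyEq hcoch
  refine (solvesAt_iff (x₀ := x₀) hx).2 ⟨?_, ?_, hcd'⟩
  · refine (cochart_snd_ne_zero (x₀ := x₀) (p := spaceCovector ι (c t) (V t)) hx).1 ?_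
    rw [hw]
    exact hne
  · have hmem : spaceCovector ι (c t) (V t) ∈ (cochart d x₀).source := mem_cochart_source.2 hx
    have h1 : ContinuousAt (cochart d x₀).symm (cochart d x₀ (spaceCovector ι (c t) (V t))) :=
      ((contMDiffOn_cochart_symm x₀).contMDiffAt ((isOpen_cochart_target x₀).mem_nhds
        ((cochart d x₀).map_source hmem))).continuousAt
    refine (ContinuousAt.comp (f := fun s => cochart d x₀ (spaceCovector ι (c s) (V s))) h1
      hcd'.continuousAt).congr ?_
    filter_upwards [hev] with s hs
    exact (cochart d x₀).left_inv (mem_cochart_source.2 hs)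

end Immersion
end Cogeodesic

end

/-! ### The round sphere: great circles as cogeodesics -/

section
set_option maxSynthPendingDepth 3
namespace Cogeodesic
open Set
open scoped RealInnerProductSpace

section Sphere
variable {n : ℕ} {E : Type*} [NormedAddCommGroup E] [InnerProductSpace ℝ E]
  [Fact (Module.finrank ℝ E = n + 1)]

lemma injective_spaceDeriv_sphere (x : Metric.sphere (0 : E) 1) :
    Function.Injective (spaceDeriv (d := n) (Subtype.val : Metric.sphere (0 : E) 1 → E) x) :=
  injective_mvfderiv_subtypeVal_sphere x

lemma mem_range_spaceDeriv_sphere {x : Metric.sphere (0 : E) 1} {v : E} :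
    v ∈ range (spaceDeriv (d := n) (Subtype.val : Metric.sphere (0 : E) 1 → E) x) ↔
      ⟪(x : E), v⟫ = 0 := by
  rw [← Submodule.mem_orthogonal_singleton_iff_inner_right, ← range_mvfderiv_subtypeVal (n := n) x]
  rfl

lemma inner_spaceDeriv_sphere (x : Metric.sphere (0 : E) 1) (u : Vec n) :
    ⟪(x : E), spaceDeriv (d := n) (Subtype.val : Metric.sphere (0 : E) 1 → E) x u⟫ = 0 :=
  mem_range_spaceDeriv_sphere.1 (mem_range_self u)

variable (n E) in
/-- The round metric of the unit sphere. -/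
def roundMetric : RiemMetric n (Metric.sphere (0 : E) 1) :=
  inducedMetric (ι := Subtype.val) contMDiff_coe_sphere injective_spaceDeriv_sphere

/-- The tangent vector of the sphere that corresponds to a covector, as a vector of the ambient
space. -/
def sphereVec (y : Metric.sphere (0 : E) 1) : Covec n →L[ℝ] E :=
  (spaceDeriv (d := n) (Subtype.val : Metric.sphere (0 : E) 1 → E) y).comp
    (raise (roundMetric n E) y)

variable {y : Metric.sphere (0 : E) 1} {η : Covec n}

lemma inner_sphereVec_spaceDeriv (u : Vec n) :
    ⟪sphereVec y η, spaceDeriv (d := n) (Subtype.val : Metric.sphere (0 : E) 1 → E) y u⟫ = η u :=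
  DFunLike.congr_fun ((isMetric_lower (roundMetric n E) y).apply_inverse η) u

lemma spaceCovector_sphereVec :
    spaceCovector (d := n) (Subtype.val : Metric.sphere (0 : E) 1 → E) y (sphereVec y η) =
      covectorAt y η :=
  congrArg (covectorAt y) (ContinuousLinearMap.ext inner_sphereVec_spaceDeriv)

lemma inner_sphereVec : ⟪(y : E), sphereVec y η⟫ = 0 :=
  inner_spaceDeriv_sphere y _

lemma sphereVec_ne_zero (hη : η ≠ 0) : sphereVec y η ≠ 0 := by
  intro h
  refine hη (ContinuousLinearMap.ext fun u => ?_)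
  rw [← inner_sphereVec_spaceDeriv (y := y), h, inner_zero_left, _root_.zero_apply]

/-- The great circle through `y` in the direction of `η`. -/
def greatCircle (y : Metric.sphere (0 : E) 1) (η : Covec n) (s : ℝ) : E :=
  Real.cos s • (y : E) + Real.sin s • (‖sphereVec y η‖⁻¹ • sphereVec y η)

/-- The velocity along a great circle, multiplied by the length of the covector. -/
def greatCircleVec (y : Metric.sphere (0 : E) 1) (η : Covec n) (s : ℝ) : E :=
  -(Real.sin s * ‖sphereVec y η‖) • (y : E) + Real.cos s • sphereVec y η

lemma norm_greatCircle (hη : η ≠ 0) (s : ℝ) : ‖greatCircle y η s‖ = 1 := by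
  have h0 := norm_pos_iff.2 (sphereVec_ne_zero (y := y) hη)
  have hy : ‖(y : E)‖ = 1 := norm_eq_of_mem_sphere y
  have h1 : ‖greatCircle y η s‖ ^ 2 = 1 := by
    rw [greatCircle, norm_add_sq_real]
    simp only [norm_smul, inner_smul_left, inner_smul_right, inner_sphereVec, hy, norm_inv,
      abs_norm, inv_mul_cancel₀ h0.ne', mul_zero, add_zero, mul_one, Real.norm_eq_abs, sq_abs]
    exact Real.cos_sq_add_sin_sq s
  nlinarith [norm_nonneg (greatCircle y η s)]

lemma norm_greatCircleVec (s : ℝ) : ‖greatCircleVec y η s‖ = ‖sphereVec y η‖ := by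
  have hy : ‖(y : E)‖ = 1 := norm_eq_of_mem_sphere y
  have h1 : ‖greatCircleVec y η s‖ ^ 2 = ‖sphereVec y η‖ ^ 2 := by
    rw [greatCircleVec, norm_add_sq_real]
    simp only [norm_smul, inner_smul_left, inner_smul_right, inner_sphereVec, hy, norm_neg,
      mul_zero, add_zero, mul_one, Real.norm_eq_abs, mul_pow, sq_abs]
    linear_combination ‖sphereVec y η‖ ^ 2 * Real.sin_sq_add_cos_sq s
  exact (pow_left_inj₀ (norm_nonneg _) (norm_nonneg _) two_ne_zero).1 h1

lemma inner_greatCircle (s : ℝ) : ⟪greatCircle y η s, greatCircleVec y η s⟫ = 0 := by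
  have hy : ⟪(y : E), (y : E)⟫ = 1 := by
    rw [real_inner_self_eq_norm_sq, norm_eq_of_mem_sphere y, one_pow]
  have h2 : ⟪sphereVec y η, (y : E)⟫ = 0 := by rw [real_inner_comm, inner_sphereVec]
  rw [greatCircle, greatCircleVec]
  simp only [inner_add_left, inner_add_right, inner_smul_left, inner_smul_right, inner_sphereVec,
    h2, hy, real_inner_self_eq_norm_sq]
  by_cases h : ‖sphereVec y η‖ = 0
  · simp [h]
  · simp
    field_simp
    ring

lemma hasDerivAt_greatCircle (hη : η ≠ 0) (s : ℝ) : HasDerivAt (greatCircle y η)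
    (‖greatCircleVec y η s‖⁻¹ • greatCircleVec y η s) s := by
  have h0 := (norm_pos_iff.2 (sphereVec_ne_zero (y := y) hη)).ne'
  refine (((Real.hasDerivAt_cos s).smul_const (y : E)).add
    ((Real.hasDerivAt_sin s).smul_const (‖sphereVec y η‖⁻¹ • sphereVec y η))).congr_deriv ?_
  rw [norm_greatCircleVec, greatCircleVec, smul_add, smul_smul, smul_smul, smul_smul]
  congr 2
  · field_simp
  · ring

lemma hasDerivAt_greatCircleVec (hη : η ≠ 0) (s : ℝ) : HasDerivAt (greatCircleVec y η)
    (-‖sphereVec y η‖ • greatCircle y η s) s := by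
  have h0 := (norm_pos_iff.2 (sphereVec_ne_zero (y := y) hη)).ne'
  refine ((((Real.hasDerivAt_sin s).mul_const ‖sphereVec y η‖).neg.smul_const (y : E)).add
    ((Real.hasDerivAt_cos s).smul_const (sphereVec y η))).congr_deriv ?_
  rw [greatCircle, smul_add, smul_smul, smul_smul, smul_smul]
  congr 2
  · ring
  · field_simp

/-- The great circle as a curve in the sphere. -/
def sphereCurve (y : Metric.sphere (0 : E) 1) (hη : η ≠ 0) (s : ℝ) : Metric.sphere (0 : E) 1 :=
  ⟨greatCircle y η s, mem_sphere_zero_iff_norm.2 (norm_greatCircle hη s)⟩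

lemma contMDiff_sphereCurve (hη : η ≠ 0) :
    ContMDiff 𝓘(ℝ, ℝ) (𝓡 n) ∞ (sphereCurve y hη) := by
  have h : ContMDiff 𝓘(ℝ, ℝ) 𝓘(ℝ, E) ∞ (greatCircle y η) :=
    ((Real.contDiff_cos.smul contDiff_const).add
      (Real.contDiff_sin.smul contDiff_const)).contMDiff
  exact h.codRestrict_sphere (n := n)
    fun s => mem_sphere_zero_iff_norm.2 (norm_greatCircle hη s)

/-- The derivative of the ambient momentum along a great circle is a multiple of the position
vector, which is normal to the sphere. -/
lemma solvesAt_sphereCurve (hη : η ≠ 0) (s : ℝ) :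
    SolvesAt (roundMetric n E)
      (fun s => spaceCovector (Subtype.val : Metric.sphere (0 : E) 1 → E) (sphereCurve y hη s)
        (greatCircleVec y η s)) s := by
  refine solvesAt_spaceCovector _ _ ((contMDiff_sphereCurve hη s).mdifferentiableAt (by simp))
    (hasDerivAt_greatCircle hη s) (hasDerivAt_greatCircleVec hη s) ?_
    (mem_range_spaceDeriv_sphere.2 (inner_greatCircle s)) fun u => ?_
  · rw [← norm_pos_iff, norm_greatCircleVec]
    exact norm_pos_iff.2 (sphereVec_ne_zero hη)
  · rw [inner_smul_left]
    exact mul_eq_zero_of_right _ (inner_spaceDeriv_sphere (sphereCurve y hη s) u)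

variable [FiniteDimensional ℝ E]

/-- The cogeodesic flow of the round sphere. -/
lemma flow_roundMetric (hη : η ≠ 0) (s : ℝ) :
    flow (roundMetric n E) s (covectorAt y η) =
      spaceCovector (Subtype.val : Metric.sphere (0 : E) 1 → E) (sphereCurve y hη s)
        (greatCircleVec y η s) := by
  have : ProperSpace E := FiniteDimensional.proper ℝ E
  refine flow_eq_of_solvesAt (a := |s| + 1) (γ := fun s => spaceCovector
    (Subtype.val : Metric.sphere (0 : E) 1 → E) (sphereCurve y hη s) (greatCircleVec y η s))
    hη ?_ (fun τ _ => solvesAt_sphereCurve hη τ) (lt_add_one _)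
  have h1 : sphereCurve y hη 0 = y := Subtype.ext (by simp [sphereCurve, greatCircle])
  have h2 : greatCircleVec y η 0 = sphereVec y η := by simp [greatCircleVec]
  simp only [h1, h2, spaceCovector_sphereVec]

end Sphere
end Cogeodesic

end

/-! ### Degeneracy of `Q` and `P` after a quarter period -/

section
set_option maxSynthPendingDepth 3
namespace Cogeodesic
open Set
open scoped RealInnerProductSpace

section Line
variable {d : ℕ} {M : Type*} [TopologicalSpace M] [ChartedSpace (Vec d) M] [IsManifold (𝓡 d) ∞ M]
variable [T2Space M] [CompactSpace M] {g : RiemMetric d M} {y x₀ : M} {t : ℝ} {η : Covec d}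

/-- Directional derivatives along lines of momenta suffice to evaluate the forms on a single
increment, using the explicit flow. -/
lemma hasDerivAt_leafChart_line (h : (t, η) ∈ leafDomain g y x₀) (u : Covec d) :
    HasDerivAt (fun s : ℝ => leafChart g y x₀ (t, η + s • u)) (leafDeriv g y x₀ t η u) 0 := by
  have h1 : HasDerivAt (fun s : ℝ => η + s • u) u 0 :=
    (((hasDerivAt_id (0 : ℝ)).smul_const u).const_add η).congr_deriv (one_smul ℝ u)
  have h2 : HasFDerivAt (fun η => leafChart g y x₀ (t, η)) (leafDeriv g y x₀ t η)
      (η + (0 : ℝ) • u) := by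
    simpa using hasFDerivAt_leafChart h
  exact HasFDerivAt.comp_hasDerivAt (l := fun η => leafChart g y x₀ (t, η)) 0 h2 h1

lemma eventually_line_mem_leafDomain (h : (t, η) ∈ leafDomain g y x₀) (u : Covec d) :
    ∀ᶠ s : ℝ in 𝓝 0, (t, η + s • u) ∈ leafDomain g y x₀ := by
  have hc : Continuous fun s : ℝ => (t, η + s • u) := by fun_prop
  exact hc.continuousAt.eventually_mem ((isOpen_leafDomain g y x₀).mem_nhds (by simpa using h))

end Line

section Sphere
variable {n : ℕ} {E : Type*} [NormedAddCommGroup E] [InnerProductSpace ℝ E]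
  [Fact (Module.finrank ℝ E = n + 1)] [FiniteDimensional ℝ E]
variable {y : Metric.sphere (0 : E) 1} {η : Covec n}

lemma greatCircle_pi_div_two : greatCircle y η (Real.pi / 2) =
    ‖sphereVec y η‖⁻¹ • sphereVec y η := by
  simp [greatCircle]

lemma greatCircleVec_pi_div_two : greatCircleVec y η (Real.pi / 2) = -‖sphereVec y η‖ • (y : E) := by
  simp [greatCircleVec]

/-- A quarter period after the start, the position form of the round sphere is degenerate in the
radial direction. -/
lemma positionForm_roundMetric (hη : η ≠ 0) :
    positionForm (roundMetric n E) y (Real.pi / 2) η η η = 0 := by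
  have : ProperSpace E := FiniteDimensional.proper ℝ E
  set g := roundMetric n E
  set x₀ := xStar g y (Real.pi / 2) η
  have hmem : (Real.pi / 2, η) ∈ leafDomain g y x₀ := mem_leafDomain_self hη
  have h1 := (ContinuousLinearMap.fst ℝ (Vec n) (Covec n)).hasFDerivAt.comp_hasDerivAt 0
    (hasDerivAt_leafChart_line hmem η)
  have h2 : (leafDeriv g y x₀ (Real.pi / 2) η η).1 = 0 := by
    refine h1.unique ((hasDerivAt_const (0 : ℝ)
      (extChartAt (𝓡 n) x₀ (sphereCurve y hη (Real.pi / 2)))).congr_of_eventuallyEq ?_)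
    -- For `s > -1` the momentum `(1 + s) η` is a positive multiple of `η`, so the great circle and
    -- its quarter point do not change.
    filter_upwards [Ioi_mem_nhds (show (-1 : ℝ) < 0 by norm_num),
      eventually_line_mem_leafDomain hmem η] with s hs hs'
    have hs1 : 0 < 1 + s := by linarith [mem_Ioi.1 hs]
    have e : sphereVec y (η + s • η) = (1 + s) • sphereVec y η := by
      rw [map_add, map_smul, add_smul, one_smul]
    change extChartAt (𝓡 n) x₀ (flow g (Real.pi / 2) (covectorAt y (η + s • η))).1 = _
    rw [flow_roundMetric hs'.1]
    refine congrArg (extChartAt (𝓡 n) x₀) (Subtype.ext ?_)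
    change greatCircle y (η + s • η) _ = greatCircle y η _
    rw [greatCircle_pi_div_two, greatCircle_pi_div_two, e, norm_smul, Real.norm_of_nonneg hs1.le,
      smul_smul, mul_inv, mul_right_comm, inv_mul_cancel₀ hs1.ne', one_mul]
  rw [positionForm_self hη, h2]
  simp

/-- The squared norm has derivative `2⟪v, w⟫ = 0`, and the square root is smooth away from zero. -/
lemma hasDerivAt_norm_add_smul {F : Type*} [NormedAddCommGroup F] [InnerProductSpace ℝ F]
    {v w : F} (hv : v ≠ 0) (h : ⟪v, w⟫ = 0) :
    HasDerivAt (fun s : ℝ => ‖v + s • w‖) 0 0 := by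
  have h1 : HasDerivAt (fun s : ℝ => v + s • w) w 0 :=
    (((hasDerivAt_id (0 : ℝ)).smul_const w).const_add v).congr_deriv (one_smul ℝ w)
  have h2 := (h1.norm_sq).sqrt (by simpa using hv)
  simpa [Real.sqrt_sq, h] using h2

/-- A quarter period after the start, the momentum form of the round sphere is degenerate in the
directions orthogonal to the radial one. -/
lemma momentumForm_roundMetric (hη : η ≠ 0) {u : Covec n}
    (hu : ⟪sphereVec y η, sphereVec y u⟫ = 0) :
    momentumForm (roundMetric n E) y (Real.pi / 2) η u u = 0 := by
  have : ProperSpace E := FiniteDimensional.proper ℝ E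
  set g := roundMetric n E
  set x₀ := xStar g y (Real.pi / 2) η with hx₀
  have hmem : (Real.pi / 2, η) ∈ leafDomain g y x₀ := mem_leafDomain_self hη
  have h1 := hasDerivAt_leafChart_line hmem u
  have hev := eventually_line_mem_leafDomain hmem u
  -- At the quarter period the ambient momentum is `-|η| y`; an orthogonal increment leaves its
  -- length, and so the vector itself, unchanged to first order.
  have hV : HasDerivAt (fun s : ℝ => -‖sphereVec y (η + s • u)‖ • (y : E)) 0 0 := by
    have h2 := (hasDerivAt_norm_add_smul (sphereVec_ne_zero (y := y) hη) hu).neg.smul_const (y : E)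
    simpa using h2
  have hchart : ∀ᶠ s : ℝ in 𝓝 0, (leafChart g y x₀ (Real.pi / 2, η + s • u)).2 =
      paramCovector n (Subtype.val : Metric.sphere (0 : E) 1 → E) x₀
        (leafChart g y x₀ (Real.pi / 2, η + s • u)).1 (-‖sphereVec y (η + s • u)‖ • (y : E)) := by
    filter_upwards [hev] with s hs
    have hne : η + s • u ≠ 0 := hs.1
    have hflow := flow_roundMetric (y := y) hne (Real.pi / 2)
    have hs2 : sphereCurve y hne (Real.pi / 2) ∈ (chartAt (Vec n) x₀).source := by
      have := hs.2
      rwa [hflow] at this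
    have e : leafChart g y x₀ (Real.pi / 2, η + s • u) = _ :=
      (congrArg (cochart n x₀) hflow).trans (cochart_spaceCovector contMDiff_coe_sphere hs2 _)
    rw [e, greatCircleVec_pi_div_two]
  have hx : x₀ = sphereCurve y hη (Real.pi / 2) := by
    rw [hx₀, xStar, flow_roundMetric hη]; rfl
  have htan : -‖sphereVec y η‖ • (y : E) ∈ range (fderiv ℝ
      (param n (Subtype.val : Metric.sphere (0 : E) 1 → E) x₀)
        (leafChart g y x₀ (Real.pi / 2, η)).1) := by
    rw [leafChart_self]
    simp only
    rw [range_fderiv_param contMDiff_coe_sphere (mem_chart_source _ _),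
      mem_range_spaceDeriv_sphere, ← greatCircleVec_pi_div_two, hx]
    exact inner_greatCircle (y := y) (η := η) (Real.pi / 2)
  have h0 : η + (0 : ℝ) • u = η := by simp
  have hcov := covDer_inducedMetric (x₀ := x₀) contMDiff_coe_sphere injective_spaceDeriv_sphere
    h1 hV (by rw [h0]; exact leafChart_fst_mem hmem) hchart (by rw [h0]; exact htan)
  have h4 : momentumDeriv g y x₀ (Real.pi / 2) η u = 0 := by
    rw [h0] at hcov
    refine hcov.trans ?_
    ext v
    simp [paramCovector]
  rw [momentumForm_self hη, h4]
  simp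

end Sphere

/-- Neither the position form nor the momentum form need be a Riemannian metric: on the round sphere
both are degenerate a quarter period after the start. -/
lemma exists_not_isRiemannianMetricOnLeaf :
    ∃ (d : ℕ) (_ : 2 ≤ d) (M : Type) (_ : TopologicalSpace M) (_ : ChartedSpace (Vec d) M)
      (_ : IsManifold (𝓡 d) ∞ M) (_ : T2Space M) (_ : CompactSpace M) (_ : ConnectedSpace M)
      (g : RiemMetric d M) (y : M) (t : ℝ),
      ¬ IsRiemannianMetricOnLeaf g y t (positionForm g y t) ∧
      ¬ IsRiemannianMetricOnLeaf g y t (momentumForm g y t) := by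
  have hrank : Module.finrank ℝ (EuclideanSpace ℝ (Fin 3)) = 2 + 1 := finrank_euclideanSpace_fin
  have : Fact (Module.finrank ℝ (EuclideanSpace ℝ (Fin 3)) = 2 + 1) := ⟨hrank⟩
  have hconn : ConnectedSpace (Metric.sphere (0 : EuclideanSpace ℝ (Fin 3)) 1) :=
    isConnected_iff_connectedSpace.1 (isConnected_sphere (by
      rw [← Module.finrank_eq_rank, hrank]; norm_num) 0 zero_le_one)
  obtain ⟨y⟩ := hconn.toNonempty
  refine ⟨2, le_rfl, Metric.sphere (0 : EuclideanSpace ℝ (Fin 3)) 1, inferInstance,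
    EuclideanSpace.instChartedSpaceSphere, inferInstance, inferInstance, inferInstance, hconn,
    roundMetric 2 (EuclideanSpace ℝ (Fin 3)), y, Real.pi / 2, ?_, ?_⟩
  all_goals
    intro h
    obtain ⟨η, hη⟩ : ∃ η : Covec 2, η ≠ 0 := exists_ne 0
  · exact (h.pos hη hη).ne' (positionForm_roundMetric hη)
  -- The null direction of `P` comes from the kernel of one linear functional on the two-dimensional
  -- space of covectors, which is nontrivial.
  · obtain ⟨u, hu, hu0⟩ := Submodule.exists_mem_ne_zero_of_ne_bot
      (LinearMap.ker_ne_bot_of_finrank_lt (K := ℝ) (V := Covec 2) (V₂ := ℝ)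
        (f := ((innerSL ℝ (sphereVec y η)).comp (sphereVec y)).toLinearMap) (by
          rw [Module.finrank_self, (LinearMap.toContinuousLinearMap (𝕜 := ℝ) (E := Vec 2)
            (F' := ℝ)).symm.finrank_eq]
          simp))
    exact (h.pos hη hu0).ne' (momentumForm_roundMetric hη hu)

end Cogeodesic

end

end

theorem theorem10p1 :
    -- `(M, g)` is a connected closed Riemannian manifold of dimension `d ≥ 2`
    (∀ (d : ℕ), 2 ≤ d → ∀ (M : Type*) [TopologicalSpace M] [ChartedSpace (Vec d) M]
      [IsManifold (𝓡 d) ∞ M] [T2Space M] [CompactSpace M] [ConnectedSpace M] (g : RiemMetric d M),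
      -- the cogeodesic flow is defined on `T'M` for all times
      (∀ p : CotangentBundle d M, p.2 ≠ 0 →
        flow g 0 p = p ∧ IsHamiltonianCurve g (fun s : ℝ => flow g s p)) ∧
      ∀ (y : M) (t : ℝ),
        -- `𝒯_y(t)` is Lagrangian
        (∀ η : Covec d, η ≠ 0 → ∀ u v : Covec d,
          symplecticForm (flowDeriv g y t η u) (flowDeriv g y t η v) = 0) ∧
        -- `a h² Q + b P` is a Riemannian metric on the submanifold `𝒯_y(t)`
        ∀ a b : ℝ, 0 < a → 0 < b →
          IsRiemannianMetricOnLeaf g y t (fun η u v =>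
            a * hamiltonian g (covectorAt y η) ^ 2 * positionForm g y t η u v +
              b * momentumForm g y t η u v)) ∧
    -- neither `Q` nor `P` need be a Riemannian metric
    (∃ (d : ℕ) (_ : 2 ≤ d) (M : Type) (_ : TopologicalSpace M) (_ : ChartedSpace (Vec d) M)
      (_ : IsManifold (𝓡 d) ∞ M) (_ : T2Space M) (_ : CompactSpace M) (_ : ConnectedSpace M)
      (g : RiemMetric d M) (y : M) (t : ℝ),
      ¬ IsRiemannianMetricOnLeaf g y t (positionForm g y t) ∧
      ¬ IsRiemannianMetricOnLeaf g y t (momentumForm g y t)) := by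
  refine ⟨fun d hd M _ _ _ _ _ _ g => ⟨fun p hp => flow_spec g hp, fun y t =>
    ⟨fun η hη u v => symplecticForm_flowDeriv hη u v, fun a b ha hb => ?_⟩⟩, ?_⟩
  · have := nonempty_leaf (one_le_two.trans hd) g y t
    exact isRiemannianMetricOnLeaf_combined ha hb
  · exact exists_not_isRiemannianMetricOnLeaf
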